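/- **Setting.** Let $N\ge 2$, $\omega=e^{2\pi i/N}$, let $X|n\rangle=|n+1\rangle$, $Z|n\rangle=\omega^n|n\rangle$ on $\mathbb C^N$ ($n\in\mathbb Z_N$), and let $L\ge1$ be a chain length (site $L+1$ is site $1$). For parameters $P=(a,b,a',b',c)$ put $$\mathsf L(t)=\begin{pmatrix}A&B\\C&D\end{pmatrix}=\begin{pmatrix}1-t\frac{c}{b'b}X & \big(\frac1b-\omega\frac{ac}{b'b}X\big)Z\\ -t\big(\frac1{b'}-\frac{a'c}{b'b}X\big)Z^{-1} & -\frac{t}{b'b}+\omega\frac{a'ac}{b'b}X\end{pmatrix},$$ $\tau^{(2)}_P(t)=\mathrm{tr}_{\mathbb C^2}\bigotimes_{\ell=1}^L\mathsf L_\ell(\omega t)$ and $C_{\xi,\eta}(t)=\xi A+C-\xi B\eta-D\eta$. The gauge and scale transformations are $(a,b,a',b',c)\mapsto(\lambda\nu^{-1}a,\nu b,\nu a',\lambda\nu^{-1}b',c)$, $\lambda,\nu\in\mathbb C^*$. A rapidity is $q=(x_q,y_q,\mu_q)\in\mathbb C^3$ with $\mu_q\neq 0$; $t_q=x_qy_q$,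 $R(x,y,\mu)=(y,\omega x,\mu^{-1})$, $U(x,y,\mu)=(\omega x,y,\mu)$. The weights are normalised by $W_{p,q}(0)=\overline W_{p,q}(0)=1$: $$W_{p,q}(n)=\Big(\frac{\mu_p}{\mu_q}\Big)^n\prod_{j=1}^n\frac{y_q-\omega^jx_p}{y_p-\omega^jx_q},\qquad \overline W_{p,q}(n)=(\mu_p\mu_q)^n\prod_{j=1}^n\frac{\omega x_p-\omega^jx_q}{y_q-\omega^jy_p},$$ $$T_{p,p'}(q)_{\{j\},\{j'\}}=\prod_{\ell=1}^L W_{p,q}(j_\ell-j'_\ell)\overline W_{p',q}(j_{\ell+1}-j'_\ell),\qquad \widehat T_{p,p'}(q)_{\{j\},\{j'\}}=\prod_{\ell=1}^L\overline W_{p,q}(j_\ell-j'_\ell)W_{p',q}(j_\ell-j'_{\ell+1}).$$ The $\tau^{(2)}$-model of $p,p'$, denoted $\tau^{(2)}_{p,p'}$, has $P=(x_p,y_p,x_{p'},y_{p'},\mu_p\mu_{p'})$. The curves are: $\mathfrak W_{k'}$: $kx^N=1-k'\mu^{-N}$, $ky^N=1-k'\mu^N$ with $k^2+k'^2=1$,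 $k'\ne0,\pm1$; the self-dual curves $x^N+y^N=0,\ \mu^N=\varepsilon$ (with a fixed $\varepsilon\in\{1,-1\}$); $x^N+y^N=1,\ \mu^N=1$; $x^N+y^N=x^Ny^N,\ \mu^N=1-y^N$; and, for $k'=0$, $\mathfrak C_+$: $x^N=1,\ \mu^N=1-y^N$ and $\mathfrak C_-$: $y^N=1,\ \mu^{-N}=1-x^N$ ($\mu$ finite and non-zero). **(1) Identification.** Let $p,p',q$ lie on one common curve, which is $\mathfrak W_{k'}$ or one of the self-dual curves, with $y_p,y_{p'}\ne0$. (R) Suppose $x_q^N\ne y_p^N$ and $y_q^N\ne y_{p'}^N$. Then $W_{p,q}$ and $\overline W_{p',q}$ are $N$-periodic. If $x_q\ne0$, then for all $i,j\in\mathbb Z_N$ the kernel of $C_{\xi,\eta}(t_q)$ with $\xi=\omega^{-i}x_q$, $\eta=\omega^{-j}x_q$ is one-dimensional, spanned by the vector $v^{ij}$ with $$\frac{v_n}{v_{n-1}}=\frac{c(\omega a'-\omega^n\xi)(t_q-\omega^na\eta)}{(b-\omega^n\eta)(t_q-\omega^nb'\xi)},\qquad v^{ij}_0=\overline W_{p',q}(-i)W_{p,q}(-j);$$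 one has $v^{ij}_n=\overline W_{p',q}(n-i)W_{p,q}(n-j)$, and $Q_R(q):=\mathrm{tr}_{\mathbb C^N}\bigotimes_\ell \mathsf S_\ell$ with $\mathsf S_{i,j}=v^{ij}\langle j|$ satisfies $Q_R(q)=T_{p,p'}(q)$. Moreover (also when $x_q=0$) $$\tau^{(2)}_{p,p'}(\omega^{-1}t_q)T_{p,p'}(q)=\Big\{\tfrac{(y_p-x_q)(t_{p'}-\omega^{-1}t_q)}{y_py_{p'}(x_{p'}-\omega^{-1}x_q)}\Big\}^LT_{p,p'}(U^{-1}q)+\Big\{\tfrac{(y_{p'}-y_q)(t_p-t_q)}{y_py_{p'}(x_p-y_q)}\Big\}^LT_{p,p'}(R^2U^{-1}q).$$ (L) Suppose $y_q^N\ne y_p^N$ and $x_q^N\ne y_{p'}^N$. Then $\overline W_{p,q}$ and $W_{p',q}$ are $N$-periodic. If $y_q\ne0$, then for all $i,j$ the cokernel (left kernel) of $C_{\xi,\eta}(t_q)$ with $\xi=\omega^{-i}y_q$, $\eta=\omega^{-j}y_q$ is one-dimensional, spanned by the covector $v^{*ij}$ with $$\frac{v^{*n}}{v^{*n-1}}=\frac{(b-\omega^{n-1}\eta)(t_q-\omega^{n-1}b'\xi)}{c(a'-\omega^{n-1}\xi)(t_q-\omega^na\eta)},\qquad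 v^{*0}=W_{p',q}(i)\overline W_{p,q}(j);$$ one has $v^{*n}=W_{p',q}(i-n)\overline W_{p,q}(j-n)$, and $Q_L(q):=\mathrm{tr}_{\mathbb C^N}\bigotimes_\ell\widehat{\mathsf S}_\ell$ with $\widehat{\mathsf S}_{i,j}=|j\rangle v^{*ij}$ satisfies $Q_L(q)=\widehat T_{p,p'}(q)$. Moreover (also when $y_q=0$) $$\widehat T_{p,p'}(q)\tau^{(2)}_{p,p'}(\omega^{-1}t_q)=\Big\{\tfrac{(y_{p'}-x_q)(t_p-\omega^{-1}t_q)}{y_py_{p'}(x_p-\omega^{-1}x_q)}\Big\}^L\widehat T_{p,p'}(U^{-1}q)+\Big\{\tfrac{(y_p-y_q)(t_{p'}-t_q)}{y_py_{p'}(x_{p'}-y_q)}\Big\}^L\widehat T_{p,p'}(R^2U^{-1}q).$$ **(2) Commutation.** Let $p,p'$ lie on one of the self-dual curves, $y_p,y_{p'}\neq0$, and call $q$ on that curve regular if the hypotheses of both (R) and (L) hold. One can choose non-zero $f_{pq},f_{p'q}$ for all regular $q$, independent of $L$, with $f_{pq}^N=\det(\overline W_{p,q}(i-j))_{i,j\in\mathbb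 Z_N}/\prod_nW_{p,q}(n)$ and likewise for $p'$, such that for every $L$ and all regular $q,r$ $$T_{p,p'}(q)\widehat T_{p,p'}(r)=\Big(\tfrac{f_{p'q}f_{pr}}{f_{pq}f_{p'r}}\Big)^LT_{p,p'}(r)\widehat T_{p,p'}(q),\qquad \widehat T_{p,p'}(q)T_{p,p'}(r)=\Big(\tfrac{f_{pq}f_{p'r}}{f_{p'q}f_{pr}}\Big)^L\widehat T_{p,p'}(r)T_{p,p'}(q);$$ and whenever $q_0$ is regular with $T_{p,p'}(q_0),\widehat T_{p,p'}(q_0)$ invertible, the operators $Q(q)=\widehat T_{p,p'}(q_0)^{-1}\widehat T_{p,p'}(q)$ ($q$ regular) equal $\big(\frac{f_{pq}f_{p'q_0}}{f_{p'q}f_{pq_0}}\big)^LT_{p,p'}(q)T_{p,p'}(q_0)^{-1}$ and commute with one another. **(3) The case $k'=0$.** If $p\in\mathfrak C_-$, $p'\in\mathfrak C_+$, $y_{p'}\neq0$, the conclusions of (R) hold for all $q\in\mathfrak C_-$ and those of (L) for all $q\in\mathfrak C_+$. If $p\in\mathfrak C_+$, $p'\in\mathfrak C_-$, $y_p\neq0$,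 the conclusions of (R) hold for all $q\in\mathfrak C_+$ and those of (L) for all $q\in\mathfrak C_-$. **(4) Non-generic models.** Call $P\in\mathbb C^{*5}$ generic if either $c^N=1$, $b^N=a'^N$, $b'^N=a^N$, or $c^N\neq1$ and $(b^N-a'^N)(b'^N-a^N)(b^N-a'^Nc^N)(b'^N-a^Nc^N)(b^Nb'^N-a^Na'^Nc^N)\ne0$. Let $P\in\mathbb C^{*5}$ be non-generic with $(c^Na'^N-b^N)(c^Na^N-b'^N)\ne0$. Then there are $\lambda,\nu\in\mathbb C^*$ and $p,p'$ such that the transform of $P$ is $(x_p,y_p,x_{p'},y_{p'},\mu_p\mu_{p'})$ and $\tau^{(2)}_P(t)=\tau^{(2)}_{p,p'}(\lambda t)$ for all $t$ and $L$, where $p,p'$ lie: on $x^N+y^N=0$, $\mu^N=1$ if $c^N=1$, $b^Nb'^N=a^Na'^N$; on $x^N+y^N=1$, $\mu^N=1$ if $c^N=1$, $b^Nb'^N\ne a^Na'^N$; on $x^N+y^N=x^Ny^N$, $\mu^N=1-y^N$ if $c^N\ne1$, $b^Nb'^N=c^Na^Na'^N$; $p\in\mathfrak C_-$, $p'\in\mathfrak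 C_+$ if $c^N\neq1$, $a'^N=b^N$, $a^N\ne b'^N$; $p\in\mathfrak C_+$, $p'\in\mathfrak C_-$ if $c^N\ne1$, $a^N=b'^N$, $a'^N\ne b^N$. The only remaining possibility is $c^N\ne1$, $a'^N=b^N$, $a^N=b'^N$; then $P$ is only asserted to be transformable to parameters with $a^N=b^N=a'^N=b'^N=1$ (for which no $\mu_p,\mu_{p'}$ finite and non-zero exist on $\mathfrak C_\pm$). **(5) XXZ chains.** Let $N$ be odd, $\varsigma\in\mathbb C^*$, $\mathsf q=\omega^{(N+1)/2}$ (so $\mathsf q^2=\omega$, $\mathsf q^N=1$). Then $K^{\pm1/2}=X^{\mp(N+1)/2}$, $e=\frac{(1-\varsigma^{-1}X)ZK^{1/2}}{\mathsf q-\mathsf q^{-1}}$, $f=-\frac{(1-\varsigma X)Z^{-1}K^{1/2}}{\mathsf q-\mathsf q^{-1}}$ satisfy $K^{1/2}eK^{-1/2}=\mathsf qe$, $K^{1/2}fK^{-1/2}=\mathsf q^{-1}f$, $[e,f]=\frac{K-K^{-1}}{\mathsf q-\mathsf q^{-1}}$, i.e. define a representation of $U_{\mathsf q}(sl_2)$;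 and for $s\ne0$ the XXZ transfer matrix $$\mathrm{tr}_{\mathbb C^2}\bigotimes_{\ell=1}^L\begin{pmatrix}s^{-1}K^{1/2}-sK^{-1/2}&(\mathsf q-\mathsf q^{-1})e\\(\mathsf q-\mathsf q^{-1})f&s^{-1}K^{-1/2}-sK^{1/2}\end{pmatrix}_\ell$$ equals $s^{-L}\,\tau^{(2)}_P(\omega^{-1}s^2)\,(K^{1/2})^{\otimes L}$ with $P=(\omega^{-1}\varsigma^{-1},1,\varsigma,1,1)$. If $\varsigma^N\ne1$, then $e^N,f^N$ are non-zero scalars, $P$ is non-generic with $(c^Na'^N-b^N)(c^Na^N-b'^N)\neq0$, and the model is that of points of the self-dual curve $x^N+y^N=0$, $\mu^N=1$: for all $\kappa,\rho$ with $\kappa^N=i$, $\rho^2=\varsigma$, the transformation $\lambda=1$, $\nu=\kappa\rho^{-1}$ carries $P$ to $p=(\omega^{-1}\kappa^{-1}\rho^{-1},\kappa\rho^{-1},1)$, $p'=(\kappa\rho,\kappa^{-1}\rho,1)$, and for all $\theta$ with $\theta^N=-1$, the transformation $\lambda=\theta\varsigma$, $\nu=1$ carries $P$ to $p=(\theta\omega^{-1},1,1)$,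 $p'=(\varsigma,\theta\varsigma,1)$; in both cases $\tau^{(2)}_P(t)=\tau^{(2)}_{p,p'}(\lambda t)$ for all $t$ and $L$. -/

import Mathlib

noncomputable section

namespace ChiralPotts

open Matrix

/-- The root of unity `ω = exp (2πi/N)`. -/
def omega (N : ℕ) : ℂ := Complex.exp (2 * Real.pi * Complex.I / N)

/-- `ω ^ i` for `i` an integer modulo `N`. -/
def omegaZ (N : ℕ) (i : ZMod N) : ℂ := omega N ^ i.val

/-- Operators on the local quantum space `ℂ^N`, with basis indexed by `ℤ/N`. -/
abbrev SiteOp (N : ℕ) := Matrix (ZMod N) (ZMod N) ℂ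

/-- Operators on the `L`-fold tensor power of `ℂ^N`, written in the tensor basis. -/
abbrev ChainOp (N L : ℕ) := Matrix (Fin L → ZMod N) (Fin L → ZMod N) ℂ

/-- `X |n⟩ = |n+1⟩`. -/
def weylX (N : ℕ) : SiteOp N := Matrix.of fun m n => if m = n + 1 then 1 else 0

/-- `Z |n⟩ = ω^n |n⟩`. -/
def weylZ (N : ℕ) : SiteOp N := Matrix.diagonal fun n => omegaZ N n

/-- For a local operator `M` with auxiliary indices in `α` and entries acting on `ℂ^N`, the trace
over the auxiliary space of the ordered product of `L` copies of `M`, the `l`-th copy acting on the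
`l`-th tensor factor; `l + 1` is taken modulo `L`. -/
def chainTrace {N : ℕ} (L : ℕ) [NeZero L] {α : Type} [Fintype α]
    (M : α → α → SiteOp N) : ChainOp N L :=
  Matrix.of fun j j' => ∑ i : Fin L → α, ∏ l : Fin L, M (i l) (i (l + 1)) (j l) (j' l)

/-- The tensor power of a one-site operator. -/
def siteProduct {N : ℕ} (L : ℕ) (M : SiteOp N) : ChainOp N L :=
  Matrix.of fun j j' => ∏ l : Fin L, M (j l) (j' l)

/-! ### The generalized tau-two model -/

/-- The five parameters `(a, b, a', b', c)` of the `L`-operator. -/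
structure LParams where
  a : ℂ
  b : ℂ
  a' : ℂ
  b' : ℂ
  c : ℂ

/-- All five parameters are non-zero. -/
def LParams.Nonvanishing (P : LParams) : Prop :=
  P.a ≠ 0 ∧ P.b ≠ 0 ∧ P.a' ≠ 0 ∧ P.b' ≠ 0 ∧ P.c ≠ 0

section Model

variable (N : ℕ) [NeZero N] (P : LParams)

def opA (t : ℂ) : SiteOp N := 1 - (t * (P.c / (P.b' * P.b))) • weylX N

def opB (_t : ℂ) : SiteOp N :=
  ((1 / P.b) • (1 : SiteOp N) - (omega N * (P.a * P.c / (P.b' * P.b))) • weylX N) * weylZ N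

def opC (t : ℂ) : SiteOp N :=
  (-t) • (((1 / P.b') • (1 : SiteOp N) - (P.a' * P.c / (P.b' * P.b)) • weylX N) * (weylZ N)⁻¹)

def opD (t : ℂ) : SiteOp N :=
  (-(t * (1 / (P.b' * P.b)))) • (1 : SiteOp N)
    + (omega N * (P.a' * P.a * P.c / (P.b' * P.b))) • weylX N

/-- The `L`-operator, a two by two matrix of operators on `ℂ^N`. -/
def lOp (t : ℂ) : Matrix (Fin 2) (Fin 2) (SiteOp N) :=
  !![opA N P t, opB N P t; opC N P t, opD N P t]

/-- `τ^{(2)}(t)`, the trace of the monodromy matrix at `ω t`. -/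
def tau2 (L : ℕ) [NeZero L] (t : ℂ) : ChainOp N L :=
  chainTrace L (lOp N P (omega N * t))

/-- `C_{ξ,η}(t) = ξ A + C - ξ B η - D η`. -/
def opCxi (t ξ η : ℂ) : SiteOp N :=
  ξ • opA N P t + opC N P t - (ξ * η) • opB N P t - η • opD N P t

/-- The cyclic vector with prescribed zeroth coordinate `v₀` whose successive ratios
`v_n / v_{n-1}` are those of a kernel vector of `C_{ξ,η}(t)`. -/
def kernelVec (t ξ η v₀ : ℂ) : ZMod N → ℂ := fun n =>
  v₀ * ∏ m ∈ Finset.range n.val,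
    (P.c * (omega N * P.a' - omega N ^ (m + 1) * ξ) * (t - omega N ^ (m + 1) * P.a * η)) /
      ((P.b - omega N ^ (m + 1) * η) * (t - omega N ^ (m + 1) * P.b' * ξ))

/-- The cyclic covector with prescribed zeroth coordinate `v₀` whose successive ratios
`v^n / v^{n-1}` are those of a cokernel vector of `C_{ξ,η}(t)`. -/
def cokernelVec (t ξ η v₀ : ℂ) : ZMod N → ℂ := fun n =>
  v₀ * ∏ m ∈ Finset.range n.val,
    ((P.b - omega N ^ m * η) * (t - omega N ^ m * P.b' * ξ)) /
      (P.c * (P.a' - omega N ^ m * ξ) * (t - omega N ^ (m + 1) * P.a * η))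

/-- The `Q_R`-operator: `S_{i,j} = v(t; δ_i, δ_j) ⟨j|` with cyclic kernel vectors `v` of zeroth
coordinates `v₀ i j`. -/
def baxterQR (L : ℕ) [NeZero L] (t : ℂ) (δ : ZMod N → ℂ) (v₀ : ZMod N → ZMod N → ℂ) :
    ChainOp N L :=
  chainTrace L fun i j : ZMod N =>
    vecMulVec (kernelVec N P t (δ i) (δ j) (v₀ i j)) (Pi.single j 1)

/-- The `Q_L`-operator: `Ŝ_{i,j} = |j⟩ v^*(t; δ_i, δ_j)` with cyclic cokernel vectors `v^*` of
zeroth coordinates `v₀ i j`. -/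
def baxterQL (L : ℕ) [NeZero L] (t : ℂ) (δ : ZMod N → ℂ) (v₀ : ZMod N → ZMod N → ℂ) :
    ChainOp N L :=
  chainTrace L fun i j : ZMod N =>
    vecMulVec (Pi.single j 1) (cokernelVec N P t (δ i) (δ j) (v₀ i j))

end Model

/-- The simultaneous gauge transformation (by `ν`) and rescaling of the spectral variable
(by `lam`). -/
def LParams.gaugeScale (P : LParams) (lam ν : ℂ) : LParams where
  a := lam * ν⁻¹ * P.a
  b := ν * P.b
  a' := ν * P.a'
  b' := lam * ν⁻¹ * P.b'
  c := P.c

/-- The condition excluding the models with a pseudovacuum state. -/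
def LParams.NoPseudovacuum (N : ℕ) (P : LParams) : Prop :=
  (P.c ^ N * P.a' ^ N - P.b ^ N) * (P.c ^ N * P.a ^ N - P.b' ^ N) ≠ 0

/-- The genericity criterion: it characterises the models which are equivalent, by gauge and
scale transformations, to a chiral Potts model with `k' ≠ 0, ±1`. -/
def LParams.Generic (N : ℕ) (P : LParams) : Prop :=
  (P.c ^ N = 1 ∧ P.b ^ N - P.a' ^ N = 0 ∧ P.b' ^ N - P.a ^ N = 0) ∨
  (P.c ^ N ≠ 1 ∧
    (P.b ^ N - P.a' ^ N) * (P.b' ^ N - P.a ^ N) * (P.b ^ N - P.a' ^ N * P.c ^ N) *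
      (P.b' ^ N - P.a ^ N * P.c ^ N) *
      (P.b ^ N * P.b' ^ N - P.a ^ N * P.a' ^ N * P.c ^ N) ≠ 0)

/-! ### Rapidities, Boltzmann weights and transfer matrices -/

/-- A rapidity in the affine coordinates `(x, y, μ)`. -/
structure Rapidity where
  x : ℂ
  y : ℂ
  μ : ℂ

/-- `t = x y`. -/
def Rapidity.t (q : Rapidity) : ℂ := q.x * q.y

/-- `R : (x, y, μ) ↦ (y, ω x, μ⁻¹)`. -/
def autR (N : ℕ) (q : Rapidity) : Rapidity := ⟨q.y, omega N * q.x, q.μ⁻¹⟩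

/-- The inverse of `U : (x, y, μ) ↦ (ω x, y, μ)`. -/
def autUinv (N : ℕ) (q : Rapidity) : Rapidity := ⟨(omega N)⁻¹ * q.x, q.y, q.μ⟩

/-- The chiral Potts curve `W_{k'}`. -/
def curveW (N : ℕ) (k k' : ℂ) : Set Rapidity :=
  {q | q.μ ≠ 0 ∧ k * q.x ^ N = 1 - k' * (q.μ ^ N)⁻¹ ∧ k * q.y ^ N = 1 - k' * q.μ ^ N}

/-- The curve `x^N + y^N = 0`, with `μ^N = ε` (where `ε = k' = ±1`). -/
def curveZero (N : ℕ) (ε : ℂ) : Set Rapidity := {q | q.x ^ N + q.y ^ N = 0 ∧ q.μ ^ N = ε}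

/-- The Fermat curve `x^N + y^N = 1`, with `μ^N = 1`. -/
def curveFermat (N : ℕ) : Set Rapidity := {q | q.x ^ N + q.y ^ N = 1 ∧ q.μ ^ N = 1}

/-- The curve `x^N + y^N = x^N y^N`, with `μ^N = 1 - y^N`. -/
def curveProd (N : ℕ) : Set Rapidity :=
  {q | q.x ^ N + q.y ^ N = q.x ^ N * q.y ^ N ∧ q.μ ^ N = 1 - q.y ^ N}

/-- The component `x^N = 1`, `μ^N = 1 - y^N` of the `k' = 0` curve. -/
def curvePlus (N : ℕ) : Set Rapidity := {q | q.μ ≠ 0 ∧ q.x ^ N = 1 ∧ q.μ ^ N = 1 - q.y ^ N}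

/-- The component `y^N = 1`, `μ^{-N} = 1 - x^N` of the `k' = 0` curve. -/
def curveMinus (N : ℕ) : Set Rapidity :=
  {q | q.μ ≠ 0 ∧ q.y ^ N = 1 ∧ (q.μ ^ N)⁻¹ = 1 - q.x ^ N}

/-- The degenerate self-dual (`k' = 1`, or `±1` for the first one) rapidity curves. -/
def IsSelfDualCurve (N : ℕ) (S : Set Rapidity) : Prop :=
  S = curveZero N 1 ∨ S = curveZero N (-1) ∨ S = curveFermat N ∨ S = curveProd N

/-- The non-degenerate chiral Potts curves and the degenerate self-dual ones. -/
def IsPottsCurve (N : ℕ) (S : Set Rapidity) : Prop :=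
  (∃ k k' : ℂ, k ^ 2 + k' ^ 2 = 1 ∧ k' ≠ 0 ∧ k' ≠ 1 ∧ k' ≠ -1 ∧ S = curveW N k k') ∨
    IsSelfDualCurve N S

/-- The weight `W_{p,q}(n)`, normalised by `W_{p,q}(0) = 1`. -/
def weightW (N : ℕ) (p q : Rapidity) (n : ℕ) : ℂ :=
  (p.μ / q.μ) ^ n * ∏ j ∈ Finset.range n,
    (q.y - omega N ^ (j + 1) * p.x) / (p.y - omega N ^ (j + 1) * q.x)

/-- The weight `W̄_{p,q}(n)`, normalised by `W̄_{p,q}(0) = 1`. -/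
def weightWbar (N : ℕ) (p q : Rapidity) (n : ℕ) : ℂ :=
  (p.μ * q.μ) ^ n * ∏ j ∈ Finset.range n,
    (omega N * p.x - omega N ^ (j + 1) * q.x) / (q.y - omega N ^ (j + 1) * p.y)

/-- `W_{p,q}` as a function on `ℤ/N`. -/
def W (N : ℕ) (p q : Rapidity) (n : ZMod N) : ℂ := weightW N p q n.val

/-- `W̄_{p,q}` as a function on `ℤ/N`. -/
def Wbar (N : ℕ) (p q : Rapidity) (n : ZMod N) : ℂ := weightWbar N p q n.val

/-- The transfer matrix `T_{p,p'}(q)`. -/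
def transferT (N L : ℕ) [NeZero L] (p p' q : Rapidity) : ChainOp N L :=
  Matrix.of fun j j' => ∏ l : Fin L, W N p q (j l - j' l) * Wbar N p' q (j (l + 1) - j' l)

/-- The transfer matrix `T̂_{p,p'}(q)`. -/
def transferThat (N L : ℕ) [NeZero L] (p p' q : Rapidity) : ChainOp N L :=
  Matrix.of fun j j' => ∏ l : Fin L, Wbar N p q (j l - j' l) * W N p' q (j l - j' (l + 1))

/-- The parameters `(x_p, y_p, x_{p'}, y_{p'}, μ_p μ_{p'})` attached to two vertical rapidities. -/
def rapParams (p p' : Rapidity) : LParams := ⟨p.x, p.y, p'.x, p'.y, p.μ * p'.μ⟩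

/-- The denominators of the weights `W_{p,q}` and `W̄_{p',q}` occurring in `T_{p,p'}(q)` do not
vanish. -/
def RegularT (N : ℕ) (p p' q : Rapidity) : Prop := q.x ^ N ≠ p.y ^ N ∧ q.y ^ N ≠ p'.y ^ N

/-- The denominators of the weights `W̄_{p,q}` and `W_{p',q}` occurring in `T̂_{p,p'}(q)` do not
vanish. -/
def RegularThat (N : ℕ) (p p' q : Rapidity) : Prop := q.y ^ N ≠ p.y ^ N ∧ q.x ^ N ≠ p'.y ^ N

section Identification

variable (N : ℕ) [NeZero N] (p p' q : Rapidity)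

/-- The cyclic kernel vector of `C_{ξ,η}(t_q)` for `ξ = ω^{-i} x_q`, `η = ω^{-j} x_q`. -/
def potVec (i j : ZMod N) : ZMod N → ℂ :=
  kernelVec N (rapParams p p') q.t (omegaZ N (-i) * q.x) (omegaZ N (-j) * q.x)
    (Wbar N p' q (-i) * W N p q (-j))

/-- The cyclic cokernel vector of `C_{ξ,η}(t_q)` for `ξ = ω^{-i} y_q`, `η = ω^{-j} y_q`. -/
def potCovec (i j : ZMod N) : ZMod N → ℂ :=
  cokernelVec N (rapParams p p') q.t (omegaZ N (-i) * q.y) (omegaZ N (-j) * q.y)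
    (W N p' q i * Wbar N p q j)

/-- `Q_R(q)`: the `Q_R`-operator made from the vectors `potVec`. -/
def opQR (L : ℕ) [NeZero L] : ChainOp N L :=
  baxterQR N (rapParams p p') L q.t (fun i => omegaZ N (-i) * q.x)
    (fun i j => Wbar N p' q (-i) * W N p q (-j))

/-- `Q_L(q)`: the `Q_L`-operator made from the covectors `potCovec`. -/
def opQL (L : ℕ) [NeZero L] : ChainOp N L :=
  baxterQL N (rapParams p p') L q.t (fun i => omegaZ N (-i) * q.y)
    (fun i j => W N p' q i * Wbar N p q j)

/-- What is claimed about `T_{p,p'}(q)` and `Q_R(q)`. -/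
structure RightIdentification : Prop where
  periodicW : ∀ n, weightW N p q (n + N) = weightW N p q n
  periodicWbar : ∀ n, weightWbar N p' q (n + N) = weightWbar N p' q n
  kernel : q.x ≠ 0 → ∀ i j : ZMod N, potVec N p p' q i j ≠ 0 ∧
    LinearMap.ker (Matrix.mulVecLin
      (opCxi N (rapParams p p') q.t (omegaZ N (-i) * q.x) (omegaZ N (-j) * q.x))) =
        Submodule.span ℂ {potVec N p p' q i j}
  vec_eq : q.x ≠ 0 → ∀ i j n : ZMod N,
    potVec N p p' q i j n = Wbar N p' q (n - i) * W N p q (n - j)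
  QR_eq : q.x ≠ 0 → ∀ (L : ℕ) [NeZero L], opQR N p p' q L = transferT N L p p' q
  tauT : ∀ (L : ℕ) [NeZero L],
    tau2 N (rapParams p p') L ((omega N)⁻¹ * q.t) * transferT N L p p' q =
      ((p.y - q.x) * (p'.t - (omega N)⁻¹ * q.t) /
          (p.y * p'.y * (p'.x - (omega N)⁻¹ * q.x))) ^ L •
        transferT N L p p' (autUinv N q) +
      ((p'.y - q.y) * (p.t - q.t) / (p.y * p'.y * (p.x - q.y))) ^ L •
        transferT N L p p' (autR N (autR N (autUinv N q)))

/-- What is claimed about `T̂_{p,p'}(q)` and `Q_L(q)`. -/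
structure LeftIdentification : Prop where
  periodicW : ∀ n, weightW N p' q (n + N) = weightW N p' q n
  periodicWbar : ∀ n, weightWbar N p q (n + N) = weightWbar N p q n
  cokernel : q.y ≠ 0 → ∀ i j : ZMod N, potCovec N p p' q i j ≠ 0 ∧
    LinearMap.ker (Matrix.vecMulLinear
      (opCxi N (rapParams p p') q.t (omegaZ N (-i) * q.y) (omegaZ N (-j) * q.y))) =
        Submodule.span ℂ {potCovec N p p' q i j}
  covec_eq : q.y ≠ 0 → ∀ i j n : ZMod N,
    potCovec N p p' q i j n = W N p' q (i - n) * Wbar N p q (j - n)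
  QL_eq : q.y ≠ 0 → ∀ (L : ℕ) [NeZero L], opQL N p p' q L = transferThat N L p p' q
  tauT : ∀ (L : ℕ) [NeZero L],
    transferThat N L p p' q * tau2 N (rapParams p p') L ((omega N)⁻¹ * q.t) =
      ((p'.y - q.x) * (p.t - (omega N)⁻¹ * q.t) /
          (p.y * p'.y * (p.x - (omega N)⁻¹ * q.x))) ^ L •
        transferThat N L p p' (autUinv N q) +
      ((p.y - q.y) * (p'.t - q.t) / (p.y * p'.y * (p'.x - q.y))) ^ L •
        transferThat N L p p' (autR N (autR N (autUinv N q)))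

/-- `f_{pq}^N`, the ratio of `det (W̄_{pq}(i - j))` and `∏ W_{pq}(n)`. -/
def fPow : ℂ :=
  Matrix.det (Matrix.of fun i j : ZMod N => Wbar N p q (i - j)) / ∏ n : ZMod N, W N p q n

end Identification

/-- The commutation relations of `T_{p,p'}` and `T̂_{p,p'}` over the curve `S`, and the resulting
commuting `Q`-operators. The `N`-th roots `f_{pq}` and `f_{p'q}` can be chosen, independently of the
chain length, so that all relations hold. -/
def Commutation (N : ℕ) [NeZero N] (S : Set Rapidity) (p p' : Rapidity) : Prop :=
  ∃ f : Rapidity → Rapidity → ℂ,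
    (∀ q ∈ S, RegularT N p p' q → RegularThat N p p' q →
      f p q ≠ 0 ∧ f p' q ≠ 0 ∧ f p q ^ N = fPow N p q ∧ f p' q ^ N = fPow N p' q) ∧
    ∀ (L : ℕ) [NeZero L],
      (∀ q ∈ S, RegularT N p p' q → RegularThat N p p' q →
        ∀ r ∈ S, RegularT N p p' r → RegularThat N p p' r →
          transferT N L p p' q * transferThat N L p p' r =
            ((f p' q * f p r) / (f p q * f p' r)) ^ L •
              (transferT N L p p' r * transferThat N L p p' q) ∧
          transferThat N L p p' q * transferT N L p p' r =
            ((f p q * f p' r) / (f p' q * f p r)) ^ L •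
              (transferThat N L p p' r * transferT N L p p' q)) ∧
      ∀ q₀ ∈ S, RegularT N p p' q₀ → RegularThat N p p' q₀ →
        IsUnit (transferThat N L p p' q₀) → IsUnit (transferT N L p p' q₀) →
        ∀ q ∈ S, RegularT N p p' q → RegularThat N p p' q →
          (transferThat N L p p' q₀)⁻¹ * transferThat N L p p' q =
            ((f p q * f p' q₀) / (f p' q * f p q₀)) ^ L •
              (transferT N L p p' q * (transferT N L p p' q₀)⁻¹) ∧
          ∀ r ∈ S, RegularT N p p' r → RegularThat N p p' r →
            Commute ((transferThat N L p p' q₀)⁻¹ * transferThat N L p p' q)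
              ((transferThat N L p p' q₀)⁻¹ * transferThat N L p p' r)

/-- By a gauge transformation `ν` and a rescaling `lam`, the model with parameters `P` is carried
to the one with vertical rapidities `p`, `p'`. -/
def ReducesTo (N : ℕ) [NeZero N] (P : LParams) (p p' : Rapidity) (lam ν : ℂ) : Prop :=
  lam ≠ 0 ∧ ν ≠ 0 ∧ P.gaugeScale lam ν = rapParams p p' ∧
    ∀ (L : ℕ) [NeZero L] (t : ℂ), tau2 N P L t = tau2 N (rapParams p p') L (lam * t)

/-! ### XXZ chains of cyclic representations, for odd `N` -/

section XXZ

variable (N : ℕ) [NeZero N]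

/-- The quantum group parameter: for odd `N`, the `N`-th root of unity `q` with `q ^ 2 = ω`. -/
def qPar : ℂ := omega N ^ ((N + 1) / 2)

/-- `K^{1/2}` in the cyclic representation. -/
def opKhalf : SiteOp N := weylX N ^ ((N - 1) / 2)

/-- `K^{-1/2}` in the cyclic representation. -/
def opKhalfInv : SiteOp N := weylX N ^ ((N + 1) / 2)

/-- The generator `e` in the cyclic representation with parameter `σ`. -/
def opE (σ : ℂ) : SiteOp N :=
  (qPar N - (qPar N)⁻¹)⁻¹ • ((1 - σ⁻¹ • weylX N) * weylZ N * opKhalf N)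

/-- The generator `f` in the cyclic representation with parameter `σ`. -/
def opF (σ : ℂ) : SiteOp N :=
  (-(qPar N - (qPar N)⁻¹)⁻¹) • ((1 - σ • weylX N) * (weylZ N)⁻¹ * opKhalf N)

/-- The defining relations of `U_q(sl_2)`. -/
def IsUqRep (q : ℂ) (kh khi e f : SiteOp N) : Prop :=
  kh * khi = 1 ∧ khi * kh = 1 ∧ kh * e * khi = q • e ∧ kh * f * khi = q⁻¹ • f ∧
    e * f - f * e = (q - q⁻¹)⁻¹ • (kh * kh - khi * khi)

/-- The XXZ `L`-operator of the cyclic representation with parameter `σ`. -/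
def xxzL (σ s : ℂ) : Matrix (Fin 2) (Fin 2) (SiteOp N) :=
  !![s⁻¹ • opKhalf N - s • opKhalfInv N, (qPar N - (qPar N)⁻¹) • opE N σ;
     (qPar N - (qPar N)⁻¹) • opF N σ, s⁻¹ • opKhalfInv N - s • opKhalf N]

/-- The transfer matrix of the XXZ chain. -/
def xxzTransfer (L : ℕ) [NeZero L] (σ s : ℂ) : ChainOp N L := chainTrace L (xxzL N σ s)

/-- The parameters `(ω⁻¹ σ⁻¹, 1, σ, 1, 1)`. -/
def xxzParams (σ : ℂ) : LParams := ⟨(omega N)⁻¹ * σ⁻¹, 1, σ, 1, 1⟩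

end XXZ

end ChiralPotts

end

open ChiralPotts

/-!
The proof rests on first order recurrences over `ℤ/N`. All weights are determined by the ratios
of consecutive values, and for `q` on one of the curves these ratios close up to `N`-periodic
functions; this is what `RegW` and `RegWbar` record, in a form which does not mention the curve.

*Identification.* In the basis of `ℂ^N` the operator `C_{ξ,η}(t)` is bidiagonal, and for
`ξ = ω^{-i} x_q`, `η = ω^{-j} x_q` its two coefficients factorise into the numerators and
denominators of `W̄_{p',q}(n - i)` and `W_{p,q}(n - j)` (`opCxi_right_mulVec`). So its kernel is
spanned by the product of these weights, which is the local factor of `T_{p,p'}(q)`. For the relation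
with `τ^{(2)}`, conjugate the auxiliary space by lower triangular matrices with entries `ξ`: the
lower left entry becomes `C_{ξ,η}`, which kills the local factor, and the trace splits into two
products (`cyclicTrace_of_gauge`). The diagonal entries multiply the local factor of `T(q)` into those
of `T(U⁻¹ q)` and `T(R² U⁻¹ q)` up to a scalar and a quotient `ω^{j - i}` which telescopes along the
chain. The operator `T̂` is treated in the same way with row vectors.

*Star-triangle relation.* For weights stripped of their `μ`-dependence (`WeightPair`), both sides of
the star-triangle relation satisfy the same recurrences in two of the three spins: the difference of
the two sides of each recurrence is summed to zero by telescoping (`starTriangle`). The constant is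
needed exactly. The Fourier transform of `W̄` is proportional to `W`, since it satisfies the same
recurrence (`WeightPair.hat_eq`), and Fourier transformation of the star-triangle relation exchanges
its two sides. This makes a certain form symmetric up to the desired factor, and the factor is
determined once a diagonal entry of the form does not vanish. If all diagonal entries vanished, then,
after completing the square with a Gaussian on `ℤ/N`, two non-zero functions on `ℤ/N` would have
Fourier transforms with disjoint supports; three-term recurrences exclude this
(`starTriangle_const`).

*Commutation.* Two star-triangle relations move `q` past `r` in `T(q) T̂(r)`
(`StarGauge.exchange`), with a factor given by the duality constants `∑ₙ W̄_{p,q}(n)` (with phases).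
Since a circulant determinant is the product of the values of the Fourier transform, an `N`-th power of
a duality constant is `f_{pq}^N` up to a quotient of a function of `q` by the same function of `p`,
which cancels in the commutation relations (`StarGauge.fPow_eq`). Pairs `q`, `r` for which the weights
`W_{q,r}`, `W̄_{q,r}` degenerate are limits of pairs for which they do not
(`StarGauge.exchangeRel`). On the curves `x^N + y^N = δ`, `μ^N = ±1` the powers of `μ` drop out of the
star-triangle relation; the curve `x^N + y^N = x^N y^N` reduces to the Fermat curve by
`(x, y, μ) ↦ (v / y, 1 / y)` with `v^N = -μ^N`, which reverses the order of the rapidities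
(`weightPair_of_mem_curveProd`).

*Reduction and XXZ chains.* The gauge and scale transformations multiply `a^N`, `b'^N` by one
arbitrary non-zero number and `b^N`, `a'^N` by another; in each case the two curve equations determine
these two numbers. The statements about XXZ chains are computations in the Weyl algebra
`Z X = ω X Z`.
-/

set_option linter.unusedSectionVars false

namespace ChiralPotts

open Matrix

/-! ### Roots of unity and characters of `ℤ/N` -/

section Characters

variable {N : ℕ} [NeZero N]

lemma isPrimitiveRoot_omega : IsPrimitiveRoot (omega N) N := by
  unfold omega
  exact Complex.isPrimitiveRoot_exp N (NeZero.ne N)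

lemma omega_pow : omega N ^ N = 1 := isPrimitiveRoot_omega.pow_eq_one

lemma omega_ne_zero : omega N ≠ 0 := by
  unfold omega
  exact Complex.exp_ne_zero _

/-- For `z ^ N = 1` the function `n ↦ z ^ n.val` is a character of `ℤ/N`. -/
lemma pow_val_add {z : ℂ} (hz : z ^ N = 1) (m n : ZMod N) :
    z ^ (m + n).val = z ^ m.val * z ^ n.val := by
  have h := (AddChar.zmodChar N hz).map_add_eq_mul m n
  simpa only [AddChar.zmodChar_apply] using h

lemma pow_val_natCast {z : ℂ} (hz : z ^ N = 1) (n : ℕ) : z ^ (n : ZMod N).val = z ^ n := by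
  have h := AddChar.zmodChar_apply' hz n
  rwa [AddChar.zmodChar_apply] at h

lemma pow_val_neg {z : ℂ} (hz : z ^ N = 1) (n : ZMod N) : z ^ (-n).val = (z ^ n.val)⁻¹ := by
  refine eq_inv_of_mul_eq_one_left ?_
  rw [← pow_val_add hz]
  simp

lemma pow_val_sub {z : ℂ} (hz : z ^ N = 1) (m n : ZMod N) :
    z ^ (m - n).val = z ^ m.val / z ^ n.val := by
  rw [sub_eq_add_neg, pow_val_add hz, pow_val_neg hz, div_eq_mul_inv]

lemma ne_zero_of_pow_eq_one {z : ℂ} (hz : z ^ N = 1) : z ≠ 0 := by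
  rintro rfl
  simp [NeZero.ne N] at hz

@[simp] lemma omegaZ_zero : omegaZ N 0 = 1 := by simp [omegaZ]

lemma omegaZ_add (m n : ZMod N) : omegaZ N (m + n) = omegaZ N m * omegaZ N n :=
  pow_val_add omega_pow m n

lemma omegaZ_natCast (n : ℕ) : omegaZ N (n : ZMod N) = omega N ^ n :=
  pow_val_natCast omega_pow n

@[simp] lemma omegaZ_one : omegaZ N 1 = omega N := by
  have := omegaZ_natCast (N := N) 1
  simpa using this

lemma omegaZ_neg (n : ZMod N) : omegaZ N (-n) = (omegaZ N n)⁻¹ := pow_val_neg omega_pow n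

lemma omegaZ_sub (m n : ZMod N) : omegaZ N (m - n) = omegaZ N m / omegaZ N n :=
  pow_val_sub omega_pow m n

lemma omegaZ_ne_zero (n : ZMod N) : omegaZ N n ≠ 0 := pow_ne_zero _ omega_ne_zero

lemma omegaZ_pow_N (n : ZMod N) : omegaZ N n ^ N = 1 := by
  rw [omegaZ, ← pow_mul, mul_comm, pow_mul, omega_pow, one_pow]

lemma omegaZ_eq_one_iff (n : ZMod N) : omegaZ N n = 1 ↔ n = 0 := by
  rw [omegaZ, isPrimitiveRoot_omega.pow_eq_one_iff_dvd]
  constructor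
  · intro h
    have := Nat.eq_zero_of_dvd_of_lt h n.val_lt
    rwa [ZMod.val_eq_zero] at this
  · rintro rfl
    simp

lemma omegaZ_injective : Function.Injective (omegaZ N) := by
  intro m n h
  have : omegaZ N (m - n) = 1 := by rw [omegaZ_sub, h, div_self (omegaZ_ne_zero n)]
  exact sub_eq_zero.mp ((omegaZ_eq_one_iff _).mp this)

lemma sum_omegaZ_mul (k : ZMod N) :
    ∑ n : ZMod N, omegaZ N (k * n) = if k = 0 then (N : ℂ) else 0 := by
  have hprim := AddChar.zmodChar_primitive_of_primitive_root N (isPrimitiveRoot_omega (N := N))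
  have h := AddChar.sum_mulShift k hprim
  simp only [AddChar.zmodChar_apply, ZMod.card] at h
  simp only [omegaZ, mul_comm k]
  rw [h]
  split_ifs <;> simp

lemma exists_omegaZ_eq {z : ℂ} (hz : z ^ N = 1) : ∃ n : ZMod N, omegaZ N n = z := by
  obtain ⟨i, -, hi⟩ := isPrimitiveRoot_omega.eq_pow_of_pow_eq_one hz
  exact ⟨i, by rw [omegaZ_natCast, hi]⟩

lemma sub_omegaZ_mul_ne_zero {x y : ℂ} (h : y ^ N ≠ x ^ N) (n : ZMod N) :
    y - omegaZ N n * x ≠ 0 := by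
  intro h0
  apply h
  rw [sub_eq_zero.mp h0, mul_pow, omegaZ_pow_N, one_mul]

/-- Products as in the weights run over `ω, ω², …, ω ^ N`, hence over all of `ℤ/N`. -/
lemma prod_range_eq_prod_zmod (f : ZMod N → ℂ) :
    ∏ j ∈ Finset.range N, f ((j : ℕ) + 1 : ZMod N) = ∏ n : ZMod N, f n := by
  have h1 : ∏ n : ZMod N, f n = ∏ n : ZMod N, f (n + 1) :=
    (Equiv.prod_comp (Equiv.addRight (1 : ZMod N)) f).symm
  rw [h1]
  refine Finset.prod_bij' (fun j _ => (j : ZMod N)) (fun n _ => n.val) ?_ ?_ ?_ ?_ ?_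
  · simp
  · intro n _
    simpa using n.val_lt
  · intro j hj
    exact ZMod.val_cast_of_lt (by simpa using hj)
  · intro n _
    simp
  · simp

lemma prod_sub_omegaZ_mul (x y : ℂ) : ∏ n : ZMod N, (y - omegaZ N n * x) = y ^ N - x ^ N := by
  rw [isPrimitiveRoot_omega.pow_sub_pow_eq_prod_sub_mul y x (NeZero.pos N)]
  refine Finset.prod_bij (fun n _ => omegaZ N n) ?_ ?_ ?_ ?_
  · intro n _
    rw [Polynomial.mem_nthRootsFinset (NeZero.pos N)]
    exact omegaZ_pow_N n
  · intro m _ n _ h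
    exact omegaZ_injective h
  · intro z hz
    rw [Polynomial.mem_nthRootsFinset (NeZero.pos N)] at hz
    obtain ⟨n, hn⟩ := exists_omegaZ_eq hz
    exact ⟨n, Finset.mem_univ _, hn⟩
  · intros
    rfl

lemma prod_range_sub_omega (x y : ℂ) :
    ∏ j ∈ Finset.range N, (y - omega N ^ (j + 1) * x) = y ^ N - x ^ N := by
  rw [← prod_sub_omegaZ_mul, ← prod_range_eq_prod_zmod]
  refine Finset.prod_congr rfl fun j _ => ?_
  rw [← omegaZ_natCast]
  push_cast
  rfl

/-- A statement about all residues follows from a cyclic step. -/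
lemma zmod_cyclic_induction {P : ZMod N → Prop} (j : ZMod N) (h0 : P j)
    (hs : ∀ n, P n → P (n + 1)) (n : ZMod N) : P n := by
  have key : ∀ k : ℕ, P (j + k) := by
    intro k
    induction k with
    | zero => simpa using h0
    | succ k ih =>
      have := hs _ ih
      push_cast
      rwa [← add_assoc]
  have := key (n - j).val
  simpa using this

/-- A first order recurrence on `ℤ/N` with non-vanishing leading coefficients determines its
solution from the value at zero. -/
lemma eq_of_recurrence {α β f g : ZMod N → ℂ} (hα : ∀ n, α n ≠ 0)
    (hf : ∀ n, α n * f n = β n * f (n - 1)) (hg : ∀ n, α n * g n = β n * g (n - 1))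
    (h0 : f 0 = g 0) : f = g := by
  funext n
  refine zmod_cyclic_induction (P := fun n => f n = g n) 0 h0 ?_ n
  intro n hn
  apply mul_left_cancel₀ (hα (n + 1))
  rw [hf, hg, add_sub_cancel_right, hn]

end Characters

/-! ### Cyclic traces of products of matrices -/

section Trace

variable {L : ℕ} [NeZero L]

lemma fin_cyclic_induction {P : Fin L → Prop} (j : Fin L) (h0 : P j)
    (hs : ∀ l, P l → P (l + 1)) (l : Fin L) : P l := by
  have key : ∀ k : ℕ, P (j + Fin.ofNat L k) := by
    intro k
    induction k with
    | zero => simpa using h0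
    | succ k ih =>
      have := hs _ ih
      rw [add_assoc] at this
      convert this using 2
      ext
      simp [Fin.val_add]
  have := key (l - j).val
  simpa using this

lemma prod_shift (f : Fin L → ℂ) : ∏ l, f (l + 1) = ∏ l, f l :=
  Equiv.prod_comp (Equiv.addRight (1 : Fin L)) f

/-- The trace of the cyclically ordered product of the matrices `m l`, `l` running over `ℤ/L`. -/
def cyclicTrace {α : Type*} [Fintype α] (m : Fin L → Matrix α α ℂ) : ℂ :=
  ∑ i : Fin L → α, ∏ l, m l (i l) (i (l + 1))

lemma prod_sum_eq {α : Type*} [Fintype α] (f : Fin L → α → ℂ) :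
    ∏ l, ∑ k, f l k = ∑ k : Fin L → α, ∏ l, f l (k l) := by
  classical
  rw [Finset.prod_univ_sum, Fintype.piFinset_univ]

/-- Cyclicity: the factors of the matrices can be regrouped. -/
lemma cyclicTrace_mul_comm {α : Type*} [Fintype α] (a b : Fin L → Matrix α α ℂ) :
    cyclicTrace (fun l => a l * b l) = cyclicTrace fun l => b l * a (l + 1) := by
  have h1 : cyclicTrace (fun l => a l * b l) =
      ∑ i : Fin L → α, ∑ k : Fin L → α, ∏ l, a l (i l) (k l) * b l (k l) (i (l + 1)) := by
    unfold cyclicTrace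
    refine Finset.sum_congr rfl fun i _ => ?_
    simp only [Matrix.mul_apply]
    rw [prod_sum_eq]
  have h2 : cyclicTrace (fun l => b l * a (l + 1)) =
      ∑ k : Fin L → α, ∑ i : Fin L → α, ∏ l, b l (k l) (i l) * a (l + 1) (i l) (k (l + 1)) := by
    unfold cyclicTrace
    refine Finset.sum_congr rfl fun i _ => ?_
    simp only [Matrix.mul_apply]
    rw [prod_sum_eq]
  rw [h1, h2, Finset.sum_comm]
  refine Finset.sum_congr rfl fun k _ => ?_
  have hshift (F : (Fin L → α) → ℂ) : ∑ i, F i = ∑ i : Fin L → α, F fun l => i (l + 1) :=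
    (Equiv.sum_comp ((Equiv.addRight (1 : Fin L)).arrowCongr (Equiv.refl α)).symm F).symm
  rw [hshift fun i => ∏ l, b l (k l) (i l) * a (l + 1) (i l) (k (l + 1))]
  refine Finset.sum_congr rfl fun i _ => ?_
  rw [Finset.prod_mul_distrib, Finset.prod_mul_distrib, mul_comm]
  congr 1
  exact (prod_shift fun l => a l (i l) (k l)).symm

/-- Invariance under a gauge transformation `g` depending on the position in the chain. -/
lemma cyclicTrace_gauge {α : Type*} [Fintype α] [DecidableEq α] (g gi m : Fin L → Matrix α α ℂ)
    (hg : ∀ l, g l * gi l = 1) :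
    cyclicTrace m = cyclicTrace fun l => gi l * m l * g (l + 1) := by
  rw [← cyclicTrace_mul_comm g fun l => gi l * m l]
  congr 1
  funext l
  rw [← Matrix.mul_assoc, hg, Matrix.one_mul]

/-- For upper triangular two by two matrices only the constant cyclic sequences contribute. -/
lemma cyclicTrace_of_triangular (m : Fin L → Matrix (Fin 2) (Fin 2) ℂ) (h : ∀ l, m l 1 0 = 0) :
    cyclicTrace m = ∏ l, m l 0 0 + ∏ l, m l 1 1 := by
  classical
  have hne : (fun _ : Fin L => (0 : Fin 2)) ≠ fun _ => 1 := by
    intro h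
    have := congrFun h 0
    simp at this
  unfold cyclicTrace
  rw [← Finset.sum_subset (Finset.subset_univ {fun _ => (0 : Fin 2), fun _ => 1})]
  · rw [Finset.sum_pair hne]
  · intro i _ hi
    have : ∃ l, i l = 1 ∧ i (l + 1) = 0 := by
      by_contra! hcon
      apply hi
      have two : ∀ x : Fin 2, x = 0 ∨ x = 1 := by decide
      by_cases h1 : ∃ l, i l = 1
      · obtain ⟨l₀, hl₀⟩ := h1
        have : ∀ l, i l = 1 := fin_cyclic_induction l₀ hl₀ fun l hl =>
          (two _).resolve_left (hcon l hl)
        have : i = fun _ => 1 := funext this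
        simp [this]
      · push Not at h1
        have : i = fun _ => 0 := funext fun l => (two _).resolve_right (h1 l)
        simp [this]
    obtain ⟨l, hl1, hl2⟩ := this
    exact Finset.prod_eq_zero (Finset.mem_univ l) (by rw [hl1, hl2, h])

variable {N : ℕ} [NeZero N]

lemma chainTrace_apply {α : Type} [Fintype α] (M : α → α → SiteOp N) (j j' : Fin L → ZMod N) :
    chainTrace L M j j' = cyclicTrace fun l => Matrix.of fun a b => M a b (j l) (j' l) := rfl

/-- Applying a chain operator to a product vector. -/
lemma chainTrace_mul_of_prod {α : Type} [Fintype α] (M : α → α → SiteOp N) (T : ChainOp N L)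
    (j' : Fin L → ZMod N) (s : Fin L → ZMod N → ℂ) (hs : ∀ j, T j j' = ∏ l, s l (j l))
    (j : Fin L → ZMod N) :
    (chainTrace L M * T) j j' =
      cyclicTrace fun l => Matrix.of fun a b => (M a b *ᵥ s l) (j l) := by
  rw [Matrix.mul_apply]
  simp only [chainTrace_apply, cyclicTrace, Matrix.of_apply, Matrix.mulVec, dotProduct]
  simp only [Finset.sum_mul, hs]
  rw [Finset.sum_comm]
  refine Finset.sum_congr rfl fun i _ => ?_
  rw [prod_sum_eq]
  refine Finset.sum_congr rfl fun k _ => ?_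
  rw [Finset.prod_mul_distrib]

/-- Applying a chain operator to a product covector. -/
lemma mul_chainTrace_of_prod {α : Type} [Fintype α] (M : α → α → SiteOp N) (T : ChainOp N L)
    (j : Fin L → ZMod N) (s : Fin L → ZMod N → ℂ) (hs : ∀ j', T j j' = ∏ l, s l (j' l))
    (j' : Fin L → ZMod N) :
    (T * chainTrace L M) j j' =
      cyclicTrace fun l => Matrix.of fun a b => (s l ᵥ* M a b) (j' l) := by
  rw [Matrix.mul_apply]
  simp only [chainTrace_apply, cyclicTrace, Matrix.of_apply, Matrix.vecMul, dotProduct]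
  simp only [Finset.mul_sum, hs]
  rw [Finset.sum_comm]
  refine Finset.sum_congr rfl fun i _ => ?_
  rw [prod_sum_eq]
  refine Finset.sum_congr rfl fun k _ => ?_
  rw [Finset.prod_mul_distrib]

end Trace

/-! ### Recurrences satisfied by the Boltzmann weights -/

section Weights

variable {N : ℕ} [NeZero N] {p q : Rapidity}

/-- The weight `W_{p,q}` has no pole and is `N`-periodic; the last clause is periodicity with
denominators cleared. -/
structure RegW (N : ℕ) (p q : Rapidity) : Prop where
  mu_left : p.μ ≠ 0
  mu_right : q.μ ≠ 0
  ne : q.x ^ N ≠ p.y ^ N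
  curve : p.μ ^ N * (q.y ^ N - p.x ^ N) = q.μ ^ N * (p.y ^ N - q.x ^ N)

/-- The weight `W̄_{p,q}` has no pole and is `N`-periodic; the last clause is periodicity with
denominators cleared. -/
structure RegWbar (N : ℕ) (p q : Rapidity) : Prop where
  mu_left : p.μ ≠ 0
  mu_right : q.μ ≠ 0
  ne : q.y ^ N ≠ p.y ^ N
  curve : (p.μ * q.μ) ^ N * (p.x ^ N - q.x ^ N) = q.y ^ N - p.y ^ N

lemma RegW.ne' (h : RegW N p q) : q.y ^ N ≠ p.x ^ N := by
  intro h0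
  have := h.curve
  rw [h0, sub_self, mul_zero, eq_comm, mul_eq_zero] at this
  rcases this with h1 | h1
  · exact pow_ne_zero _ h.mu_right h1
  · exact h.ne (sub_eq_zero.mp h1).symm

lemma RegWbar.ne' (h : RegWbar N p q) : p.x ^ N ≠ q.x ^ N := by
  intro h0
  have := h.curve
  rw [h0, sub_self, mul_zero, eq_comm] at this
  exact h.ne (sub_eq_zero.mp this)

lemma RegW.den_ne_zero (h : RegW N p q) (n : ZMod N) : p.y - omegaZ N n * q.x ≠ 0 :=
  sub_omegaZ_mul_ne_zero h.ne.symm n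

lemma RegW.num_ne_zero (h : RegW N p q) (n : ZMod N) : q.y - omegaZ N n * p.x ≠ 0 :=
  sub_omegaZ_mul_ne_zero h.ne' n

lemma RegWbar.den_ne_zero (h : RegWbar N p q) (n : ZMod N) : q.y - omegaZ N n * p.y ≠ 0 :=
  sub_omegaZ_mul_ne_zero h.ne n

lemma RegWbar.num_ne_zero (h : RegWbar N p q) (n : ZMod N) :
    omega N * p.x - omegaZ N n * q.x ≠ 0 := by
  apply sub_omegaZ_mul_ne_zero
  rw [mul_pow, omega_pow, one_mul]
  exact h.ne'

lemma weightW_zero : weightW N p q 0 = 1 := by simp [weightW]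

lemma weightWbar_zero : weightWbar N p q 0 = 1 := by simp [weightWbar]

lemma weightW_succ (n : ℕ) : weightW N p q (n + 1) = weightW N p q n *
    ((p.μ / q.μ) * ((q.y - omega N ^ (n + 1) * p.x) / (p.y - omega N ^ (n + 1) * q.x))) := by
  simp only [weightW, Finset.prod_range_succ, pow_succ (p.μ / q.μ)]
  ring

lemma weightWbar_succ (n : ℕ) : weightWbar N p q (n + 1) = weightWbar N p q n *
    ((p.μ * q.μ) *
      ((omega N * p.x - omega N ^ (n + 1) * q.x) / (q.y - omega N ^ (n + 1) * p.y))) := by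
  simp only [weightWbar, Finset.prod_range_succ, pow_succ (p.μ * q.μ)]
  ring

/-- A sequence with `N`-periodic ratios which returns to its first value is `N`-periodic. -/
lemma periodic_of_ratio {f r : ℕ → ℂ} (hf : ∀ n, f (n + 1) = f n * r n)
    (hr : ∀ n, r (n + N) = r n) (h0 : f N = f 0) (n : ℕ) : f (n + N) = f n := by
  induction n with
  | zero => simpa using h0
  | succ n ih => rw [show n + 1 + N = n + N + 1 by ring, hf, ih, hr, ← hf]

lemma omega_pow_add_N (n : ℕ) : omega N ^ (n + N) = omega N ^ n := by
  rw [pow_add, omega_pow, mul_one]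

lemma RegW.periodic (h : RegW N p q) (n : ℕ) : weightW N p q (n + N) = weightW N p q n := by
  refine periodic_of_ratio weightW_succ (fun n => ?_) ?_ n
  · rw [show n + N + 1 = n + 1 + N by ring, omega_pow_add_N]
  · rw [weightW_zero, weightW, Finset.prod_div_distrib, prod_range_sub_omega,
      prod_range_sub_omega, div_pow]
    have h1 := pow_ne_zero N h.mu_right
    have h2 := sub_ne_zero.mpr h.ne.symm
    rw [div_mul_div_comm, h.curve, div_self (mul_ne_zero h1 h2)]

lemma RegWbar.periodic (h : RegWbar N p q) (n : ℕ) :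
    weightWbar N p q (n + N) = weightWbar N p q n := by
  refine periodic_of_ratio weightWbar_succ (fun n => ?_) ?_ n
  · rw [show n + N + 1 = n + 1 + N by ring, omega_pow_add_N]
  · rw [weightWbar_zero, weightWbar, Finset.prod_div_distrib, prod_range_sub_omega,
      prod_range_sub_omega, mul_pow (omega N), omega_pow, one_mul]
    have h2 := sub_ne_zero.mpr h.ne
    rw [mul_div_assoc', h.curve, div_self h2]

lemma eq_val_of_periodic {f : ℕ → ℂ} (hf : ∀ n, f (n + N) = f n) (n : ℕ) :
    f (n : ZMod N).val = f n := by
  rw [ZMod.val_natCast]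
  have key : ∀ k m, f (m + N * k) = f m := by
    intro k
    induction k with
    | zero => simp
    | succ k ih =>
      intro m
      rw [show m + N * (k + 1) = (m + N * k) + N by ring, hf, ih]
  conv_rhs => rw [← Nat.mod_add_div n N, key]

lemma RegW.natCast (h : RegW N p q) (n : ℕ) : W N p q n = weightW N p q n :=
  eq_val_of_periodic h.periodic n

lemma RegWbar.natCast (h : RegWbar N p q) (n : ℕ) : Wbar N p q n = weightWbar N p q n :=
  eq_val_of_periodic h.periodic n

@[simp] lemma W_zero : W N p q 0 = 1 := by simp [W, weightW_zero]

@[simp] lemma Wbar_zero : Wbar N p q 0 = 1 := by simp [Wbar, weightWbar_zero]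

lemma RegW.recurrence (h : RegW N p q) (n : ZMod N) :
    q.μ * (p.y - omegaZ N n * q.x) * W N p q n =
      p.μ * (q.y - omegaZ N n * p.x) * W N p q (n - 1) := by
  obtain ⟨k, rfl⟩ : ∃ k : ℕ, n = (k : ZMod N) + 1 := ⟨(n - 1).val, by simp⟩
  have h1 := h.den_ne_zero ((k : ZMod N) + 1)
  have h2 := h.mu_right
  have e : omegaZ N ((k : ZMod N) + 1) = omega N ^ (k + 1) := by
    rw [← omegaZ_natCast]
    push_cast
    rfl
  have e2 : W N p q ((k : ZMod N) + 1) = weightW N p q (k + 1) := by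
    rw [← h.natCast]
    push_cast
    rfl
  rw [add_sub_cancel_right, e2, h.natCast, weightW_succ]
  rw [e] at h1 ⊢
  field_simp

lemma RegWbar.recurrence (h : RegWbar N p q) (n : ZMod N) :
    (q.y - omegaZ N n * p.y) * Wbar N p q n =
      p.μ * q.μ * (omega N * p.x - omegaZ N n * q.x) * Wbar N p q (n - 1) := by
  obtain ⟨k, rfl⟩ : ∃ k : ℕ, n = (k : ZMod N) + 1 := ⟨(n - 1).val, by simp⟩
  have h1 := h.den_ne_zero ((k : ZMod N) + 1)
  have e : omegaZ N ((k : ZMod N) + 1) = omega N ^ (k + 1) := by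
    rw [← omegaZ_natCast]
    push_cast
    rfl
  have e2 : Wbar N p q ((k : ZMod N) + 1) = weightWbar N p q (k + 1) := by
    rw [← h.natCast]
    push_cast
    rfl
  rw [add_sub_cancel_right, e2, h.natCast, weightWbar_succ]
  rw [e] at h1 ⊢
  field_simp

lemma RegW.W_ne_zero (h : RegW N p q) (n : ZMod N) : W N p q n ≠ 0 := by
  refine zmod_cyclic_induction (P := fun n => W N p q n ≠ 0) 0 (by simp) (fun n hn h0 => ?_) n
  have := h.recurrence (n + 1)
  rw [h0, mul_zero, add_sub_cancel_right, eq_comm] at this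
  exact mul_ne_zero (mul_ne_zero h.mu_left (h.num_ne_zero _)) hn this

lemma RegWbar.Wbar_ne_zero (h : RegWbar N p q) (n : ZMod N) : Wbar N p q n ≠ 0 := by
  refine zmod_cyclic_induction (P := fun n => Wbar N p q n ≠ 0) 0 (by simp) (fun n hn h0 => ?_) n
  have := h.recurrence (n + 1)
  rw [h0, mul_zero, add_sub_cancel_right, eq_comm] at this
  exact mul_ne_zero (mul_ne_zero (mul_ne_zero h.mu_left h.mu_right) (h.num_ne_zero _)) hn this

/-- The effect of `q ↦ U⁻¹ q` on `W_{p,q}`. -/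
lemma RegW.W_autUinv (h : RegW N p q) (n : ZMod N) :
    W N p (autUinv N q) n * (p.y - q.x) = W N p q n * (p.y - omegaZ N n * q.x) := by
  have key : ∀ k : ℕ, weightW N p (autUinv N q) k * (p.y - q.x) =
      weightW N p q k * (p.y - omega N ^ k * q.x) := by
    intro k
    induction k with
    | zero => simp [weightW_zero]
    | succ k ih =>
      have h1 : p.y - omega N ^ (k + 1) * q.x ≠ 0 := by
        simpa only [omegaZ_natCast] using h.den_ne_zero ((k + 1 : ℕ) : ZMod N)
      have h2 : p.y - omega N ^ k * q.x ≠ 0 := by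
        simpa only [omegaZ_natCast] using h.den_ne_zero (k : ZMod N)
      have hw := omega_ne_zero (N := N)
      have h3 : omega N ^ (k + 1) * ((omega N)⁻¹ * q.x) = omega N ^ k * q.x := by
        rw [pow_succ]
        field_simp
      rw [weightW_succ, weightW_succ, mul_right_comm, ih]
      simp only [autUinv, h3]
      generalize p.y - omega N ^ (k + 1) * q.x = E at h1 ⊢
      field_simp
  exact key n.val

/-- The effect of `q ↦ U⁻¹ q` on `W̄_{p,q}`. -/
lemma RegWbar.Wbar_autUinv (h : RegWbar N p q) (n : ZMod N) :
    Wbar N p (autUinv N q) n * (omega N * p.x - omegaZ N n * q.x) =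
      Wbar N p q n * (omega N * p.x - q.x) := by
  have key : ∀ k : ℕ, weightWbar N p (autUinv N q) k * (omega N * p.x - omega N ^ k * q.x) =
      weightWbar N p q k * (omega N * p.x - q.x) := by
    intro k
    induction k with
    | zero => simp [weightWbar_zero]
    | succ k ih =>
      have h1 : q.y - omega N ^ (k + 1) * p.y ≠ 0 := by
        simpa only [omegaZ_natCast] using h.den_ne_zero ((k + 1 : ℕ) : ZMod N)
      have hw := omega_ne_zero (N := N)
      have h3 : omega N ^ (k + 1) * ((omega N)⁻¹ * q.x) = omega N ^ k * q.x := by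
        rw [pow_succ]
        field_simp
      rw [weightWbar_succ, weightWbar_succ]
      simp only [autUinv, h3] at ih ⊢
      linear_combination (p.μ * q.μ * ((omega N * p.x - omega N ^ (k + 1) * q.x) /
        (q.y - omega N ^ (k + 1) * p.y))) * ih
  exact key n.val

/-- `R² U⁻¹` multiplies `y` by `ω`. -/
lemma autR_autR_autUinv : autR N (autR N (autUinv N q)) = ⟨q.x, omega N * q.y, q.μ⟩ := by
  have hw := omega_ne_zero (N := N)
  simp [autR, autUinv, hw]

/-- The effect of `q ↦ R² U⁻¹ q` on `W_{p,q}`. -/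
lemma W_autRR (n : ZMod N) :
    W N p (autR N (autR N (autUinv N q))) n * (q.y - omegaZ N n * p.x) =
      omegaZ N n * W N p q n * (q.y - p.x) := by
  have key : ∀ k : ℕ, weightW N p ⟨q.x, omega N * q.y, q.μ⟩ k * (q.y - omega N ^ k * p.x) =
      omega N ^ k * weightW N p q k * (q.y - p.x) := by
    intro k
    induction k with
    | zero => simp [weightW_zero]
    | succ k ih =>
      rw [weightW_succ, weightW_succ]
      have h3 : omega N * q.y - omega N ^ (k + 1) * p.x
        = omega N * (q.y - omega N ^ k * p.x) := by ring
      simp only [h3]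
      linear_combination (omega N * (p.μ / q.μ) * ((q.y - omega N ^ (k + 1) * p.x) /
        (p.y - omega N ^ (k + 1) * q.x))) * ih
  rw [autR_autR_autUinv]
  exact key n.val

/-- The effect of `q ↦ R² U⁻¹ q` on `W̄_{p,q}`. -/
lemma RegWbar.Wbar_autRR (h : RegWbar N p q) (n : ZMod N) :
    omegaZ N n * Wbar N p (autR N (autR N (autUinv N q))) n * (q.y - p.y) =
      Wbar N p q n * (q.y - omegaZ N n * p.y) := by
  have key : ∀ k : ℕ, omega N ^ k * weightWbar N p ⟨q.x, omega N * q.y, q.μ⟩ k * (q.y - p.y) =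
      weightWbar N p q k * (q.y - omega N ^ k * p.y) := by
    intro k
    induction k with
    | zero => simp [weightWbar_zero]
    | succ k ih =>
      have h1 : q.y - omega N ^ (k + 1) * p.y ≠ 0 := by
        simpa only [omegaZ_natCast] using h.den_ne_zero ((k + 1 : ℕ) : ZMod N)
      have h2 : q.y - omega N ^ k * p.y ≠ 0 := by
        simpa only [omegaZ_natCast] using h.den_ne_zero (k : ZMod N)
      have hw := omega_ne_zero (N := N)
      rw [weightWbar_succ, weightWbar_succ]
      have h3 : omega N * q.y - omega N ^ (k + 1) * p.y
        = omega N * (q.y - omega N ^ k * p.y) := by ring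
      simp only [h3]
      set A := p.μ * q.μ * (omega N * p.x - omega N ^ (k + 1) * q.x) with hA
      have e1 : omega N ^ (k + 1) * (weightWbar N p ⟨q.x, omega N * q.y, q.μ⟩ k *
          (p.μ * q.μ * ((omega N * p.x - omega N ^ (k + 1) * q.x) /
            (omega N * (q.y - omega N ^ k * p.y))))) * (q.y - p.y) =
          (omega N ^ k * weightWbar N p ⟨q.x, omega N * q.y, q.μ⟩ k * (q.y - p.y)) *
            (A / (q.y - omega N ^ k * p.y)) := by
        rw [hA, pow_succ]
        field_simp
      rw [e1, ih, hA]
      generalize q.y - omega N ^ (k + 1) * p.y = E at h1 ⊢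
      field_simp
  rw [autR_autR_autUinv]
  exact key n.val

end Weights

/-! ### The local operators -/

section Operators

variable {N : ℕ} [NeZero N]

lemma weylX_mulVec (v : ZMod N → ℂ) (n : ZMod N) : (weylX N *ᵥ v) n = v (n - 1) := by
  simp only [weylX, Matrix.mulVec, dotProduct, Matrix.of_apply, ite_mul, one_mul, zero_mul]
  rw [Finset.sum_eq_single (n - 1)]
  · simp
  · intro m _ hm
    rw [if_neg]
    rintro rfl
    simp at hm
  · simp

lemma vecMul_weylX (v : ZMod N → ℂ) (n : ZMod N) : (v ᵥ* weylX N) n = v (n + 1) := by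
  simp [weylX, Matrix.vecMul, dotProduct]

lemma weylZ_mul_diagonal :
    weylZ N * Matrix.diagonal (fun n => (omegaZ N n)⁻¹) = 1 := by
  rw [weylZ, Matrix.diagonal_mul_diagonal]
  simp [omegaZ_ne_zero]

lemma weylZ_inv : (weylZ N)⁻¹ = Matrix.diagonal fun n => (omegaZ N n)⁻¹ :=
  Matrix.inv_eq_right_inv weylZ_mul_diagonal

variable (P : LParams) (t ξ η : ℂ) (v : ZMod N → ℂ) (n : ZMod N)

lemma opA_mulVec : (opA N P t *ᵥ v) n = v n - t * (P.c / (P.b' * P.b)) * v (n - 1) := by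
  simp [opA, Matrix.sub_mulVec, Matrix.smul_mulVec, weylX_mulVec]

lemma opB_mulVec : (opB N P t *ᵥ v) n = 1 / P.b * (omegaZ N n * v n) -
    omega N * (P.a * P.c / (P.b' * P.b)) * (omegaZ N (n - 1) * v (n - 1)) := by
  simp [opB, ← Matrix.mulVec_mulVec, Matrix.sub_mulVec, Matrix.smul_mulVec, weylX_mulVec,
    weylZ, Matrix.mulVec_diagonal]

lemma opC_mulVec : (opC N P t *ᵥ v) n = -t * (1 / P.b' * ((omegaZ N n)⁻¹ * v n) -
    P.a' * P.c / (P.b' * P.b) * ((omegaZ N (n - 1))⁻¹ * v (n - 1))) := by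
  rw [opC, weylZ_inv]
  simp [← Matrix.mulVec_mulVec, Matrix.sub_mulVec, Matrix.smul_mulVec, weylX_mulVec,
    Matrix.neg_mulVec, Matrix.mulVec_diagonal]

lemma opD_mulVec : (opD N P t *ᵥ v) n = -(t * (1 / (P.b' * P.b))) * v n +
    omega N * (P.a' * P.a * P.c / (P.b' * P.b)) * v (n - 1) := by
  simp [opD, Matrix.add_mulVec, Matrix.smul_mulVec, weylX_mulVec, Matrix.neg_mulVec]

lemma vecMul_opA : (v ᵥ* opA N P t) n = v n - t * (P.c / (P.b' * P.b)) * v (n + 1) := by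
  simp [opA, Matrix.vecMul_sub, Matrix.vecMul_smul, vecMul_weylX]

lemma vecMul_opB : (v ᵥ* opB N P t) n = (1 / P.b * v n -
    omega N * (P.a * P.c / (P.b' * P.b)) * v (n + 1)) * omegaZ N n := by
  simp [opB, ← Matrix.vecMul_vecMul, Matrix.vecMul_sub, Matrix.vecMul_smul, vecMul_weylX,
    weylZ, Matrix.vecMul_diagonal]

lemma vecMul_opC : (v ᵥ* opC N P t) n = -t * ((1 / P.b' * v n -
    P.a' * P.c / (P.b' * P.b) * v (n + 1)) * (omegaZ N n)⁻¹) := by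
  rw [opC, weylZ_inv]
  simp [← Matrix.vecMul_vecMul, Matrix.vecMul_sub, Matrix.vecMul_smul, vecMul_weylX,
    Matrix.vecMul_neg, Matrix.vecMul_diagonal]

lemma vecMul_opD : (v ᵥ* opD N P t) n = -(t * (1 / (P.b' * P.b))) * v n +
    omega N * (P.a' * P.a * P.c / (P.b' * P.b)) * v (n + 1) := by
  simp [opD, Matrix.vecMul_add, Matrix.vecMul_smul, vecMul_weylX, Matrix.vecMul_neg]

lemma opCxi_mulVec_eq : (opCxi N P t ξ η *ᵥ v) n = ξ * (opA N P t *ᵥ v) n + (opC N P t *ᵥ v) n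
    - ξ * η * (opB N P t *ᵥ v) n - η * (opD N P t *ᵥ v) n := by
  simp [opCxi, Matrix.sub_mulVec, Matrix.add_mulVec, Matrix.smul_mulVec]

lemma vecMul_opCxi_eq : (v ᵥ* opCxi N P t ξ η) n = ξ * (v ᵥ* opA N P t) n + (v ᵥ* opC N P t) n
    - ξ * η * (v ᵥ* opB N P t) n - η * (v ᵥ* opD N P t) n := by
  simp [opCxi, Matrix.vecMul_sub, Matrix.vecMul_add, Matrix.vecMul_smul]

/-- `C_{ξ,η}(t)` is bidiagonal, with both coefficients factorised. -/
lemma opCxi_mulVec (hb : P.b ≠ 0) (hb' : P.b' ≠ 0) : (opCxi N P t ξ η *ᵥ v) n =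
    ((P.b - omegaZ N n * η) * (P.b' * ξ - t * (omegaZ N n)⁻¹) * v n +
      P.c * (t - omegaZ N n * P.a * η) * (omega N * P.a' * (omegaZ N n)⁻¹ - ξ) * v (n - 1)) /
        (P.b * P.b') := by
  have h1 := omegaZ_ne_zero n
  have h2 := omega_ne_zero (N := N)
  rw [opCxi_mulVec_eq, opA_mulVec, opB_mulVec, opC_mulVec, opD_mulVec, omegaZ_sub, omegaZ_one]
  field_simp
  ring

/-- The same factorisation for the action on row vectors. -/
lemma vecMul_opCxi (hb : P.b ≠ 0) (hb' : P.b' ≠ 0) : (v ᵥ* opCxi N P t ξ η) n =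
    ((P.b - omegaZ N n * η) * (P.b' * ξ - t * (omegaZ N n)⁻¹) * v n +
      P.c * (t - omega N * omegaZ N n * P.a * η) * (P.a' * (omegaZ N n)⁻¹ - ξ) * v (n + 1)) /
        (P.b * P.b') := by
  have h1 := omegaZ_ne_zero n
  have h2 := omega_ne_zero (N := N)
  rw [vecMul_opCxi_eq, vecMul_opA, vecMul_opB, vecMul_opC, vecMul_opD]
  field_simp
  ring

end Operators

/-! ### The identification of `T` with `Q_R` and its functional relation -/

section Right

variable {N : ℕ} [NeZero N] {p p' q : Rapidity}

/-- The local factor of a column of `T_{p,p'}(q)`. -/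
noncomputable def rightVec (N : ℕ) (p p' q : Rapidity) (i j n : ZMod N) : ℂ :=
  Wbar N p' q (n - i) * W N p q (n - j)

/-- The product of the recurrences of the two weights; the coefficients are those of
`opCxi_right_mulVec`. -/
lemma rightVec_recurrence (h : RegW N p q) (h' : RegWbar N p' q) (i j n : ZMod N) :
    (p.y - omegaZ N (n - j) * q.x) * (q.y - omegaZ N (n - i) * p'.y) * rightVec N p p' q i j n =
      p.μ * p'.μ * (omega N * p'.x - omegaZ N (n - i) * q.x) *
        (q.y - omegaZ N (n - j) * p.x) * rightVec N p p' q i j (n - 1) := by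
  have h1 := h.recurrence (n - j)
  have h2 := h'.recurrence (n - i)
  rw [sub_right_comm] at h1 h2
  apply mul_left_cancel₀ h.mu_right
  unfold rightVec
  linear_combination (q.y - omegaZ N (n - i) * p'.y) * Wbar N p' q (n - i) * h1 +
    p.μ * (q.y - omegaZ N (n - j) * p.x) * W N p q (n - 1 - j) * h2

lemma rightVec_ne_zero (h : RegW N p q) (h' : RegWbar N p' q) (i j n : ZMod N) :
    rightVec N p p' q i j n ≠ 0 :=
  mul_ne_zero (h'.Wbar_ne_zero _) (h.W_ne_zero _)

/-- At `t = t_q`, `ξ = ω^{-i} x_q`, `η = ω^{-j} x_q` a factor `x_q` splits off and the coefficients of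
`C_{ξ,η}` become numerators and denominators of the weights. -/
lemma opCxi_right_mulVec (hy : p.y ≠ 0) (hy' : p'.y ≠ 0) (i j n : ZMod N) (v : ZMod N → ℂ) :
    (opCxi N (rapParams p p') q.t (omegaZ N (-i) * q.x) (omegaZ N (-j) * q.x) *ᵥ v) n =
      q.x / (omegaZ N n * (p.y * p'.y)) *
        (p.μ * p'.μ * (omega N * p'.x - omegaZ N (n - i) * q.x) *
          (q.y - omegaZ N (n - j) * p.x) * v (n - 1) -
        (p.y - omegaZ N (n - j) * q.x) * (q.y - omegaZ N (n - i) * p'.y) * v n) := by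
  rw [opCxi_mulVec _ _ _ _ _ _ hy hy']
  simp only [rapParams, Rapidity.t, omegaZ_sub, omegaZ_neg]
  have h1 := omegaZ_ne_zero n
  have h2 := omegaZ_ne_zero i
  have h3 := omegaZ_ne_zero j
  field_simp
  ring

lemma opCxi_right_mulVec_rightVec (h : RegW N p q) (h' : RegWbar N p' q) (hy : p.y ≠ 0)
    (hy' : p'.y ≠ 0) (i j n : ZMod N) :
    (opCxi N (rapParams p p') q.t (omegaZ N (-i) * q.x) (omegaZ N (-j) * q.x) *ᵥ
      rightVec N p p' q i j) n = 0 := by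
  rw [opCxi_right_mulVec hy hy', rightVec_recurrence h h', sub_self, mul_zero]

lemma eq_prod_of_ratio {f r : ℕ → ℂ} (h : ∀ k, f (k + 1) = f k * r k) (n : ℕ) :
    f n = f 0 * ∏ m ∈ Finset.range n, r m := by
  induction n with
  | zero => simp
  | succ n ih => rw [h, ih, Finset.prod_range_succ, mul_assoc]

lemma potVec_eq (h : RegW N p q) (h' : RegWbar N p' q) (hx : q.x ≠ 0) (i j : ZMod N) :
    potVec N p p' q i j = rightVec N p p' q i j := by
  funext n
  set r : ℕ → ℂ := fun m => ((rapParams p p').c *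
      (omega N * (rapParams p p').a' - omega N ^ (m + 1) * (omegaZ N (-i) * q.x)) *
      (q.t - omega N ^ (m + 1) * (rapParams p p').a * (omegaZ N (-j) * q.x))) /
      (((rapParams p p').b - omega N ^ (m + 1) * (omegaZ N (-j) * q.x)) *
      (q.t - omega N ^ (m + 1) * (rapParams p p').b' * (omegaZ N (-i) * q.x))) with hr
  have key := eq_prod_of_ratio (f := fun k : ℕ => rightVec N p p' q i j (k : ZMod N)) (r := r) ?_
    n.val
  · simp only [ZMod.natCast_val, ZMod.cast_id', id, Nat.cast_zero] at key
    rw [key, rightVec, zero_sub, zero_sub]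
    rfl
  · intro k
    have h1 := rightVec_recurrence h h' i j ((k : ZMod N) + 1)
    have h2 := h.den_ne_zero ((k : ZMod N) + 1 - j)
    have h3 := h'.den_ne_zero ((k : ZMod N) + 1 - i)
    rw [add_sub_cancel_right] at h1
    have e (i : ZMod N) : omegaZ N ((k : ZMod N) + 1 - i) = omega N ^ (k + 1) * omegaZ N (-i) := by
      rw [← omegaZ_natCast, ← omegaZ_add]
      push_cast
      rw [sub_eq_add_neg]
    rw [e] at h2 h3
    rw [e, e] at h1
    simp only [hr, rapParams, Rapidity.t, Nat.cast_add, Nat.cast_one]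
    generalize omega N ^ (k + 1) = E at *
    have h4 : q.x * q.y - E * p'.y * (omegaZ N (-i) * q.x) =
      q.x * (q.y - E * omegaZ N (-i) * p'.y) := by ring
    have h5 : p.y - E * (omegaZ N (-j) * q.x) = p.y - E * omegaZ N (-j) * q.x := by ring
    rw [h4, h5, mul_div_assoc', eq_div_iff (mul_ne_zero h2 (mul_ne_zero hx h3))]
    linear_combination q.x * h1

lemma rightVec_kernel (h : RegW N p q) (h' : RegWbar N p' q) (hy : p.y ≠ 0) (hy' : p'.y ≠ 0)
    (hx : q.x ≠ 0) (i j : ZMod N) :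
    LinearMap.ker (Matrix.mulVecLin
      (opCxi N (rapParams p p') q.t (omegaZ N (-i) * q.x) (omegaZ N (-j) * q.x))) =
        Submodule.span ℂ {rightVec N p p' q i j} := by
  apply le_antisymm
  · intro u hu
    rw [LinearMap.mem_ker, Matrix.mulVecLin_apply] at hu
    rw [Submodule.mem_span_singleton]
    refine ⟨u 0 / rightVec N p p' q i j 0, ?_⟩
    refine eq_of_recurrence
      (α := fun n => (p.y - omegaZ N (n - j) * q.x) * (q.y - omegaZ N (n - i) * p'.y))
      (β := fun n => p.μ * p'.μ * (omega N * p'.x - omegaZ N (n - i) * q.x) *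
        (q.y - omegaZ N (n - j) * p.x))
      (fun n => mul_ne_zero (h.den_ne_zero _) (h'.den_ne_zero _)) (fun n => ?_) (fun n => ?_) ?_
    · have := rightVec_recurrence h h' i j n
      simp only [Pi.smul_apply, smul_eq_mul]
      linear_combination (u 0 / rightVec N p p' q i j 0) * this
    · have h0 := congrFun hu n
      rw [opCxi_right_mulVec hy hy', Pi.zero_apply, mul_eq_zero] at h0
      rcases h0 with h0 | h0
      · exact absurd h0 (div_ne_zero hx (mul_ne_zero (omegaZ_ne_zero n) (mul_ne_zero hy hy')))
      · exact (sub_eq_zero.mp h0).symm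
    · simp only [Pi.smul_apply, smul_eq_mul]
      exact div_mul_cancel₀ _ (rightVec_ne_zero h h' i j 0)
  · rw [Submodule.span_singleton_le_iff_mem, LinearMap.mem_ker, Matrix.mulVecLin_apply]
    funext n
    exact opCxi_right_mulVec_rightVec h h' hy hy' i j n

lemma transferT_apply (L : ℕ) [NeZero L] (j j' : Fin L → ZMod N) :
    transferT N L p p' q j j' = ∏ l, rightVec N p p' q (j' (l - 1)) (j' l) (j l) := by
  simp only [transferT, Matrix.of_apply, rightVec, Finset.prod_mul_distrib]
  rw [mul_comm, ← prod_shift fun l => Wbar N p' q (j l - j' (l - 1))]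
  simp

/-- The factors `⟨j|` leave only one sequence of auxiliary indices, the shifted spins. -/
lemma opQR_eq (h : RegW N p q) (h' : RegWbar N p' q) (hx : q.x ≠ 0) (L : ℕ) [NeZero L] :
    opQR N p p' q L = transferT N L p p' q := by
  ext j j'
  have h1 : opQR N p p' q L j j' = ∑ i : Fin L → ZMod N, ∏ l,
      (potVec N p p' q (i l) (i (l + 1)) (j l) * (Pi.single (i (l + 1)) (1 : ℂ) : _ → ℂ) (j' l)) :=
    rfl
  rw [h1, transferT_apply, Finset.sum_eq_single fun l => j' (l - 1)]
  · refine Finset.prod_congr rfl fun l _ => ?_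
    rw [potVec_eq h h' hx]
    simp
  · intro i _ hi
    obtain ⟨l, hl⟩ : ∃ l, i l ≠ j' (l - 1) := Function.ne_iff.mp hi
    refine Finset.prod_eq_zero (Finset.mem_univ (l - 1)) ?_
    rw [sub_add_cancel, Pi.single_eq_of_ne hl.symm, mul_zero]
  · simp

/-- The first diagonal entry of the triangularised `L`-operator acting on `rightVec`. -/
lemma right_diag_zero (h : RegW N p q) (h' : RegWbar N p' q) (hy : p.y ≠ 0) (hy' : p'.y ≠ 0)
    (i j n : ZMod N) :
    (opA N (rapParams p p') q.t *ᵥ rightVec N p p' q i j) n -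
      omegaZ N (-j) * q.x * (opB N (rapParams p p') q.t *ᵥ rightVec N p p' q i j) n =
    (p.y - q.x) * (p'.t - (omega N)⁻¹ * q.t) / (p.y * p'.y * (p'.x - (omega N)⁻¹ * q.x)) *
      rightVec N p p' (autUinv N q) i j n := by
  have hw := omega_ne_zero (N := N)
  have hU1 := h.W_autUinv (n - j)
  have hU2 := h'.Wbar_autUinv (n - i)
  have hr := rightVec_recurrence h h' i j n
  have n1 := h'.num_ne_zero (n - i)
  have n2 := h.num_ne_zero (n - j)
  have n3 : p.y - q.x ≠ 0 := by simpa using h.den_ne_zero 0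
  have n4 : omega N * p'.x - q.x ≠ 0 := by simpa using h'.num_ne_zero 0
  have hm := h.mu_left
  have hm' := h'.mu_left
  have e1 : (p.y - q.x) * (p'.t - (omega N)⁻¹ * q.t) /
      (p.y * p'.y * (p'.x - (omega N)⁻¹ * q.x)) =
      (p.y - q.x) * (omega N * p'.t - q.t) / (p.y * p'.y * (omega N * p'.x - q.x)) := by
    have : p'.x - (omega N)⁻¹ * q.x = (omega N)⁻¹ * (omega N * p'.x - q.x) := by
      field_simp
    have h2 : p'.t - (omega N)⁻¹ * q.t = (omega N)⁻¹ * (omega N * p'.t - q.t) := by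
      field_simp
    rw [this, h2]
    field_simp
  -- the ratio of the vectors for `U⁻¹ q` and `q`; with `hr` everything is a multiple of one vector
  have e2 : (p.y - q.x) * rightVec N p p' (autUinv N q) i j n *
      (omega N * p'.x - omegaZ N (n - i) * q.x) =
      rightVec N p p' q i j n * (omega N * p'.x - q.x) * (p.y - omegaZ N (n - j) * q.x) := by
    unfold rightVec
    linear_combination (p.y - q.x) * W N p (autUinv N q) (n - j) * hU2 +
      Wbar N p' q (n - i) * (omega N * p'.x - q.x) * hU1
  rw [opA_mulVec, opB_mulVec, e1]
  have e3 : omegaZ N (n - 1) = omegaZ N n / omega N := by rw [omegaZ_sub, omegaZ_one]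
  have e4 : omegaZ N n = omegaZ N (n - j) * omegaZ N j := by
    rw [← omegaZ_add, sub_add_cancel]
  have e5 : omegaZ N (-j) = (omegaZ N j)⁻¹ := omegaZ_neg j
  rw [e3, e4, e5]
  have hj := omegaZ_ne_zero j
  generalize rightVec N p p' (autUinv N q) i j n = s' at *
  generalize rightVec N p p' q i j n = s at *
  generalize rightVec N p p' q i j (n - 1) = s0 at *
  generalize omegaZ N (n - j) = E at *
  generalize omegaZ N (n - i) = F at *
  generalize omegaZ N j = J at *
  simp only [rapParams, Rapidity.t]
  have lhs : s - q.x * q.y * (p.μ * p'.μ / (p'.y * p.y)) * s0 - J⁻¹ * q.x *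
      (1 / p.y * (E * J * s) -
        omega N * (p.x * (p.μ * p'.μ) / (p'.y * p.y)) * (E * J / omega N * s0)) =
      (p'.y * (p.y - E * q.x) * s - q.x * (p.μ * p'.μ * (q.y - E * p.x) * s0)) /
        (p.y * p'.y) := by
    field_simp
    ring
  rw [lhs, eq_comm, mul_comm, mul_div_assoc', div_eq_div_iff (by
    exact mul_ne_zero (mul_ne_zero hy hy') n4) (mul_ne_zero hy hy')]
  apply mul_left_cancel₀ n1
  linear_combination (p.y * p'.y) * (omega N * (p'.x * p'.y) - q.x * q.y) * e2 -
    (p.y * p'.y * (omega N * p'.x - q.x)) * q.x * hr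

/-- The second diagonal entry of the triangularised `L`-operator acting on `rightVec`. The quotient
`ω^j / ω^i` drops out of the product over the chain. -/
lemma right_diag_one (h : RegW N p q) (h' : RegWbar N p' q) (hy : p.y ≠ 0) (hy' : p'.y ≠ 0)
    (i j n : ZMod N) :
    omegaZ N (-i) * q.x * (opB N (rapParams p p') q.t *ᵥ rightVec N p p' q i j) n +
      (opD N (rapParams p p') q.t *ᵥ rightVec N p p' q i j) n =
    omegaZ N j / omegaZ N i *
      ((p'.y - q.y) * (p.t - q.t) / (p.y * p'.y * (p.x - q.y)) *
        rightVec N p p' (autR N (autR N (autUinv N q))) i j n) := by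
  have hw := omega_ne_zero (N := N)
  have hU1 := W_autRR (p := p) (q := q) (n - j)
  have hU2 := h'.Wbar_autRR (n - i)
  have hr := rightVec_recurrence h h' i j n
  have n2 := h.num_ne_zero (n - j)
  have n3 : q.y - p'.y ≠ 0 := by simpa using h'.den_ne_zero 0
  have n4 : q.y - p.x ≠ 0 := by simpa using h.num_ne_zero 0
  have n4' : p.x - q.y ≠ 0 := by rw [← neg_sub]; exact neg_ne_zero.mpr n4
  have hF := omegaZ_ne_zero (n - i)
  have hE := omegaZ_ne_zero (n - j)
  have hj := omegaZ_ne_zero j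
  have hi := omegaZ_ne_zero i
  have e2 : omegaZ N (n - i) * rightVec N p p' (autR N (autR N (autUinv N q))) i j n *
      ((q.y - omegaZ N (n - j) * p.x) * (q.y - p'.y)) =
      omegaZ N (n - j) * rightVec N p p' q i j n *
        ((q.y - p.x) * (q.y - omegaZ N (n - i) * p'.y)) := by
    unfold rightVec
    linear_combination (q.y - omegaZ N (n - j) * p.x) *
      W N p (autR N (autR N (autUinv N q))) (n - j) * hU2 +
      Wbar N p' q (n - i) * (q.y - omegaZ N (n - i) * p'.y) * hU1
  rw [opB_mulVec, opD_mulVec]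
  have e3 : omegaZ N (n - 1) = omegaZ N n / omega N := by rw [omegaZ_sub, omegaZ_one]
  have e4 : omegaZ N n = omegaZ N (n - i) * omegaZ N i := by
    rw [← omegaZ_add, sub_add_cancel]
  have e5 : omegaZ N (-i) = (omegaZ N i)⁻¹ := omegaZ_neg i
  have e6 : omegaZ N j / omegaZ N i = omegaZ N (n - i) / omegaZ N (n - j) := by
    rw [omegaZ_sub, omegaZ_sub]
    have := omegaZ_ne_zero n
    field_simp
  rw [e6, e3, e4, e5]
  generalize rightVec N p p' (autR N (autR N (autUinv N q))) i j n = s' at *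
  generalize rightVec N p p' q i j n = s at *
  generalize rightVec N p p' q i j (n - 1) = s0 at *
  generalize omegaZ N (n - j) = E at *
  generalize omegaZ N (n - i) = F at *
  generalize omegaZ N i = J at *
  simp only [rapParams, Rapidity.t]
  have lhs : J⁻¹ * q.x * (1 / p.y * (F * J * s) -
        omega N * (p.x * (p.μ * p'.μ) / (p'.y * p.y)) * (F * J / omega N * s0)) +
      (-(q.x * q.y * (1 / (p'.y * p.y))) * s +
        omega N * (p'.x * p.x * (p.μ * p'.μ) / (p'.y * p.y)) * s0) =
      (p.x * (p.μ * p'.μ * (omega N * p'.x - F * q.x) * s0) - q.x * (q.y - F * p'.y) * s) /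
        (p.y * p'.y) := by
    field_simp
    ring
  have rhs : F / E * ((p'.y - q.y) * (p.x * p.y - q.x * q.y) / (p.y * p'.y * (p.x - q.y)) * s') =
      (p.x * p.y - q.x * q.y) * (F * s' * (q.y - p'.y)) / (E * (q.y - p.x) * (p.y * p'.y)) := by
    rw [← neg_sub q.y p.x, ← neg_sub q.y p'.y]
    field_simp
  rw [lhs, rhs, div_eq_div_iff (mul_ne_zero hy hy')
    (mul_ne_zero (mul_ne_zero hE n4) (mul_ne_zero hy hy'))]
  apply mul_left_cancel₀ n2
  linear_combination -(p.x * p.y - q.x * q.y) * (p.y * p'.y) * e2 -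
    p.x * E * (q.y - p.x) * (p.y * p'.y) * hr

lemma prod_div_shift_eq_one (L : ℕ) [NeZero L] (f : Fin L → ℂ) (hf : ∀ l, f l ≠ 0) :
    ∏ l, f l / f (l - 1) = 1 := by
  rw [Finset.prod_div_distrib, ← prod_shift fun l => f (l - 1)]
  simp only [add_sub_cancel_right]
  exact div_self (Finset.prod_ne_zero_iff.mpr fun l _ => hf l)

lemma lower_gauge_mul_inv (ξ : ℂ) :
    (!![1, 0; -ξ, 1] : Matrix (Fin 2) (Fin 2) ℂ) * !![1, 0; ξ, 1] = 1 := by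
  ext a b
  fin_cases a <;> fin_cases b <;> simp [Matrix.mul_apply, Fin.sum_univ_two]

/-- A cyclic trace of two by two matrices whose `C_{ξ,η}` entries vanish, with cyclically matching
`ξ` and `η`, is the sum of the two products of diagonal entries after triangularisation. -/
lemma cyclicTrace_of_gauge (L : ℕ) [NeZero L] (m : Fin L → Matrix (Fin 2) (Fin 2) ℂ)
    (ξ : Fin L → ℂ)
    (h : ∀ l, ξ l * m l 0 0 + m l 1 0 - ξ l * ξ (l + 1) * m l 0 1 - ξ (l + 1) * m l 1 1 = 0) :
    cyclicTrace m = ∏ l, (m l 0 0 - ξ (l + 1) * m l 0 1) + ∏ l, (ξ l * m l 0 1 + m l 1 1) := by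
  rw [cyclicTrace_gauge (fun l => !![1, 0; -ξ l, 1]) (fun l => !![1, 0; ξ l, 1]) m
    fun l => lower_gauge_mul_inv (ξ l), cyclicTrace_of_triangular]
  · congr 1
    · refine Finset.prod_congr rfl fun l _ => ?_
      simp [Matrix.mul_apply, Matrix.vecMul, dotProduct, Fin.sum_univ_two]
      ring
    · refine Finset.prod_congr rfl fun l _ => ?_
      simp [Matrix.mul_apply, Matrix.vecMul, dotProduct, Fin.sum_univ_two]
  · intro l
    rw [← h l]
    simp [Matrix.mul_apply, Matrix.vecMul, dotProduct, Fin.sum_univ_two]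
    ring

theorem tau2_mul_transferT (h : RegW N p q) (h' : RegWbar N p' q) (hy : p.y ≠ 0)
    (hy' : p'.y ≠ 0) (L : ℕ) [NeZero L] :
    tau2 N (rapParams p p') L ((omega N)⁻¹ * q.t) * transferT N L p p' q =
      ((p.y - q.x) * (p'.t - (omega N)⁻¹ * q.t) /
          (p.y * p'.y * (p'.x - (omega N)⁻¹ * q.x))) ^ L •
        transferT N L p p' (autUinv N q) +
      ((p'.y - q.y) * (p.t - q.t) / (p.y * p'.y * (p.x - q.y))) ^ L •
        transferT N L p p' (autR N (autR N (autUinv N q))) := by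
  ext j j'
  have ht : omega N * ((omega N)⁻¹ * q.t) = q.t := mul_inv_cancel_left₀ omega_ne_zero _
  rw [tau2, ht, chainTrace_mul_of_prod (lOp N (rapParams p p') q.t) (transferT N L p p' q) j'
    (fun l => rightVec N p p' q (j' (l - 1)) (j' l)) (fun j => transferT_apply L j j')]
  rw [cyclicTrace_of_gauge L _ fun l => omegaZ N (-j' (l - 1)) * q.x]
  · simp only [Matrix.of_apply, lOp, Matrix.cons_val', Matrix.cons_val_zero, Matrix.cons_val_one,
      Matrix.cons_val_fin_one, add_sub_cancel_right, right_diag_zero h h' hy hy',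
      right_diag_one h h' hy hy', Matrix.add_apply, Matrix.smul_apply, transferT_apply,
      smul_eq_mul]
    rw [Finset.prod_mul_distrib, Finset.prod_mul_distrib, Finset.prod_mul_distrib,
      prod_div_shift_eq_one L (fun l => omegaZ N (j' l)) fun l => omegaZ_ne_zero _]
    simp only [one_mul, Finset.prod_const, Finset.card_univ, Fintype.card_fin]
  · intro l
    have := opCxi_right_mulVec_rightVec h h' hy hy' (j' (l - 1)) (j' l) (j l)
    rw [opCxi_mulVec_eq] at this
    simp only [Matrix.of_apply, lOp, Matrix.cons_val', Matrix.cons_val_zero, Matrix.cons_val_one,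
      Matrix.cons_val_fin_one, add_sub_cancel_right]
    linear_combination this

theorem rightIdentification (h : RegW N p q) (h' : RegWbar N p' q) (hy : p.y ≠ 0)
    (hy' : p'.y ≠ 0) : RightIdentification N p p' q where
  periodicW := h.periodic
  periodicWbar := h'.periodic
  kernel hx i j := by
    rw [potVec_eq h h' hx]
    exact ⟨fun h0 => rightVec_ne_zero h h' i j 0 (congrFun h0 0),
      rightVec_kernel h h' hy hy' hx i j⟩
  vec_eq hx i j n := by
    rw [potVec_eq h h' hx]
    rfl
  QR_eq hx L _ := opQR_eq h h' hx L
  tauT L _ := tau2_mul_transferT h h' hy hy' L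

end Right

/-! ### The identification of `T̂` with `Q_L` and its functional relation -/

section Left

variable {N : ℕ} [NeZero N] {p p' q : Rapidity}

/-- The local factor of a row of `T̂_{p,p'}(q)`. -/
noncomputable def leftVec (N : ℕ) (p p' q : Rapidity) (i j n : ZMod N) : ℂ :=
  W N p' q (i - n) * Wbar N p q (j - n)

/-- The product of the recurrences of the two weights, with reflected arguments. -/
lemma leftVec_recurrence (h : RegW N p' q) (h' : RegWbar N p q) (i j n : ZMod N) :
    p.μ * p'.μ * (p'.x - omegaZ N (n - i) * q.y) *
        (q.x - omega N * omegaZ N (n - j) * p.x) * leftVec N p p' q i j (n + 1) =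
      (p.y - omegaZ N (n - j) * q.y) * (q.x - omegaZ N (n - i) * p'.y) *
        leftVec N p p' q i j n := by
  have h1 := h.recurrence (i - n)
  have h2 := h'.recurrence (j - n)
  rw [sub_sub] at h1 h2
  have e1 : omegaZ N (i - n) = (omegaZ N (n - i))⁻¹ := by rw [← omegaZ_neg, neg_sub]
  have e2 : omegaZ N (j - n) = (omegaZ N (n - j))⁻¹ := by rw [← omegaZ_neg, neg_sub]
  have n1 := omegaZ_ne_zero (n - i)
  have n2 := omegaZ_ne_zero (n - j)
  have hm := h.mu_right
  unfold leftVec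
  rw [e1] at h1
  rw [e2] at h2
  generalize omegaZ N (n - i) = F at *
  generalize omegaZ N (n - j) = E at *
  field_simp at h1 h2
  apply mul_left_cancel₀ hm
  linear_combination (p.y - E * q.y) * Wbar N p q (j - n) * h1 -
    p'.μ * (q.y * F - p'.x) * W N p' q (i - (n + 1)) * h2

lemma leftVec_ne_zero (h : RegW N p' q) (h' : RegWbar N p q) (i j n : ZMod N) :
    leftVec N p p' q i j n ≠ 0 :=
  mul_ne_zero (h.W_ne_zero _) (h'.Wbar_ne_zero _)

lemma RegW.left_num_ne_zero (h : RegW N p' q) (n : ZMod N) : p'.x - omegaZ N n * q.y ≠ 0 :=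
  sub_omegaZ_mul_ne_zero h.ne'.symm n

lemma RegWbar.left_den_ne_zero (h : RegWbar N p q) (n : ZMod N) : p.y - omegaZ N n * q.y ≠ 0 :=
  sub_omegaZ_mul_ne_zero h.ne.symm n

lemma RegWbar.left_num_ne_zero (h : RegWbar N p q) (n : ZMod N) :
    q.x - omega N * omegaZ N n * p.x ≠ 0 := by
  rw [mul_assoc, mul_left_comm]
  apply sub_omegaZ_mul_ne_zero
  rw [mul_pow, omega_pow, one_mul]
  exact h.ne'.symm

lemma vecMul_opCxi_left (hy : p.y ≠ 0) (hy' : p'.y ≠ 0) (i j n : ZMod N) (v : ZMod N → ℂ) :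
    (v ᵥ* opCxi N (rapParams p p') q.t (omegaZ N (-i) * q.y) (omegaZ N (-j) * q.y)) n =
      q.y / (omegaZ N n * (p.y * p'.y)) *
        (p.μ * p'.μ * (p'.x - omegaZ N (n - i) * q.y) *
          (q.x - omega N * omegaZ N (n - j) * p.x) * v (n + 1) -
        (p.y - omegaZ N (n - j) * q.y) * (q.x - omegaZ N (n - i) * p'.y) * v n) := by
  rw [vecMul_opCxi _ _ _ _ _ _ hy hy']
  simp only [rapParams, Rapidity.t, omegaZ_sub, omegaZ_neg]
  have h1 := omegaZ_ne_zero n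
  have h2 := omegaZ_ne_zero i
  have h3 := omegaZ_ne_zero j
  field_simp
  ring

lemma leftVec_vecMul_opCxi (h : RegW N p' q) (h' : RegWbar N p q) (hy : p.y ≠ 0)
    (hy' : p'.y ≠ 0) (i j n : ZMod N) :
    (leftVec N p p' q i j ᵥ*
      opCxi N (rapParams p p') q.t (omegaZ N (-i) * q.y) (omegaZ N (-j) * q.y)) n = 0 := by
  rw [vecMul_opCxi_left hy hy', leftVec_recurrence h h', sub_self, mul_zero]

lemma potCovec_eq (h : RegW N p' q) (h' : RegWbar N p q) (hx : q.y ≠ 0) (i j : ZMod N) :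
    potCovec N p p' q i j = leftVec N p p' q i j := by
  funext n
  set r : ℕ → ℂ := fun m => (((rapParams p p').b - omega N ^ m * (omegaZ N (-j) * q.y)) *
      (q.t - omega N ^ m * (rapParams p p').b' * (omegaZ N (-i) * q.y))) /
      ((rapParams p p').c * ((rapParams p p').a' - omega N ^ m * (omegaZ N (-i) * q.y)) *
      (q.t - omega N ^ (m + 1) * (rapParams p p').a * (omegaZ N (-j) * q.y))) with hr
  have key := eq_prod_of_ratio (f := fun k : ℕ => leftVec N p p' q i j (k : ZMod N)) (r := r) ?_
    n.val
  · simp only [ZMod.natCast_val, ZMod.cast_id', id, Nat.cast_zero] at key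
    rw [key, leftVec, sub_zero, sub_zero]
    rfl
  · intro k
    have h1 := leftVec_recurrence h h' i j (k : ZMod N)
    have h2 := h.left_num_ne_zero ((k : ZMod N) - i)
    have h3 := h'.left_num_ne_zero ((k : ZMod N) - j)
    have hm := h.mu_left
    have hm' := h'.mu_left
    have e (i : ZMod N) : omegaZ N ((k : ZMod N) - i) = omega N ^ k * omegaZ N (-i) := by
      rw [← omegaZ_natCast, ← omegaZ_add, sub_eq_add_neg]
    rw [e] at h2 h3
    rw [e, e] at h1
    simp only [hr, rapParams, Rapidity.t, Nat.cast_add, Nat.cast_one, pow_succ]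
    generalize omega N ^ k = E at *
    have h4 : q.x * q.y - E * omega N * p.x * (omegaZ N (-j) * q.y) =
      q.y * (q.x - omega N * (E * omegaZ N (-j)) * p.x) := by ring
    have h5 : p'.x - E * (omegaZ N (-i) * q.y) = p'.x - E * omegaZ N (-i) * q.y := by ring
    rw [h4, h5, mul_div_assoc', eq_div_iff (mul_ne_zero (mul_ne_zero (mul_ne_zero hm' hm) h2)
      (mul_ne_zero hx h3))]
    linear_combination q.y * h1

lemma leftVec_kernel (h : RegW N p' q) (h' : RegWbar N p q) (hy : p.y ≠ 0) (hy' : p'.y ≠ 0)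
    (hx : q.y ≠ 0) (i j : ZMod N) :
    LinearMap.ker (Matrix.vecMulLinear
      (opCxi N (rapParams p p') q.t (omegaZ N (-i) * q.y) (omegaZ N (-j) * q.y))) =
        Submodule.span ℂ {leftVec N p p' q i j} := by
  apply le_antisymm
  · intro u hu
    rw [LinearMap.mem_ker, Matrix.vecMulLinear_apply] at hu
    rw [Submodule.mem_span_singleton]
    refine ⟨u 0 / leftVec N p p' q i j 0, ?_⟩
    refine eq_of_recurrence
      (α := fun n => p.μ * p'.μ * (p'.x - omegaZ N (n - 1 - i) * q.y) *
          (q.x - omega N * omegaZ N (n - 1 - j) * p.x))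
      (β := fun n => (p.y - omegaZ N (n - 1 - j) * q.y) * (q.x - omegaZ N (n - 1 - i) * p'.y))
      (fun n => mul_ne_zero (mul_ne_zero (mul_ne_zero h'.mu_left h.mu_left)
        (h.left_num_ne_zero _)) (h'.left_num_ne_zero _)) (fun n => ?_) (fun n => ?_) ?_
    · have := leftVec_recurrence h h' i j (n - 1)
      rw [sub_add_cancel] at this
      simp only [Pi.smul_apply, smul_eq_mul]
      linear_combination (u 0 / leftVec N p p' q i j 0) * this
    · have h0 := congrFun hu (n - 1)
      rw [vecMul_opCxi_left hy hy', Pi.zero_apply, mul_eq_zero, sub_add_cancel] at h0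
      rcases h0 with h0 | h0
      · exact absurd h0 (div_ne_zero hx (mul_ne_zero (omegaZ_ne_zero _) (mul_ne_zero hy hy')))
      · exact sub_eq_zero.mp h0
    · simp only [Pi.smul_apply, smul_eq_mul]
      exact div_mul_cancel₀ _ (leftVec_ne_zero h h' i j 0)
  · rw [Submodule.span_singleton_le_iff_mem, LinearMap.mem_ker, Matrix.vecMulLinear_apply]
    funext n
    exact leftVec_vecMul_opCxi h h' hy hy' i j n

lemma transferThat_apply (L : ℕ) [NeZero L] (j j' : Fin L → ZMod N) :
    transferThat N L p p' q j j' = ∏ l, leftVec N p p' q (j (l - 1)) (j l) (j' l) := by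
  simp only [transferThat, Matrix.of_apply, leftVec, Finset.prod_mul_distrib]
  rw [mul_comm, ← prod_shift fun l => W N p' q (j (l - 1) - j' l)]
  simp

lemma opQL_eq (h : RegW N p' q) (h' : RegWbar N p q) (hx : q.y ≠ 0) (L : ℕ) [NeZero L] :
    opQL N p p' q L = transferThat N L p p' q := by
  ext j j'
  have h1 : opQL N p p' q L j j' = ∑ i : Fin L → ZMod N, ∏ l,
      ((Pi.single (i (l + 1)) (1 : ℂ) : _ → ℂ) (j l) *
        potCovec N p p' q (i l) (i (l + 1)) (j' l)) :=
    rfl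
  rw [h1, transferThat_apply, Finset.sum_eq_single fun l => j (l - 1)]
  · refine Finset.prod_congr rfl fun l _ => ?_
    rw [potCovec_eq h h' hx]
    simp
  · intro i _ hi
    obtain ⟨l, hl⟩ : ∃ l, i l ≠ j (l - 1) := Function.ne_iff.mp hi
    refine Finset.prod_eq_zero (Finset.mem_univ (l - 1)) ?_
    rw [sub_add_cancel, Pi.single_eq_of_ne hl.symm, zero_mul]
  · simp

/-- The first diagonal entry of the triangularised `L`-operator, `leftVec` acting on it. -/
lemma left_diag_zero (h : RegW N p' q) (h' : RegWbar N p q) (hy : p.y ≠ 0) (hy' : p'.y ≠ 0)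
    (i j n : ZMod N) :
    (leftVec N p p' q i j ᵥ* opA N (rapParams p p') q.t) n -
      omegaZ N (-j) * q.y * (leftVec N p p' q i j ᵥ* opB N (rapParams p p') q.t) n =
    (p.y - q.y) * (p'.t - q.t) / (p.y * p'.y * (p'.x - q.y)) *
      leftVec N p p' (autR N (autR N (autUinv N q))) i j n := by
  have hw := omega_ne_zero (N := N)
  have hU1 := W_autRR (p := p') (q := q) (i - n)
  have hU2 := h'.Wbar_autRR (j - n)
  have hr := leftVec_recurrence h h' i j n
  have n1 := h.left_num_ne_zero (n - i)
  have n2 := h'.left_den_ne_zero (n - j)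
  have n3 : p.y - q.y ≠ 0 := by simpa using h'.left_den_ne_zero 0
  have n4 : p'.x - q.y ≠ 0 := by simpa using h.left_num_ne_zero 0
  have hF := omegaZ_ne_zero (n - i)
  have hE := omegaZ_ne_zero (n - j)
  have e1 : omegaZ N (i - n) = (omegaZ N (n - i))⁻¹ := by rw [← omegaZ_neg, neg_sub]
  have e2 : omegaZ N (j - n) = (omegaZ N (n - j))⁻¹ := by rw [← omegaZ_neg, neg_sub]
  have e3 : leftVec N p p' (autR N (autR N (autUinv N q))) i j n *
      ((p'.x - omegaZ N (n - i) * q.y) * (p.y - q.y)) =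
      leftVec N p p' q i j n * ((p'.x - q.y) * (p.y - omegaZ N (n - j) * q.y)) := by
    rw [e1] at hU1
    rw [e2] at hU2
    unfold leftVec
    generalize omegaZ N (n - i) = F at *
    generalize omegaZ N (n - j) = E at *
    field_simp at hU1 hU2
    linear_combination (q.y - p.y) * Wbar N p (autR N (autR N (autUinv N q))) (j - n) * hU1 +
      (q.y - p'.x) * W N p' q (i - n) * hU2
  rw [vecMul_opA, vecMul_opB]
  have e4 : omegaZ N n = omegaZ N (n - j) * omegaZ N j := by
    rw [← omegaZ_add, sub_add_cancel]
  have e5 : omegaZ N (-j) = (omegaZ N j)⁻¹ := omegaZ_neg j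
  have hj := omegaZ_ne_zero j
  rw [e4, e5]
  generalize leftVec N p p' (autR N (autR N (autUinv N q))) i j n = s' at *
  generalize leftVec N p p' q i j n = s at *
  generalize leftVec N p p' q i j (n + 1) = s1 at *
  generalize omegaZ N (n - j) = E at *
  generalize omegaZ N (n - i) = F at *
  generalize omegaZ N j = J at *
  simp only [rapParams, Rapidity.t]
  have lhs : s - q.x * q.y * (p.μ * p'.μ / (p'.y * p.y)) * s1 - J⁻¹ * q.y *
      ((1 / p.y * s - omega N * (p.x * (p.μ * p'.μ) / (p'.y * p.y)) * s1) * (E * J)) =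
      (p'.y * (p.y - E * q.y) * s - q.y * (p.μ * p'.μ * (q.x - omega N * E * p.x) * s1)) /
        (p.y * p'.y) := by
    field_simp
    ring
  rw [lhs, eq_comm, mul_comm, mul_div_assoc', div_eq_div_iff (by
    exact mul_ne_zero (mul_ne_zero hy hy') n4) (mul_ne_zero hy hy')]
  apply mul_left_cancel₀ n1
  linear_combination (p.y * p'.y) * (p'.x * p'.y - q.x * q.y) * e3 +
    (p.y * p'.y * (p'.x - q.y)) * q.y * hr

/-- The second diagonal entry of the triangularised `L`-operator, `leftVec` acting on it. The
quotient of powers of `ω` drops out of the product over the chain. -/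
lemma left_diag_one (h : RegW N p' q) (h' : RegWbar N p q) (hy : p.y ≠ 0) (hy' : p'.y ≠ 0)
    (i j n : ZMod N) :
    omegaZ N (-i) * q.y * (leftVec N p p' q i j ᵥ* opB N (rapParams p p') q.t) n +
      (leftVec N p p' q i j ᵥ* opD N (rapParams p p') q.t) n =
    omegaZ N j / omegaZ N i *
      ((p'.y - q.x) * (p.t - (omega N)⁻¹ * q.t) / (p.y * p'.y * (p.x - (omega N)⁻¹ * q.x)) *
        leftVec N p p' (autUinv N q) i j n) := by
  have hw := omega_ne_zero (N := N)
  have hU1 := h.W_autUinv (i - n)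
  have hU2 := h'.Wbar_autUinv (j - n)
  have hr := leftVec_recurrence h h' i j n
  have n1 := h'.left_num_ne_zero (n - j)
  have n3 : p'.y - q.x ≠ 0 := by simpa using h.den_ne_zero 0
  have n4 : omega N * p.x - q.x ≠ 0 := by simpa using h'.num_ne_zero 0
  have hF := omegaZ_ne_zero (n - i)
  have hE := omegaZ_ne_zero (n - j)
  have hi := omegaZ_ne_zero i
  have e1 : omegaZ N (i - n) = (omegaZ N (n - i))⁻¹ := by rw [← omegaZ_neg, neg_sub]
  have e2 : omegaZ N (j - n) = (omegaZ N (n - j))⁻¹ := by rw [← omegaZ_neg, neg_sub]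
  have e3 : omegaZ N (n - i) * leftVec N p p' (autUinv N q) i j n *
      ((p'.y - q.x) * (q.x - omega N * omegaZ N (n - j) * p.x)) =
      omegaZ N (n - j) * leftVec N p p' q i j n *
        ((q.x - omegaZ N (n - i) * p'.y) * (omega N * p.x - q.x)) := by
    rw [e1] at hU1
    rw [e2] at hU2
    unfold leftVec
    generalize omegaZ N (n - i) = F at *
    generalize omegaZ N (n - j) = E at *
    field_simp at hU1 hU2
    linear_combination (q.x - omega N * E * p.x) * Wbar N p (autUinv N q) (j - n) * hU1 -
      W N p' q (i - n) * (F * p'.y - q.x) * hU2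
  have e6 : omegaZ N j / omegaZ N i = omegaZ N (n - i) / omegaZ N (n - j) := by
    rw [omegaZ_sub, omegaZ_sub]
    have := omegaZ_ne_zero n
    have := omegaZ_ne_zero j
    field_simp
  rw [vecMul_opB, vecMul_opD, e6]
  have e4 : omegaZ N n = omegaZ N (n - i) * omegaZ N i := by
    rw [← omegaZ_add, sub_add_cancel]
  have e5 : omegaZ N (-i) = (omegaZ N i)⁻¹ := omegaZ_neg i
  rw [e4, e5]
  generalize leftVec N p p' (autUinv N q) i j n = s' at *
  generalize leftVec N p p' q i j n = s at *
  generalize leftVec N p p' q i j (n + 1) = s1 at *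
  generalize omegaZ N (n - j) = E at *
  generalize omegaZ N (n - i) = F at *
  generalize omegaZ N i = J at *
  simp only [rapParams, Rapidity.t]
  have lhs : J⁻¹ * q.y * ((1 / p.y * s - omega N * (p.x * (p.μ * p'.μ) / (p'.y * p.y)) * s1) *
        (F * J)) + (-(q.x * q.y * (1 / (p'.y * p.y))) * s +
        omega N * (p'.x * p.x * (p.μ * p'.μ) / (p'.y * p.y)) * s1) =
      (omega N * p.x * (p.μ * p'.μ * (p'.x - F * q.y) * s1) - q.y * (q.x - F * p'.y) * s) /
        (p.y * p'.y) := by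
    field_simp
    ring
  have rhs : F / E * ((p'.y - q.x) * (p.x * p.y - (omega N)⁻¹ * (q.x * q.y)) /
      (p.y * p'.y * (p.x - (omega N)⁻¹ * q.x)) * s') =
      (omega N * (p.x * p.y) - q.x * q.y) * (F * s' * (p'.y - q.x)) /
        (E * (omega N * p.x - q.x) * (p.y * p'.y)) := by
    have a1 : p.x - (omega N)⁻¹ * q.x = (omega N)⁻¹ * (omega N * p.x - q.x) := by
      field_simp
    have a2 : p.x * p.y - (omega N)⁻¹ * (q.x * q.y) =
        (omega N)⁻¹ * (omega N * (p.x * p.y) - q.x * q.y) := by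
      field_simp
    rw [a1, a2]
    field_simp
  rw [lhs, rhs, div_eq_div_iff (mul_ne_zero hy hy')
    (mul_ne_zero (mul_ne_zero hE n4) (mul_ne_zero hy hy'))]
  apply mul_left_cancel₀ n1
  linear_combination -(omega N * (p.x * p.y) - q.x * q.y) * (p.y * p'.y) * e3 +
    omega N * p.x * E * (omega N * p.x - q.x) * (p.y * p'.y) * hr

theorem transferThat_mul_tau2 (h : RegW N p' q) (h' : RegWbar N p q) (hy : p.y ≠ 0)
    (hy' : p'.y ≠ 0) (L : ℕ) [NeZero L] :
    transferThat N L p p' q * tau2 N (rapParams p p') L ((omega N)⁻¹ * q.t) =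
      ((p'.y - q.x) * (p.t - (omega N)⁻¹ * q.t) /
          (p.y * p'.y * (p.x - (omega N)⁻¹ * q.x))) ^ L •
        transferThat N L p p' (autUinv N q) +
      ((p.y - q.y) * (p'.t - q.t) / (p.y * p'.y * (p'.x - q.y))) ^ L •
        transferThat N L p p' (autR N (autR N (autUinv N q))) := by
  ext j j'
  have ht : omega N * ((omega N)⁻¹ * q.t) = q.t := mul_inv_cancel_left₀ omega_ne_zero _
  rw [tau2, ht, mul_chainTrace_of_prod (lOp N (rapParams p p') q.t) (transferThat N L p p' q) j
    (fun l => leftVec N p p' q (j (l - 1)) (j l)) (fun j' => transferThat_apply L j j')]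
  rw [cyclicTrace_of_gauge L _ fun l => omegaZ N (-j (l - 1)) * q.y]
  · simp only [Matrix.of_apply, lOp, Matrix.cons_val', Matrix.cons_val_zero, Matrix.cons_val_one,
      Matrix.cons_val_fin_one, add_sub_cancel_right, left_diag_zero h h' hy hy',
      left_diag_one h h' hy hy', Matrix.add_apply, Matrix.smul_apply, transferThat_apply,
      smul_eq_mul]
    rw [Finset.prod_mul_distrib, Finset.prod_mul_distrib, Finset.prod_mul_distrib,
      prod_div_shift_eq_one L (fun l => omegaZ N (j l)) fun l => omegaZ_ne_zero _]
    simp only [one_mul, Finset.prod_const, Finset.card_univ, Fintype.card_fin]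
    rw [add_comm]
  · intro l
    have := leftVec_vecMul_opCxi h h' hy hy' (j (l - 1)) (j l) (j' l)
    rw [vecMul_opCxi_eq] at this
    simp only [Matrix.of_apply, lOp, Matrix.cons_val', Matrix.cons_val_zero, Matrix.cons_val_one,
      Matrix.cons_val_fin_one, add_sub_cancel_right]
    linear_combination this

theorem leftIdentification (h : RegW N p' q) (h' : RegWbar N p q) (hy : p.y ≠ 0)
    (hy' : p'.y ≠ 0) : LeftIdentification N p p' q where
  periodicW := h.periodic
  periodicWbar := h'.periodic
  cokernel hx i j := by
    rw [potCovec_eq h h' hx]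
    exact ⟨fun h0 => leftVec_ne_zero h h' i j 0 (congrFun h0 0),
      leftVec_kernel h h' hy hy' hx i j⟩
  covec_eq hx i j n := by
    rw [potCovec_eq h h' hx]
    rfl
  QL_eq hx L _ := opQL_eq h h' hx L
  tauT L _ := transferThat_mul_tau2 h h' hy hy' L

end Left

/-! ### The star-triangle relation -/

section StarTriangle

variable {N : ℕ} [NeZero N]

/-- `u` and `v` are the weights `W̄` and `W` of two points `p = (x, y)`, `q = (x', y')`, with the
factors depending on `μ` removed, and none of their zeros or poles is met. -/
structure WeightPair (N : ℕ) [NeZero N] (p q : ℂ × ℂ) (u v : ZMod N → ℂ) : Prop where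
  u_zero : u 0 = 1
  v_zero : v 0 = 1
  u_rec : ∀ n, (q.2 - omegaZ N n * p.2) * u n =
    (omega N * p.1 - omegaZ N n * q.1) * u (n - 1)
  v_rec : ∀ n, (p.2 - omegaZ N n * q.1) * v n = (q.2 - omegaZ N n * p.1) * v (n - 1)
  u_den : ∀ n, q.2 - omegaZ N n * p.2 ≠ 0
  u_num : ∀ n, omega N * p.1 - omegaZ N n * q.1 ≠ 0
  v_den : ∀ n, p.2 - omegaZ N n * q.1 ≠ 0
  v_num : ∀ n, q.2 - omegaZ N n * p.1 ≠ 0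

lemma WeightPair.u_ne_zero {p q : ℂ × ℂ} {u v : ZMod N → ℂ} (h : WeightPair N p q u v)
    (n : ZMod N) : u n ≠ 0 := by
  refine zmod_cyclic_induction (P := fun n => u n ≠ 0) 0 (by simp [h.u_zero]) (fun n hn h0 => ?_) n
  have := h.u_rec (n + 1)
  rw [h0, mul_zero, add_sub_cancel_right, eq_comm] at this
  exact mul_ne_zero (h.u_num _) hn this

lemma WeightPair.v_ne_zero {p q : ℂ × ℂ} {u v : ZMod N → ℂ} (h : WeightPair N p q u v)
    (n : ZMod N) : v n ≠ 0 := by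
  refine zmod_cyclic_induction (P := fun n => v n ≠ 0) 0 (by simp [h.v_zero]) (fun n hn h0 => ?_) n
  have := h.v_rec (n + 1)
  rw [h0, mul_zero, add_sub_cancel_right, eq_comm] at this
  exact mul_ne_zero (h.v_num _) hn this

lemma sum_shift_sub_eq_zero (f : ZMod N → ℂ) : ∑ d, (f (d + 1) - f d) = 0 := by
  rw [Finset.sum_sub_distrib, sub_eq_zero]
  exact Equiv.sum_comp (Equiv.addRight (1 : ZMod N)) f

/-- The left hand side of the star-triangle relation. -/
def starSum (u₁ u₃ v₂ : ZMod N → ℂ) (a b c : ZMod N) : ℂ :=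
  ∑ d, u₃ (b - d) * v₂ (a - d) * u₁ (d - c)

/-- The star sum depends on the differences of the spins only. -/
lemma starSum_add (u₁ u₃ v₂ : ZMod N → ℂ) (a b c : ZMod N) :
    starSum u₁ u₃ v₂ (a + 1) (b + 1) (c + 1) = starSum u₁ u₃ v₂ a b c := by
  unfold starSum
  rw [← Equiv.sum_comp (Equiv.addRight (1 : ZMod N))]
  refine Finset.sum_congr rfl fun d _ => ?_
  simp only [Equiv.coe_addRight, add_sub_add_right_eq_sub]

variable {p q r : ℂ × ℂ} {u₁ v₁ u₂ v₂ u₃ v₃ : ZMod N → ℂ}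

/-- The first order recurrence of the star sum in `a`. The difference of the two sides is summed
to zero because its summand is the difference of consecutive values of a function of `d`. -/
lemma starSum_recurrence_left (h₁ : WeightPair N p q u₁ v₁) (h₂ : WeightPair N p r u₂ v₂)
    (h₃ : WeightPair N q r u₃ v₃) (a b c : ZMod N) :
    (q.2 - omegaZ N (a + 1 - b) * p.1) * (r.2 - omegaZ N (a + 1 - c) * q.1) *
        starSum u₁ u₃ v₂ a b c =
      (p.2 - omegaZ N (a + 1 - b) * q.1) * (q.2 - omegaZ N (a + 1 - c) * r.1) *
        starSum u₁ u₃ v₂ (a + 1) b c := by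
  set h : ZMod N → ℂ := fun d => (q.1 - omegaZ N (b - d) * r.1) *
    (q.2 - omegaZ N (d - c) * p.2) * (u₃ (b - d) * u₁ (d - c) * v₂ (a + 1 - d)) with hh
  have key : ∀ d, h (d + 1) - h d = -(omegaZ N (a + 1 - b))⁻¹ *
      ((q.2 - omegaZ N (a + 1 - b) * p.1) * (r.2 - omegaZ N (a + 1 - c) * q.1) *
        (u₃ (b - d) * v₂ (a - d) * u₁ (d - c)) -
      (p.2 - omegaZ N (a + 1 - b) * q.1) * (q.2 - omegaZ N (a + 1 - c) * r.1) *
        (u₃ (b - d) * v₂ (a + 1 - d) * u₁ (d - c))) := by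
    intro d
    have hw := omega_ne_zero (N := N)
    have e1 := h₁.u_rec (d + 1 - c)
    have e2 := h₂.v_rec (a + 1 - d)
    have e3 := h₃.u_rec (b - d)
    have n2 := h₂.v_den (a + 1 - d)
    rw [show d + 1 - c - 1 = d - c by ring] at e1
    rw [show a + 1 - d - 1 = a - d by ring] at e2
    have r1 : omegaZ N (d + 1 - c) = omega N * omegaZ N (d - c) := by
      rw [← omegaZ_one, ← omegaZ_add]
      congr 1
      ring
    have r2 : omegaZ N (b - (d + 1)) = omegaZ N (b - d) / omega N := by
      rw [← omegaZ_one, ← omegaZ_sub]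
      congr 1
      ring
    have r3 : omegaZ N (a + 1 - b) = omegaZ N (a + 1 - d) / omegaZ N (b - d) := by
      rw [← omegaZ_sub]
      congr 1
      ring
    have r4 : omegaZ N (a + 1 - c) = omegaZ N (a + 1 - d) * omegaZ N (d - c) := by
      rw [← omegaZ_add]
      congr 1
      ring
    have nB := omegaZ_ne_zero (b - d)
    have nA := omegaZ_ne_zero (a + 1 - d)
    simp only [hh]
    rw [r1] at e1 ⊢
    rw [r2, r3, r4, show a + 1 - (d + 1) = a - d by ring]
    rw [show b - d - 1 = b - (d + 1) by ring] at e3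
    generalize omegaZ N (b - d) = B at *
    generalize omegaZ N (a + 1 - d) = A at *
    generalize omegaZ N (d - c) = C at *
    generalize u₁ (d + 1 - c) = f1 at *
    generalize u₁ (d - c) = f0 at *
    generalize u₃ (b - (d + 1)) = g1 at *
    generalize u₃ (b - d) = g0 at *
    generalize v₂ (a - d) = k1 at *
    have hk : v₂ (a + 1 - d) = (r.2 - A * p.1) * k1 / (p.2 - A * r.1) := by
      rw [eq_div_iff n2]
      linear_combination e2
    rw [hk]
    have s1 : (q.1 - B / omega N * r.1) * (q.2 - omega N * C * p.2) * (g1 * f1 * k1) =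
        (omega N)⁻¹ * ((omega N * q.1 - B * r.1) * g1) *
          ((q.2 - omega N * C * p.2) * f1) * k1 := by
      field_simp
    rw [s1, e1, ← e3]
    have hE : k1 = (k1 / (p.2 - A * r.1)) * (p.2 - A * r.1) := by field_simp
    have hE' : (r.2 - A * p.1) * k1 / (p.2 - A * r.1) =
      (k1 / (p.2 - A * r.1)) * (r.2 - A * p.1) := by ring
    rw [hE']
    conv_lhs => enter [1]; rw [hE]
    conv_rhs => enter [2, 1, 2, 1]; rw [hE]
    generalize k1 / (p.2 - A * r.1) = E
    field_simp
    ring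
  have h0 := sum_shift_sub_eq_zero h
  simp only [key] at h0
  rw [← Finset.mul_sum, Finset.sum_sub_distrib, ← Finset.mul_sum, ← Finset.mul_sum] at h0
  rcases mul_eq_zero.mp h0 with h0 | h0
  · exact absurd h0 (neg_ne_zero.mpr (inv_ne_zero (omegaZ_ne_zero _)))
  · exact sub_eq_zero.mp h0

/-- The first order recurrence of the star sum in `b`, again by telescoping. -/
lemma starSum_recurrence_right (h₁ : WeightPair N p q u₁ v₁) (h₂ : WeightPair N p r u₂ v₂)
    (h₃ : WeightPair N q r u₃ v₃) (a b c : ZMod N) :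
    (p.2 - omegaZ N (a - b) * q.1) * (omega N * p.1 - omegaZ N (b + 1 - c) * r.1) *
        starSum u₁ u₃ v₂ a b c =
      (q.2 - omegaZ N (a - b) * p.1) * (r.2 - omegaZ N (b + 1 - c) * p.2) *
        starSum u₁ u₃ v₂ a (b + 1) c := by
  set h : ZMod N → ℂ := fun d => (r.2 - omegaZ N (a + 1 - d) * p.1) *
    (q.2 - omegaZ N (d - c) * p.2) * (u₃ (b + 1 - d) * v₂ (a - d) * u₁ (d - c)) with hh
  have key : ∀ d, h (d + 1) - h d =
      ((p.2 - omegaZ N (a - b) * q.1) * (omega N * p.1 - omegaZ N (b + 1 - c) * r.1) *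
        (u₃ (b - d) * v₂ (a - d) * u₁ (d - c)) -
      (q.2 - omegaZ N (a - b) * p.1) * (r.2 - omegaZ N (b + 1 - c) * p.2) *
        (u₃ (b + 1 - d) * v₂ (a - d) * u₁ (d - c))) := by
    intro d
    have hw := omega_ne_zero (N := N)
    have e1 := h₁.u_rec (d + 1 - c)
    have e2 := h₂.v_rec (a - d)
    have e3 := h₃.u_rec (b + 1 - d)
    have n3 := h₃.u_den (b + 1 - d)
    rw [show d + 1 - c - 1 = d - c by ring] at e1
    rw [show b + 1 - d - 1 = b - d by ring] at e3
    rw [show a - d - 1 = a - (d + 1) by ring] at e2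
    have r1 : omegaZ N (d + 1 - c) = omega N * omegaZ N (d - c) := by
      rw [← omegaZ_one, ← omegaZ_add]
      congr 1
      ring
    have r2 : omegaZ N (a + 1 - d) = omega N * omegaZ N (a - d) := by
      rw [← omegaZ_one, ← omegaZ_add]
      congr 1
      ring
    have r3 : omegaZ N (a - b) = omega N * omegaZ N (a - d) / omegaZ N (b + 1 - d) := by
      rw [← omegaZ_one, ← omegaZ_add, ← omegaZ_sub]
      congr 1
      ring
    have r4 : omegaZ N (b + 1 - c) = omegaZ N (b + 1 - d) * omegaZ N (d - c) := by
      rw [← omegaZ_add]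
      congr 1
      ring
    have nB := omegaZ_ne_zero (b + 1 - d)
    simp only [hh]
    rw [r1] at e1 ⊢
    rw [r2, r3, r4, show a + 1 - (d + 1) = a - d by ring, show b + 1 - (d + 1) = b - d by ring]
    generalize omegaZ N (b + 1 - d) = B at *
    generalize omegaZ N (a - d) = A at *
    generalize omegaZ N (d - c) = C at *
    generalize u₁ (d + 1 - c) = f1 at *
    generalize u₁ (d - c) = f0 at *
    generalize u₃ (b - d) = g0 at *
    generalize v₂ (a - (d + 1)) = k1 at *
    generalize v₂ (a - d) = k0 at *
    have hg : u₃ (b + 1 - d) = (omega N * q.1 - B * r.1) * g0 / (r.2 - B * q.2) := by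
      rw [eq_div_iff n3]
      linear_combination e3
    rw [hg]
    have s1 : (r.2 - A * p.1) * (q.2 - omega N * C * p.2) * (g0 * k1 * f1) =
        ((r.2 - A * p.1) * k1) * ((q.2 - omega N * C * p.2) * f1) * g0 := by
      ring
    rw [s1, e1, ← e2]
    have hE : g0 = (g0 / (r.2 - B * q.2)) * (r.2 - B * q.2) := by field_simp
    have hE' : (omega N * q.1 - B * r.1) * g0 / (r.2 - B * q.2) =
      (g0 / (r.2 - B * q.2)) * (omega N * q.1 - B * r.1) := by ring
    rw [hE']
    conv_lhs => enter [1]; rw [hE]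
    conv_rhs => enter [1, 2, 1, 1]; rw [hE]
    generalize g0 / (r.2 - B * q.2) = E
    field_simp
    ring
  have h0 := sum_shift_sub_eq_zero h
  simp only [key] at h0
  rw [Finset.sum_sub_distrib, ← Finset.mul_sum, ← Finset.mul_sum] at h0
  exact sub_eq_zero.mp h0

/-- The star-triangle relation up to the value of its constant: the quotient of the two sides is
unchanged when one of the three spins moves by one. -/
theorem starTriangle (h₁ : WeightPair N p q u₁ v₁) (h₂ : WeightPair N p r u₂ v₂)
    (h₃ : WeightPair N q r u₃ v₃) (a b c : ZMod N) :
    starSum u₁ u₃ v₂ a b c =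
      starSum u₁ u₃ v₂ 0 0 0 * (v₁ (a - b) * u₂ (b - c) * v₃ (a - c)) := by
  set Ψ : ZMod N → ZMod N → ZMod N → ℂ := fun a b c => v₁ (a - b) * u₂ (b - c) * v₃ (a - c)
    with hΨ
  have hΨ0 : ∀ a b c, Ψ a b c ≠ 0 := fun a b c =>
    mul_ne_zero (mul_ne_zero (h₁.v_ne_zero _) (h₂.u_ne_zero _)) (h₃.v_ne_zero _)
  set S := starSum u₁ u₃ v₂ with hS
  have sa : ∀ a b c, S (a + 1) b c / Ψ (a + 1) b c = S a b c / Ψ a b c := by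
    intro a b c
    rw [div_eq_div_iff (hΨ0 _ _ _) (hΨ0 _ _ _)]
    have e := starSum_recurrence_left h₁ h₂ h₃ a b c
    have f1 := h₁.v_rec (a + 1 - b)
    have f3 := h₃.v_rec (a + 1 - c)
    rw [show a + 1 - b - 1 = a - b by ring] at f1
    rw [show a + 1 - c - 1 = a - c by ring] at f3
    apply mul_left_cancel₀ (mul_ne_zero (h₁.v_den (a + 1 - b)) (h₃.v_den (a + 1 - c)))
    simp only [hΨ, hS]
    linear_combination -(v₁ (a - b) * u₂ (b - c) * v₃ (a - c)) * e -
      (u₂ (b - c) * starSum u₁ u₃ v₂ a b c * v₃ (a + 1 - c) *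
        (q.2 - omegaZ N (a + 1 - c) * r.1)) * f1 -
      (u₂ (b - c) * starSum u₁ u₃ v₂ a b c * v₁ (a - b) *
        (q.2 - omegaZ N (a + 1 - b) * p.1)) * f3
  have sb : ∀ a b c, S a (b + 1) c / Ψ a (b + 1) c = S a b c / Ψ a b c := by
    intro a b c
    rw [div_eq_div_iff (hΨ0 _ _ _) (hΨ0 _ _ _)]
    have e := starSum_recurrence_right h₁ h₂ h₃ a b c
    have f1 := h₁.v_rec (a - b)
    have f2 := h₂.u_rec (b + 1 - c)
    rw [show a - b - 1 = a - (b + 1) by ring] at f1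
    rw [show b + 1 - c - 1 = b - c by ring] at f2
    apply mul_left_cancel₀ (mul_ne_zero (h₁.v_num (a - b)) (h₂.u_den (b + 1 - c)))
    simp only [hΨ, hS]
    linear_combination -(v₁ (a - b) * u₂ (b - c) * v₃ (a - c)) * e +
      (u₂ (b - c) * starSum u₁ u₃ v₂ a b c * v₃ (a - c) *
        (omega N * p.1 - omegaZ N (b + 1 - c) * r.1)) * f1 -
      (starSum u₁ u₃ v₂ a b c * v₃ (a - c) * v₁ (a - (b + 1)) *
        (q.2 - omegaZ N (a - b) * p.1)) * f2
  have sc : ∀ a b c, S a b (c + 1) / Ψ a b (c + 1) = S a b c / Ψ a b c := by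
    intro a b c
    rw [← sa a b (c + 1), ← sb (a + 1) b (c + 1), hS, starSum_add]
    simp only [hΨ, add_sub_add_right_eq_sub]
  have h000 : S a b c / Ψ a b c = S 0 0 0 / Ψ 0 0 0 := by
    rw [zmod_cyclic_induction (P := fun a => S a b c / Ψ a b c = S 0 b c / Ψ 0 b c) 0 rfl
        (fun n hn => (sa n b c).trans hn) a,
      zmod_cyclic_induction (P := fun b => S 0 b c / Ψ 0 b c = S 0 0 c / Ψ 0 0 c) 0 rfl
        (fun n hn => (sb 0 n c).trans hn) b,
      zmod_cyclic_induction (P := fun c => S 0 0 c / Ψ 0 0 c = S 0 0 0 / Ψ 0 0 0) 0 rfl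
        (fun n hn => (sc 0 0 n).trans hn) c]
  rw [div_eq_iff (hΨ0 _ _ _)] at h000
  rw [h000]
  simp [hΨ, h₁.v_zero, h₂.u_zero, h₃.v_zero]

end StarTriangle

/-! ### Fourier duality of the weights and the star-triangle constant -/

section Fourier

variable {N : ℕ} [NeZero N]

/-- The discrete Fourier transform `k ↦ ∑ₙ ω^{kn} u(n)`. -/
noncomputable def hat (u : ZMod N → ℂ) (k : ZMod N) : ℂ := ∑ n, omegaZ N (k * n) * u n

lemma hat_mul_char (u : ZMod N → ℂ) (j k : ZMod N) :
    ∑ n, omegaZ N (k * n) * (omegaZ N (j * n) * u n) = hat u (k + j) := by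
  refine Finset.sum_congr rfl fun n _ => ?_
  rw [add_mul, omegaZ_add, mul_assoc]

lemma hat_shift (u : ZMod N → ℂ) (j k : ZMod N) :
    ∑ n, omegaZ N (k * n) * u (n - j) = omegaZ N (k * j) * hat u k := by
  rw [← Equiv.sum_comp (Equiv.addRight j), hat, Finset.mul_sum]
  refine Finset.sum_congr rfl fun n _ => ?_
  rw [Equiv.coe_addRight, add_sub_cancel_right, mul_add, omegaZ_add]
  ring

lemma hat_inversion (u : ZMod N → ℂ) (m : ZMod N) :
    ∑ k, omegaZ N (-(k * m)) * hat u k = N * u m := by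
  simp only [hat, Finset.mul_sum]
  rw [Finset.sum_comm]
  have : ∀ n, ∑ k, omegaZ N (-(k * m)) * (omegaZ N (k * n) * u n) =
      (if n - m = 0 then (N : ℂ) else 0) * u n := by
    intro n
    rw [← sum_omegaZ_mul, Finset.sum_mul]
    refine Finset.sum_congr rfl fun k _ => ?_
    rw [← mul_assoc, ← omegaZ_add]
    congr 2
    ring
  simp only [this, sub_eq_zero, ite_mul, zero_mul]
  simp

lemma eq_zero_of_hat_eq_zero {u : ZMod N → ℂ} (h : ∀ k, hat u k = 0) (n : ZMod N) : u n = 0 := by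
  have := hat_inversion u n
  simp only [h, mul_zero, Finset.sum_const_zero] at this
  exact (mul_eq_zero.mp this.symm).resolve_left (Nat.cast_ne_zero.mpr (NeZero.ne N))

lemma hat_convolution (P Q : ZMod N → ℂ) (k : ZMod N) :
    ∑ b, omegaZ N (k * b) * ∑ c, P (b - c) * Q c = hat P k * hat Q k := by
  simp only [Finset.mul_sum]
  rw [Finset.sum_comm, hat, hat, mul_comm, Finset.sum_mul]
  refine Finset.sum_congr rfl fun c _ => ?_
  rw [← Equiv.sum_comp (Equiv.addRight c), Finset.mul_sum]
  refine Finset.sum_congr rfl fun n _ => ?_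
  rw [Equiv.coe_addRight, add_sub_cancel_right, mul_add, omegaZ_add]
  ring

variable {p q r : ℂ × ℂ} {u v u₁ v₁ u₂ v₂ u₃ v₃ : ZMod N → ℂ}

/-- Self-duality: the Fourier transform of `u` is proportional to `v`, because Fourier transformation
turns the recurrence of `u`, with coefficients linear in `ω ^ n`, into that of `v`. -/
lemma WeightPair.hat_eq (h : WeightPair N p q u v) (k : ZMod N) : hat u k = hat u 0 * v k := by
  have hg : (fun k => hat u k) = fun k => hat u 0 * v k := by
    refine eq_of_recurrence (α := fun n => p.2 - omegaZ N n * q.1)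
      (β := fun n => q.2 - omegaZ N n * p.1) h.v_den (fun k => ?_) (fun k => ?_) ?_
    · have key : ∑ n, omegaZ N ((k - 1) * n) * ((q.2 - omegaZ N n * p.2) * u n) =
          ∑ n, omegaZ N ((k - 1) * n) *
            ((omega N * p.1 - omegaZ N n * q.1) * u (n - 1)) := by
        refine Finset.sum_congr rfl fun n _ => ?_
        rw [h.u_rec]
      have a1 : ∑ n, omegaZ N ((k - 1) * n) * ((q.2 - omegaZ N n * p.2) * u n) =
          q.2 * hat u (k - 1) - p.2 * hat u k := by
        have := hat_mul_char u 1 (k - 1)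
        rw [sub_add_cancel] at this
        rw [← this, hat, Finset.mul_sum, Finset.mul_sum, ← Finset.sum_sub_distrib]
        refine Finset.sum_congr rfl fun n _ => ?_
        rw [one_mul]
        ring
      have a2 : ∑ n, omegaZ N ((k - 1) * n) *
            ((omega N * p.1 - omegaZ N n * q.1) * u (n - 1)) =
          omegaZ N k * (p.1 * hat u (k - 1) - q.1 * hat u k) := by
        have b1 := hat_shift u 1 (k - 1)
        have b2 := hat_shift u 1 k
        rw [mul_one] at b1 b2
        have b3 : omegaZ N k = omegaZ N (k - 1) * omega N := by
          rw [← omegaZ_one, ← omegaZ_add, sub_add_cancel]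
        have : omegaZ N k * (p.1 * hat u (k - 1) - q.1 * hat u k) =
          omega N * p.1 * (omegaZ N (k - 1) * hat u (k - 1)) - q.1 * (omegaZ N k * hat u k) := by
          rw [b3]
          ring
        rw [this, ← b1, ← b2, Finset.mul_sum, Finset.mul_sum, ← Finset.sum_sub_distrib]
        refine Finset.sum_congr rfl fun n _ => ?_
        have b4 : omegaZ N (k * n) = omegaZ N ((k - 1) * n) * omegaZ N n := by
          rw [← omegaZ_add]
          congr 1
          ring
        rw [b4]
        ring
      rw [a1, a2] at key
      linear_combination -key
    · linear_combination hat u 0 * h.v_rec k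
    · simp [h.v_zero]
  exact congrFun hg k

/-- A Gaussian `g(n) = z^{n²}` on `ℤ/N`, with `z ^ 2 = ω`. -/
lemma exists_gaussian (N : ℕ) [NeZero N] : ∃ g : ZMod N → ℂ, (∀ n, g n ≠ 0) ∧
    ∀ b c, omegaZ N (b * c) * g (b - c) = g b * g c := by
  -- the square root of `ω` whose `N ^ 2`-th power is one, whatever the parity of `N`
  set z : ℂ := Complex.exp (Real.pi * Complex.I * (N + 1) / N) with hz
  have hN : (N : ℂ) ≠ 0 := Nat.cast_ne_zero.mpr (NeZero.ne N)
  have hz0 : z ≠ 0 := Complex.exp_ne_zero _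
  have hz2 : z ^ 2 = omega N := by
    rw [hz, ← Complex.exp_nat_mul, omega]
    have : ((2 : ℕ) : ℂ) * (Real.pi * Complex.I * (N + 1) / N) =
        2 * Real.pi * Complex.I / N + 2 * Real.pi * Complex.I := by
      field_simp
      push_cast
      ring
    rw [this, Complex.exp_add, Complex.exp_two_pi_mul_I, mul_one]
  have hzN : z ^ (N ^ 2) = 1 := by
    rw [hz, ← Complex.exp_nat_mul]
    obtain ⟨m, hm⟩ := Nat.even_mul_succ_self N
    have hm' : (N : ℂ) * (N + 1) = m + m := by exact_mod_cast hm
    have : ((N ^ 2 : ℕ) : ℂ) * (Real.pi * Complex.I * (N + 1) / N) =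
        m * (2 * Real.pi * Complex.I) := by
      push_cast
      field_simp
      linear_combination hm'
    rw [this]
    exact_mod_cast Complex.exp_int_mul_two_pi_mul_I m
  have hper : ∀ k l : ℤ, (k : ZMod N) = l → z ^ (k ^ 2) = z ^ (l ^ 2) := by
    intro k l hkl
    obtain ⟨m, hm⟩ := (ZMod.intCast_eq_intCast_iff_dvd_sub k l N).mp hkl
    have hl : l ^ 2 = k ^ 2 + 2 * (N * (k * m)) + ((N ^ 2 : ℕ) : ℤ) * m ^ 2 := by
      have : l = k + N * m := by linarith
      rw [this]
      push_cast
      ring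
    have h1 : z ^ (2 * ((N : ℤ) * (k * m))) = 1 := by
      rw [_root_.zpow_mul, show (2 : ℤ) = ((2 : ℕ) : ℤ) by rfl, zpow_natCast, hz2, _root_.zpow_mul, zpow_natCast,
        omega_pow, _root_.one_zpow]
    have h2 : z ^ (((N ^ 2 : ℕ) : ℤ) * m ^ 2) = 1 := by
      rw [_root_.zpow_mul, zpow_natCast, hzN, _root_.one_zpow]
    rw [hl, zpow_add₀ hz0, zpow_add₀ hz0, h1, h2, mul_one, mul_one]
  refine ⟨fun n => z ^ ((n.val : ℤ) ^ 2), fun n => zpow_ne_zero _ hz0, fun b c => ?_⟩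
  have h1 : omegaZ N (b * c) = z ^ (2 * ((b.val : ℤ) * c.val)) := by
    have : b * c = ((b.val * c.val : ℕ) : ZMod N) := by simp
    rw [this, omegaZ_natCast, ← hz2, ← pow_mul, ← zpow_natCast]
    push_cast
    rfl
  have h2 : z ^ (((b - c).val : ℤ) ^ 2) = z ^ (((b.val : ℤ) - c.val) ^ 2) := by
    apply hper
    simp
  simp only
  rw [h1, h2, ← zpow_add₀ hz0, ← zpow_add₀ hz0]
  congr 1
  ring

/-- A non-zero solution of a three-term recurrence has no two consecutive zeros. -/
lemma no_consecutive_zeros {P α β γ : ZMod N → ℂ} (hP : ∃ n, P n ≠ 0)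
    (h : ∀ j, γ j * P j = α j * P (j + 1) + β j * P (j - 1))
    (hc : (∀ j, α j ≠ 0) ∨ ∀ j, β j ≠ 0) (j : ZMod N) (hj : P j = 0) : P (j + 1) ≠ 0 := by
  intro hj1
  obtain ⟨n, hn⟩ := hP
  apply hn
  rcases hc with hc | hc
  · refine (zmod_cyclic_induction (P := fun n => P n = 0 ∧ P (n + 1) = 0) j ⟨hj, hj1⟩
      (fun m hm => ⟨hm.2, ?_⟩) n).1
    have := h (m + 1)
    rw [hm.2, add_sub_cancel_right, hm.1, mul_zero, mul_zero, add_zero, eq_comm] at this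
    exact (mul_eq_zero.mp this).resolve_left (hc _)
  · have key := zmod_cyclic_induction (P := fun n => P (-n) = 0 ∧ P (-n + 1) = 0) (-j)
      ⟨by rwa [neg_neg], by rwa [neg_neg]⟩ (fun m hm => ?_) (-n)
    · rw [neg_neg] at key
      exact key.1
    · have e1 : -(m + 1) + 1 = -m := by ring
      have e2 : -(m + 1) = -m - 1 := by ring
      rw [e1]
      refine ⟨?_, hm.1⟩
      have := h (-m)
      rw [hm.1, hm.2, mul_zero, mul_zero, zero_add, eq_comm] at this
      rw [e2]
      exact (mul_eq_zero.mp this).resolve_left (hc _)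

/-- Two non-zero solutions of three-term recurrences with the same zeros of the middle coefficients
cannot have disjoint supports: these would alternate, forcing two consecutive middle coefficients
to vanish. -/
lemma exists_common_support {P Q α β γ α' β' : ZMod N → ℂ} (hP : ∃ n, P n ≠ 0)
    (hQ : ∃ n, Q n ≠ 0) (h : ∀ j, γ j * P j = α j * P (j + 1) + β j * P (j - 1))
    (h' : ∀ j, γ j * Q j = α' j * Q (j + 1) + β' j * Q (j - 1))
    (hc : (∀ j, α j ≠ 0) ∨ ∀ j, β j ≠ 0) (hc' : (∀ j, α' j ≠ 0) ∨ ∀ j, β' j ≠ 0)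
    (hγ : ∀ j, γ j = 0 → γ (j + 1) ≠ 0) : ∃ k, P k * Q k ≠ 0 := by
  by_contra! hPQ
  have nP := no_consecutive_zeros hP h hc
  have nQ := no_consecutive_zeros hQ h' hc'
  have sP : ∀ j, P j ≠ 0 → Q j = 0 := fun j hj => (mul_eq_zero.mp (hPQ j)).resolve_left hj
  have sQ : ∀ j, Q j ≠ 0 → P j = 0 := fun j hj => (mul_eq_zero.mp (hPQ j)).resolve_right hj
  obtain ⟨n, hn⟩ := hQ
  -- once a value of `P` vanishes, the supports alternate
  have alt : ∀ j, P j = 0 → Q (j + 1) = 0 ∧ Q j ≠ 0 ∧ Q (j - 1) = 0 := by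
    intro j hj
    have h1 := sP _ (nP j hj)
    have h2 : P (j - 1) ≠ 0 := fun h0 => by
      have := nP _ h0
      rw [sub_add_cancel] at this
      exact this hj
    refine ⟨h1, fun h0 => nQ j h0 h1, sP _ h2⟩
  have hj := sQ n hn
  obtain ⟨a1, a2, a3⟩ := alt n hj
  have g0 : γ n = 0 := by
    have := h' n
    rw [a1, a3, mul_zero, mul_zero, add_zero] at this
    exact (mul_eq_zero.mp this).resolve_right a2
  apply hγ n g0
  have hP1 := nP n hj
  have hP2 : P (n + 1 + 1) = 0 := sQ _ (nQ _ a1)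
  have := h (n + 1)
  rw [hP2, add_sub_cancel_right, hj, mul_zero, mul_zero, add_zero] at this
  exact (mul_eq_zero.mp this).resolve_right hP1

/-- The sum on the diagonal of the symmetric form attached to the star-triangle relation does not
vanish identically. -/
lemma exists_diagonal_sum_ne_zero (hN : 2 ≤ N) (h₂ : WeightPair N p r u₂ v₂)
    (h₃ : WeightPair N q r u₃ v₃) (hp : p ≠ 0) (hq : q ≠ 0) (hr : r ≠ 0) :
    ∃ b, ∑ c, u₂ (b - c) * v₃ (-c) * omegaZ N (c * b) ≠ 0 := by
  by_contra! hcon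
  obtain ⟨g, hg0, hg⟩ := exists_gaussian N
  set P : ZMod N → ℂ := fun n => u₂ n / g n with hPdef
  set Q : ZMod N → ℂ := fun n => v₃ (-n) * g n with hQdef
  -- completing the square turns the sums into a convolution
  have hconv : ∀ b, ∑ c, P (b - c) * Q c = 0 := by
    intro b
    apply mul_left_cancel₀ (hg0 b)
    rw [mul_zero, ← hcon b, Finset.mul_sum]
    refine Finset.sum_congr rfl fun c _ => ?_
    have h1 := hg b c
    have h2 := hg0 (b - c)
    simp only [hPdef, hQdef]
    rw [mul_comm c b]
    field_simp
    linear_combination -(u₂ (b - c) * v₃ (-c)) * h1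
  have hPQ : ∀ k, hat P k * hat Q k = 0 := by
    intro k
    rw [← hat_convolution]
    simp [hconv]
  have g00 : g 0 = 1 := by
    have := hg 0 0
    simp only [mul_zero, omegaZ_zero, sub_zero, one_mul] at this
    exact (mul_eq_left₀ (hg0 0)).mp this.symm
  set z := g 1 with hz
  have hzz : z * z = omega N := by
    have := hg 1 1
    rw [mul_one, omegaZ_one, sub_self, g00, mul_one] at this
    exact this.symm
  have hz0 : z ≠ 0 := hg0 1
  have gpred : ∀ n, omegaZ N n * g (n - 1) = g n * z := by
    intro n
    have := hg n 1
    rwa [mul_one] at this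
  have recP : ∀ n, (r.2 - omegaZ N n * p.2) * P n =
      z * (omega N * p.1 * omegaZ N (-n) - r.1) * P (n - 1) := by
    intro n
    have h1 := h₂.u_rec n
    have h2 := gpred n
    have e := omegaZ_ne_zero n
    have a1 := hg0 n
    have a2 := hg0 (n - 1)
    simp only [hPdef]
    rw [omegaZ_neg]
    field_simp
    linear_combination omegaZ N n * g (n - 1) * h1 +
      (omega N * p.1 - omegaZ N n * r.1) * u₂ (n - 1) * h2
  have recQ : ∀ n, z * (omegaZ N n * q.2 - r.1) * Q n =
      (r.2 - omegaZ N (-n) * q.1) * Q (n + 1) := by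
    intro n
    have h1 := h₃.v_rec (-n)
    have h2 := gpred (n + 1)
    rw [add_sub_cancel_right, omegaZ_add, omegaZ_one, ← hzz] at h2
    have h3 : g (n + 1) = omegaZ N n * z * g n := by
      apply mul_right_cancel₀ hz0
      linear_combination -h2
    have e := omegaZ_ne_zero n
    simp only [hQdef, h3]
    rw [omegaZ_neg] at h1 ⊢
    rw [show -(n + 1) = -n - 1 by ring]
    field_simp
    field_simp at h1
    linear_combination g n * h1
  -- after Fourier transformation both become three-term recurrences with the same middle coefficient
  have recP' : ∀ j, (r.2 + z * omegaZ N j * r.1) * hat P j =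
      p.2 * hat P (j + 1) + z * omegaZ N j * p.1 * hat P (j - 1) := by
    intro j
    have key : ∑ n, omegaZ N (j * n) * ((r.2 - omegaZ N n * p.2) * P n) =
        ∑ n, omegaZ N (j * n) * (z * (omega N * p.1 * omegaZ N (-n) - r.1) * P (n - 1)) := by
      refine Finset.sum_congr rfl fun n _ => ?_
      rw [recP]
    have a1 : ∑ n, omegaZ N (j * n) * ((r.2 - omegaZ N n * p.2) * P n) =
        r.2 * hat P j - p.2 * hat P (j + 1) := by
      rw [← hat_mul_char P 1 j, hat, Finset.mul_sum, Finset.mul_sum, ← Finset.sum_sub_distrib]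
      refine Finset.sum_congr rfl fun n _ => ?_
      rw [one_mul]
      ring
    have a2 : ∑ n, omegaZ N (j * n) * (z * (omega N * p.1 * omegaZ N (-n) - r.1) * P (n - 1)) =
        z * omegaZ N j * (p.1 * hat P (j - 1) - r.1 * hat P j) := by
      have b1 := hat_shift P 1 (j - 1)
      have b2 := hat_shift P 1 j
      rw [mul_one] at b1 b2
      have b3 : omegaZ N j = omegaZ N (j - 1) * omega N := by
        rw [← omegaZ_one, ← omegaZ_add, sub_add_cancel]
      have : z * omegaZ N j * (p.1 * hat P (j - 1) - r.1 * hat P j) =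
          z * omega N * p.1 * (omegaZ N (j - 1) * hat P (j - 1)) -
            z * r.1 * (omegaZ N j * hat P j) := by
        rw [b3]
        ring
      rw [this, ← b1, ← b2, Finset.mul_sum, Finset.mul_sum, ← Finset.sum_sub_distrib]
      refine Finset.sum_congr rfl fun n _ => ?_
      have b4 : omegaZ N ((j - 1) * n) = omegaZ N (j * n) * omegaZ N (-n) := by
        rw [← omegaZ_add]
        congr 1
        ring
      rw [b4]
      ring
    rw [a1, a2] at key
    linear_combination key
  have recQ' : ∀ j, (r.2 + z * omegaZ N j * r.1) * hat Q j =
      z * omegaZ N j * q.2 * hat Q (j + 1) + omega N * q.1 * hat Q (j - 1) := by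
    intro j
    have key : ∑ n, omegaZ N (j * n) * (z * (omegaZ N n * q.2 - r.1) * Q n) =
        ∑ n, omegaZ N (j * n) * ((r.2 - omegaZ N (-n) * q.1) * Q (n + 1)) := by
      refine Finset.sum_congr rfl fun n _ => ?_
      rw [recQ]
    have a1 : ∑ n, omegaZ N (j * n) * (z * (omegaZ N n * q.2 - r.1) * Q n) =
        z * q.2 * hat Q (j + 1) - z * r.1 * hat Q j := by
      rw [← hat_mul_char Q 1 j, hat, Finset.mul_sum, Finset.mul_sum, ← Finset.sum_sub_distrib]
      refine Finset.sum_congr rfl fun n _ => ?_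
      rw [one_mul]
      ring
    have e := omegaZ_ne_zero j
    have a2 : ∑ n, omegaZ N (j * n) * ((r.2 - omegaZ N (-n) * q.1) * Q (n + 1)) =
        (omegaZ N j)⁻¹ * (r.2 * hat Q j - omega N * q.1 * hat Q (j - 1)) := by
      have b1 := hat_shift Q (-1) (j - 1)
      have b2 := hat_shift Q (-1) j
      simp only [sub_neg_eq_add, mul_neg, mul_one, omegaZ_neg] at b1 b2
      rw [omegaZ_sub, omegaZ_one, inv_div] at b1
      have : (omegaZ N j)⁻¹ * (r.2 * hat Q j - omega N * q.1 * hat Q (j - 1)) =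
          r.2 * ((omegaZ N j)⁻¹ * hat Q j) - q.1 * (omega N / omegaZ N j * hat Q (j - 1)) := by
        ring
      rw [this, ← b1, ← b2, Finset.mul_sum, Finset.mul_sum, ← Finset.sum_sub_distrib]
      refine Finset.sum_congr rfl fun n _ => ?_
      have b4 : omegaZ N ((j - 1) * n) = omegaZ N (j * n) * omegaZ N (-n) := by
        rw [← omegaZ_add]
        congr 1
        ring
      rw [b4]
      ring
    rw [a1, a2] at key
    field_simp at key
    linear_combination -key
  have comp : ∀ w : ℂ × ℂ, w ≠ 0 → w.1 ≠ 0 ∨ w.2 ≠ 0 := by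
    intro w hw
    by_contra! h0
    exact hw (Prod.ext h0.1 h0.2)
  have hw := omega_ne_zero (N := N)
  obtain ⟨k, hk⟩ := exists_common_support (P := hat P) (Q := hat Q)
    (α := fun _ => p.2) (β := fun j => z * omegaZ N j * p.1)
    (γ := fun j => r.2 + z * omegaZ N j * r.1)
    (α' := fun j => z * omegaZ N j * q.2) (β' := fun _ => omega N * q.1)
    (by
      by_contra! h0
      have := eq_zero_of_hat_eq_zero h0 0
      simp [hPdef, h₂.u_zero, g00] at this)
    (by
      by_contra! h0
      have := eq_zero_of_hat_eq_zero h0 0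
      simp [hQdef, h₃.v_zero, g00] at this)
    recP' recQ'
    ((comp p hp).symm.imp (fun h _ => h)
      fun h j => mul_ne_zero (mul_ne_zero hz0 (omegaZ_ne_zero j)) h)
    ((comp q hq).symm.imp
      (fun h j => mul_ne_zero (mul_ne_zero hz0 (omegaZ_ne_zero j)) h)
      fun h _ => mul_ne_zero hw h)
    (by
      intro j h0 h1
      rw [omegaZ_add, omegaZ_one] at h1
      have hw1 : omega N - 1 ≠ 0 :=
        sub_ne_zero.mpr (isPrimitiveRoot_omega.ne_one (by omega))
      have h2 : z * omegaZ N j * (omega N - 1) * r.1 = 0 := by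
        linear_combination h1 - h0
      have h3 : r.1 = 0 := (mul_eq_zero.mp h2).resolve_left
        (mul_ne_zero (mul_ne_zero hz0 (omegaZ_ne_zero j)) hw1)
      rw [h3, mul_zero, add_zero] at h0
      exact hr (Prod.ext h3 h0))
  exact hk (hPQ k)

/-- Self-duality exchanges the two sides of the star-triangle relation; this determines the square
of its constant, and a non-vanishing diagonal entry determines the constant itself. -/
theorem starTriangle_const (hN : 2 ≤ N) (h₁ : WeightPair N p q u₁ v₁)
    (h₂ : WeightPair N p r u₂ v₂) (h₃ : WeightPair N q r u₃ v₃) (hp : p ≠ 0) (hq : q ≠ 0)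
    (hr : r ≠ 0) : starSum u₁ u₃ v₂ 0 0 0 * hat u₂ 0 = hat u₁ 0 * hat u₃ 0 := by
  set R := starSum u₁ u₃ v₂ 0 0 0 with hR
  set G : ZMod N → ZMod N → ℂ := fun b k =>
    v₁ (-b) * ∑ c, u₂ (b - c) * v₃ (-c) * omegaZ N (-(c * k)) with hG
  have hsym : ∀ b k, R * hat u₂ 0 * G b k = hat u₁ 0 * hat u₃ 0 * G (-k) (-b) := by
    intro b k
    have e1 : R * G b k = ∑ c, starSum u₁ u₃ v₂ 0 b c * omegaZ N (-(c * k)) := by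
      simp only [hG, starTriangle h₁ h₂ h₃ 0 b, Finset.mul_sum]
      refine Finset.sum_congr rfl fun c _ => ?_
      rw [zero_sub, zero_sub]
      ring
    have e2 : ∑ c, starSum u₁ u₃ v₂ 0 b c * omegaZ N (-(c * k)) =
        (∑ d, u₃ (b - d) * v₂ (-d) * omegaZ N (-(d * k))) * hat u₁ k := by
      simp only [starSum, Finset.sum_mul]
      rw [Finset.sum_comm]
      refine Finset.sum_congr rfl fun d _ => ?_
      rw [hat, Finset.mul_sum, ← Equiv.sum_comp (Equiv.subLeft d)]
      refine Finset.sum_congr rfl fun n _ => ?_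
      simp only [Equiv.subLeft_apply, sub_sub_cancel, zero_sub]
      have : omegaZ N (-((d - n) * k)) = omegaZ N (-(d * k)) * omegaZ N (k * n) := by
        rw [← omegaZ_add]
        congr 1
        ring
      rw [this]
      ring
    have e3 : hat u₂ 0 * ∑ d, u₃ (b - d) * v₂ (-d) * omegaZ N (-(d * k)) =
        hat u₃ 0 * ∑ c, u₂ (-k - c) * v₃ (-c) * omegaZ N (-(c * -b)) := by
      have s1 : hat u₂ 0 * ∑ d, u₃ (b - d) * v₂ (-d) * omegaZ N (-(d * k)) =
          ∑ d, ∑ n, u₃ (b - d) * u₂ n * omegaZ N (-(d * (n + k))) := by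
        rw [Finset.mul_sum]
        refine Finset.sum_congr rfl fun d _ => ?_
        have : hat u₂ 0 * (u₃ (b - d) * v₂ (-d) * omegaZ N (-(d * k))) =
            u₃ (b - d) * omegaZ N (-(d * k)) * hat u₂ (-d) := by
          rw [h₂.hat_eq (-d)]
          ring
        rw [this, hat, Finset.mul_sum]
        refine Finset.sum_congr rfl fun n _ => ?_
        have : omegaZ N (-(d * (n + k))) = omegaZ N (-(d * k)) * omegaZ N (-d * n) := by
          rw [← omegaZ_add]
          congr 1
          ring
        rw [this]
        ring
      rw [s1, Finset.sum_comm, Finset.mul_sum, ← Equiv.sum_comp (Equiv.subLeft (-k))]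
      refine Finset.sum_congr rfl fun c _ => ?_
      simp only [Equiv.subLeft_apply]
      have : hat u₃ 0 * (u₂ (-k - c) * v₃ (-c) * omegaZ N (-(c * -b))) =
          u₂ (-k - c) * omegaZ N (-(c * -b)) * hat u₃ (-c) := by
        rw [h₃.hat_eq (-c)]
        ring
      rw [this, hat, Finset.mul_sum, ← Equiv.sum_comp (Equiv.subLeft b)]
      refine Finset.sum_congr rfl fun n _ => ?_
      simp only [Equiv.subLeft_apply, sub_sub_cancel]
      have : omegaZ N (-((b - n) * (-k - c + k))) =
          omegaZ N (-(c * -b)) * omegaZ N (-c * n) := by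
        rw [← omegaZ_add]
        congr 1
        ring
      rw [this]
      ring
    have e4 : R * hat u₂ 0 * G b k = hat u₂ 0 * (R * G b k) := by ring
    rw [e4, e1, e2, ← mul_assoc, e3, h₁.hat_eq k]
    simp only [hG, neg_neg]
    ring
  obtain ⟨b, hb⟩ := exists_diagonal_sum_ne_zero hN h₂ h₃ hp hq hr
  have hGb : G b (-b) ≠ 0 := by
    simp only [hG]
    refine mul_ne_zero (h₁.v_ne_zero _) ?_
    simpa only [mul_neg, neg_neg] using hb
  have := hsym b (-b)
  rw [neg_neg] at this
  exact mul_right_cancel₀ hGb this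

end Fourier

/-! ### Circulant determinants and the constants of the commutation relations -/

section Circulant

variable {N : ℕ} [NeZero N]

/-- The Fourier matrix diagonalises circulant matrices. -/
lemma det_circulant_eq_prod_hat (u : ZMod N → ℂ) :
    Matrix.det (Matrix.of fun i j : ZMod N => u (i - j)) = ∏ k, hat u k := by
  set F : Matrix (ZMod N) (ZMod N) ℂ := Matrix.of fun j k => omegaZ N (-(j * k)) with hF
  set F' : Matrix (ZMod N) (ZMod N) ℂ := Matrix.of fun j k => omegaZ N (j * k) with hF'
  have hN : (N : ℂ) ≠ 0 := Nat.cast_ne_zero.mpr (NeZero.ne N)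
  have h1 : F * F' = (N : ℂ) • (1 : Matrix (ZMod N) (ZMod N) ℂ) := by
    ext i j
    rw [Matrix.mul_apply, Matrix.smul_apply, Matrix.one_apply]
    have : ∀ k, F i k * F' k j = omegaZ N ((j - i) * k) := by
      intro k
      rw [hF, hF', Matrix.of_apply, Matrix.of_apply, ← omegaZ_add]
      congr 1
      ring
    simp only [this, sum_omegaZ_mul, sub_eq_zero, smul_eq_mul, mul_ite, mul_one, mul_zero, eq_comm]
  have h2 : F.det ≠ 0 := by
    intro h0
    have := congrArg Matrix.det h1
    rw [Matrix.det_mul, h0, zero_mul, Matrix.det_smul, Matrix.det_one, mul_one, eq_comm] at this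
    exact pow_ne_zero _ hN this
  have h3 : Matrix.of (fun i j : ZMod N => u (i - j)) * F = F * Matrix.diagonal (hat u) := by
    ext i k
    rw [Matrix.mul_diagonal, Matrix.mul_apply, hat, Finset.mul_sum,
      ← Equiv.sum_comp (Equiv.subLeft i)]
    refine Finset.sum_congr rfl fun n _ => ?_
    rw [hF, Matrix.of_apply, Matrix.of_apply, Matrix.of_apply, Equiv.subLeft_apply, sub_sub_cancel]
    have : omegaZ N (-((i - n) * k)) = omegaZ N (-(i * k)) * omegaZ N (k * n) := by
      rw [← omegaZ_add]
      congr 1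
      ring
    rw [this]
    ring
  have h4 := congrArg Matrix.det h3
  rw [Matrix.det_mul, Matrix.det_mul, Matrix.det_diagonal, mul_comm] at h4
  exact mul_left_cancel₀ h2 h4

/-- `W̄_{p,q}(n)` multiplied by the power `(z_p z_q)^{-n}`. -/
noncomputable def phasedWbar (N : ℕ) [NeZero N] (z : Rapidity → ℂ) (p q : Rapidity)
    (n : ZMod N) : ℂ :=
  (z p * z q)⁻¹ ^ n.val * Wbar N p q n

/-- `W_{p,q}(n)` multiplied by the power `(z_q / z_p)^n`. -/
noncomputable def phasedW (N : ℕ) [NeZero N] (z : Rapidity → ℂ) (p q : Rapidity)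
    (n : ZMod N) : ℂ :=
  (z q / z p) ^ n.val * W N p q n

/-- The proportionality factor between the Fourier transform of `phasedWbar` and `phasedW`, where
`φ` identifies the dual of `ℤ/N` with `ℤ/N`. -/
noncomputable def dualConst (N : ℕ) [NeZero N] (z : Rapidity → ℂ) (φ : Equiv.Perm (ZMod N))
    (p q : Rapidity) : ℂ :=
  hat (phasedWbar N z p q) (φ 0)

/-- The weights `W` and `W̄` of the pair of rapidities are `N`-periodic and have no poles and zeros. -/
def RegPair (N : ℕ) (p q : Rapidity) : Prop := RegW N p q ∧ RegWbar N p q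

/-- The family `γ` tends to `q` in all coordinates as `ε → 0`, while `x ^ N` and `y ^ N` avoid any
given value. -/
structure Approaches (N : ℕ) (z : Rapidity → ℂ) (γ : ℂ → Rapidity) (q : Rapidity) : Prop where
  x : Filter.Tendsto (fun ε => (γ ε).x) (nhdsWithin 0 {0}ᶜ) (nhds q.x)
  y : Filter.Tendsto (fun ε => (γ ε).y) (nhdsWithin 0 {0}ᶜ) (nhds q.y)
  μ : Filter.Tendsto (fun ε => (γ ε).μ) (nhdsWithin 0 {0}ᶜ) (nhds q.μ)
  z : Filter.Tendsto (fun ε => z (γ ε)) (nhdsWithin 0 {0}ᶜ) (nhds (z q))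
  avoid : ∀ B : ℂ, ∀ᶠ ε in nhdsWithin 0 {0}ᶜ, (γ ε).x ^ N ≠ B ∧ (γ ε).y ^ N ≠ B

/-- What makes the commutation relations hold over a curve `S`: multiplied by powers of the phases
`z`, the weights are Fourier dual to each other, and they satisfy the star-triangle relation with a
constant expressed by the duality constants. The star-triangle relation is required for points with
`y ≠ 0` only, and every point of `S` is a limit of such points. -/
structure StarGauge (N : ℕ) [NeZero N] (S : Set Rapidity) (z : Rapidity → ℂ)
    (φ : Equiv.Perm (ZMod N)) : Prop where
  z_ne_zero : ∀ p ∈ S, z p ≠ 0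
  z_pow : ∀ p ∈ S, ∀ q ∈ S, (z p * z q) ^ N = 1
  regW : ∀ p ∈ S, ∀ q ∈ S, q.x ^ N ≠ p.y ^ N → RegW N p q
  regWbar : ∀ p ∈ S, ∀ q ∈ S, q.y ^ N ≠ p.y ^ N → RegWbar N p q
  dual : ∀ p ∈ S, ∀ q ∈ S, RegPair N p q → ∀ k,
    hat (phasedWbar N z p q) (φ k) = dualConst N z φ p q * phasedW N z p q k
  star : ∀ p ∈ S, ∀ q ∈ S, ∀ r ∈ S, p.y ≠ 0 → q.y ^ N ≠ 0 → r.y ^ N ≠ 0 → RegPair N p q →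
    RegPair N p r → RegPair N q r → ∀ a b c,
      dualConst N z φ p r *
          starSum (phasedWbar N z p q) (phasedWbar N z q r) (phasedW N z p r) a b c =
        dualConst N z φ p q * dualConst N z φ q r *
          (phasedW N z p q (a - b) * phasedWbar N z p r (b - c) * phasedW N z q r (a - c))
  approach : ∀ q ∈ S, ∃ γ : ℂ → Rapidity,
    (∀ᶠ ε in nhdsWithin 0 {0}ᶜ, γ ε ∈ S) ∧ Approaches N z γ q

variable {S : Set Rapidity} {z : Rapidity → ℂ} {φ : Equiv.Perm (ZMod N)} {p q r : Rapidity}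

lemma StarGauge.div_pow (h : StarGauge N S z φ) (hp : p ∈ S) (hq : q ∈ S) :
    (z q / z p) ^ N = 1 := by
  have h1 := h.z_pow p hp q hq
  have h2 := h.z_pow p hp p hp
  have h3 := pow_ne_zero N (h.z_ne_zero p hp)
  rw [mul_pow] at h1 h2
  rw [_root_.div_pow, div_eq_one_iff_eq h3]
  apply mul_left_cancel₀ h3
  rw [h1, h2]

lemma StarGauge.dualConst_ne_zero (h : StarGauge N S z φ) (hp : p ∈ S) (hq : q ∈ S)
    (hpq : RegPair N p q) : dualConst N z φ p q ≠ 0 := by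
  intro h0
  have h1 : ∀ k, hat (phasedWbar N z p q) k = 0 := by
    intro k
    have := h.dual p hp q hq hpq (φ.symm k)
    rwa [h0, zero_mul, Equiv.apply_symm_apply] at this
  have h2 := eq_zero_of_hat_eq_zero h1 0
  simp [phasedWbar] at h2

/-- The quotient of the circulant determinant by the product of the weights is the `N`-th power of
the duality constant, up to a factor which separates `p` and `q`. -/
lemma StarGauge.fPow_eq (h : StarGauge N S z φ) (hp : p ∈ S) (hq : q ∈ S)
    (hpq : RegPair N p q) :
    fPow N p q = dualConst N z φ p q ^ N * (z q / z p) ^ (∑ k : ZMod N, k.val) := by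
  have hz : (z p * z q)⁻¹ ^ N = 1 := by rw [inv_pow, h.z_pow p hp q hq, inv_one]
  -- the phase is a character, so that it shifts the argument of the Fourier transform
  obtain ⟨j, hj⟩ := exists_omegaZ_eq hz
  have h1 : ∀ k, hat (phasedWbar N z p q) k = hat (Wbar N p q) (k + j) := by
    intro k
    rw [← hat_mul_char, hat]
    refine Finset.sum_congr rfl fun n _ => ?_
    rw [phasedWbar, ← hj]
    congr 2
    have : j * n = ((j.val * n.val : ℕ) : ZMod N) := by simp
    rw [this, omegaZ_natCast, omegaZ, pow_mul]
  have h2 : ∏ k, hat (Wbar N p q) k = ∏ k, hat (Wbar N p q) (φ k + j) :=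
    (Equiv.prod_comp (φ.trans (Equiv.addRight j)) fun k => hat (Wbar N p q) k).symm
  have h3 : ∏ n, W N p q n ≠ 0 := Finset.prod_ne_zero_iff.mpr fun n _ => hpq.1.W_ne_zero n
  rw [fPow, det_circulant_eq_prod_hat, h2, div_eq_iff h3, ← Finset.prod_pow_eq_pow_sum]
  simp only [← h1, h.dual p hp q hq hpq, phasedW, Finset.prod_mul_distrib, Finset.prod_const,
    Finset.card_univ, ZMod.card]
  ring

/-- The star-triangle relation for the weights themselves: the powers of `z` cancel. -/
lemma StarGauge.star_weights (h : StarGauge N S z φ) (hp : p ∈ S) (hq : q ∈ S) (hr : r ∈ S)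
    (hy : p.y ≠ 0) (hqy : q.y ^ N ≠ 0) (hry : r.y ^ N ≠ 0) (hpq : RegPair N p q)
    (hpr : RegPair N p r) (hqr : RegPair N q r) (a b c : ZMod N) :
    dualConst N z φ p r * ∑ d, Wbar N q r (b - d) * W N p r (a - d) * Wbar N p q (d - c) =
      dualConst N z φ p q * dualConst N z φ q r *
        (W N p q (a - b) * Wbar N p r (b - c) * W N q r (a - c)) := by
  have key := h.star p hp q hq r hr hy hqy hry hpq hpr hqr a b c
  have z1 := h.z_ne_zero p hp
  have z2 := h.z_ne_zero q hq
  have z3 := h.z_ne_zero r hr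
  have i1 : (z p * z q)⁻¹ ^ N = 1 := by rw [inv_pow, h.z_pow p hp q hq, inv_one]
  have i2 : (z p * z r)⁻¹ ^ N = 1 := by rw [inv_pow, h.z_pow p hp r hr, inv_one]
  have i3 : (z q * z r)⁻¹ ^ N = 1 := by rw [inv_pow, h.z_pow q hq r hr, inv_one]
  have e1 := h.div_pow hp hq
  have e2 := h.div_pow hp hr
  have e3 := h.div_pow hq hr
  set C : ℂ := z r ^ a.val / z p ^ a.val * (z q * z r)⁻¹ ^ b.val * (z p * z q) ^ c.val with hC
  have hC0 : C ≠ 0 := by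
    rw [hC]
    positivity
  have s1 : starSum (phasedWbar N z p q) (phasedWbar N z q r) (phasedW N z p r) a b c =
      C * ∑ d, Wbar N q r (b - d) * W N p r (a - d) * Wbar N p q (d - c) := by
    rw [starSum, Finset.mul_sum]
    refine Finset.sum_congr rfl fun d _ => ?_
    simp only [phasedWbar, phasedW, pow_val_sub i1, pow_val_sub i3, pow_val_sub e2, hC]
    simp only [mul_pow, inv_pow, _root_.div_pow]
    field_simp
  have s2 : phasedW N z p q (a - b) * phasedWbar N z p r (b - c) * phasedW N z q r (a - c) =
      C * (W N p q (a - b) * Wbar N p r (b - c) * W N q r (a - c)) := by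
    simp only [phasedWbar, phasedW, pow_val_sub e1, pow_val_sub i2, pow_val_sub e3, hC]
    simp only [mul_pow, inv_pow, _root_.div_pow]
    field_simp
  rw [s1, s2] at key
  apply mul_left_cancel₀ hC0
  linear_combination key

end Circulant

/-! ### Commutation relations of the transfer matrices -/

section Exchange

open Filter Topology

variable {N : ℕ} [NeZero N] {S : Set Rapidity} {z : Rapidity → ℂ} {φ : Equiv.Perm (ZMod N)}
  {p p' q r : Rapidity}

/-- The local factor of `T_{p,p'}(q) T̂_{p,p'}(r)`, obtained by summing over one intermediate
spin. -/
noncomputable def exchangeSum (N : ℕ) [NeZero N] (p p' q r : Rapidity) (a b c d : ZMod N) : ℂ :=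
  ∑ n, W N p q (a - n) * Wbar N p' q (b - n) * (Wbar N p r (n - c) * W N p' r (n - d))

lemma transferT_mul_transferThat (L : ℕ) [NeZero L] (j k : Fin L → ZMod N) :
    (transferT N L p p' q * transferThat N L p p' r) j k =
      ∏ l, exchangeSum N p p' q r (j l) (j (l + 1)) (k l) (k (l + 1)) := by
  simp only [exchangeSum]
  rw [prod_sum_eq, Matrix.mul_apply]
  refine Finset.sum_congr rfl fun n _ => ?_
  simp only [transferT, transferThat, Matrix.of_apply]
  rw [← Finset.prod_mul_distrib]

/-- In the product `T̂_{p,p'}(q) T_{p,p'}(r)` the same local factor occurs, with `p` and `p'`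
exchanged. -/
lemma transferThat_mul_transferT (L : ℕ) [NeZero L] (j k : Fin L → ZMod N) :
    (transferThat N L p p' q * transferT N L p p' r) j k =
      ∏ l, exchangeSum N p' p q r (j l) (j (l + 1)) (k l) (k (l + 1)) := by
  simp only [exchangeSum]
  rw [prod_sum_eq, Matrix.mul_apply,
    ← Equiv.sum_comp ((Equiv.addRight (1 : Fin L)).arrowCongr (Equiv.refl (ZMod N)))]
  refine Finset.sum_congr rfl fun n _ => ?_
  have hn : ∀ l, ((Equiv.addRight (1 : Fin L)).arrowCongr (Equiv.refl (ZMod N))) n (l + 1) = n l := by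
    intro l
    simp [Equiv.arrowCongr]
  set m := ((Equiv.addRight (1 : Fin L)).arrowCongr (Equiv.refl (ZMod N))) n with hm
  simp only [transferT, transferThat, Matrix.of_apply, Finset.prod_mul_distrib]
  rw [← prod_shift fun l => Wbar N p q (j l - m l), ← prod_shift fun l => W N p r (m l - k l)]
  simp only [hn]
  ring

/-- Two applications of the star-triangle relation move `q` and `r` past each other. -/
lemma StarGauge.exchange (h : StarGauge N S z φ) (hp : p ∈ S) (hp' : p' ∈ S) (hq : q ∈ S)
    (hr : r ∈ S) (hy : p.y ≠ 0) (hy' : p'.y ≠ 0) (hqy : q.y ^ N ≠ 0) (hry : r.y ^ N ≠ 0)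
    (hpq : RegPair N p q) (hpr : RegPair N p r) (hpq' : RegPair N p' q) (hpr' : RegPair N p' r)
    (hqr : RegPair N q r) (a b c d : ZMod N) :
    dualConst N z φ p q * dualConst N z φ p' r *
        (exchangeSum N p p' q r a b c d * W N q r (a - c)) =
      dualConst N z φ p' q * dualConst N z φ p r *
        (exchangeSum N p p' r q a b c d * W N q r (b - d)) := by
  have hA := h.dualConst_ne_zero hq hr hqr
  set A := dualConst N z φ q r
  set Apq := dualConst N z φ p q
  set Apr := dualConst N z φ p r
  set Apq' := dualConst N z φ p' q
  set Apr' := dualConst N z φ p' r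
  have e1 : Apq * A * (exchangeSum N p p' q r a b c d * W N q r (a - c)) =
      Apr * ∑ m, W N p r (a - m) * Wbar N p q (m - c) *
        ∑ n, Wbar N q r (n - m) * Wbar N p' q (b - n) * W N p' r (n - d) := by
    have : ∀ n, Apq * A * (W N p q (a - n) * Wbar N p' q (b - n) *
          (Wbar N p r (n - c) * W N p' r (n - d)) * W N q r (a - c)) =
        Wbar N p' q (b - n) * W N p' r (n - d) * (Apr *
          ∑ m, Wbar N q r (n - m) * W N p r (a - m) * Wbar N p q (m - c)) := by
      intro n
      rw [h.star_weights hp hq hr hy hqy hry hpq hpr hqr]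
      ring
    simp only [exchangeSum, Finset.sum_mul, Finset.mul_sum] at this ⊢
    simp only [this]
    rw [Finset.sum_comm]
    refine Finset.sum_congr rfl fun m _ => Finset.sum_congr rfl fun n _ => ?_
    ring
  -- the second relation is used with all spins reflected
  have e2 : ∀ m, Apr' * ∑ n, Wbar N q r (n - m) * Wbar N p' q (b - n) * W N p' r (n - d) =
      Apq' * A * (W N p' q (m - d) * Wbar N p' r (b - m) * W N q r (b - d)) := by
    intro m
    have := h.star_weights hp' hq hr hy' hqy hry hpq' hpr' hqr (-d) (-m) (-b)
    simp only [neg_sub_neg] at this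
    rw [← this, ← Equiv.sum_comp (Equiv.neg (ZMod N))]
    simp only [Equiv.neg_apply, sub_neg_eq_add]
    congr 1
    refine Finset.sum_congr rfl fun n _ => ?_
    rw [show -n - m = -m - n by ring, show -n - d = -d - n by ring, add_comm b n]
    ring
  apply mul_left_cancel₀ hA
  have e3 : A * (Apq * Apr' * (exchangeSum N p p' q r a b c d * W N q r (a - c))) =
      Apr' * (Apq * A * (exchangeSum N p p' q r a b c d * W N q r (a - c))) := by ring
  rw [e3, e1, exchangeSum, Finset.sum_mul, Finset.mul_sum, Finset.mul_sum, Finset.mul_sum,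
    Finset.mul_sum]
  refine Finset.sum_congr rfl fun m _ => ?_
  linear_combination Apr * W N p r (a - m) * Wbar N p q (m - c) * e2 m

/-- The relation between `T_{p,p'}(q) T̂_{p,p'}(r)` and `T_{p,p'}(r) T̂_{p,p'}(q)`, written in
a way which is continuous in `q` and `r`. -/
def ExchangeRel (N : ℕ) [NeZero N] (z : Rapidity → ℂ) (φ : Equiv.Perm (ZMod N)) (L : ℕ) [NeZero L]
    (p p' q r : Rapidity) : Prop :=
  ∀ j k : Fin L → ZMod N,
    (dualConst N z φ p q * dualConst N z φ p' r) ^ L *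
        ∏ l, exchangeSum N p p' q r (j l) (j (l + 1)) (k l) (k (l + 1)) =
      (dualConst N z φ p' q * dualConst N z φ p r) ^ L *
        ∏ l, exchangeSum N p p' r q (j l) (j (l + 1)) (k l) (k (l + 1))

lemma ExchangeRel.symm {L : ℕ} [NeZero L] (h : ExchangeRel N z φ L p p' q r) :
    ExchangeRel N z φ L p p' r q := by
  intro j k
  rw [mul_comm (dualConst N z φ p r), mul_comm (dualConst N z φ p' r)]
  exact (h j k).symm

lemma StarGauge.exchangeRel_of_regPair (h : StarGauge N S z φ) (hp : p ∈ S) (hp' : p' ∈ S)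
    (hq : q ∈ S) (hr : r ∈ S) (hy : p.y ≠ 0) (hy' : p'.y ≠ 0) (hqy : q.y ^ N ≠ 0)
    (hry : r.y ^ N ≠ 0) (hpq : RegPair N p q) (hpr : RegPair N p r) (hpq' : RegPair N p' q)
    (hpr' : RegPair N p' r) (hqr : RegPair N q r) (L : ℕ) [NeZero L] :
    ExchangeRel N z φ L p p' q r := by
  intro j k
  have key := Finset.prod_congr (rfl : (Finset.univ : Finset (Fin L)) = Finset.univ) fun l _ =>
    h.exchange hp hp' hq hr hy hy' hqy hry hpq hpr hpq' hpr' hqr (j l) (j (l + 1)) (k l) (k (l + 1))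
  simp only [Finset.prod_mul_distrib, Finset.prod_const, Finset.card_univ, Fintype.card_fin] at key
  rw [prod_shift fun l => W N q r (j l - k l)] at key
  have hne : ∏ l, W N q r (j l - k l) ≠ 0 :=
    Finset.prod_ne_zero_iff.mpr fun l _ => hqr.1.W_ne_zero _
  apply mul_right_cancel₀ hne
  simp only [mul_pow]
  linear_combination key

section Limit

variable {γ : ℂ → Rapidity}

lemma Approaches.tendsto_W (h : Approaches N z γ q) (hpq : RegW N p q) (n : ZMod N) :
    Tendsto (fun ε => W N p (γ ε) n) (𝓝[≠] 0) (𝓝 (W N p q n)) := by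
  unfold W weightW
  refine ((tendsto_const_nhds.div h.μ hpq.mu_right).pow _).mul (tendsto_finsetProd _ fun j _ => ?_)
  refine (h.y.sub tendsto_const_nhds).div (tendsto_const_nhds.sub (h.x.const_mul _)) ?_
  have := hpq.den_ne_zero ((j + 1 : ℕ) : ZMod N)
  rwa [omegaZ_natCast] at this

lemma Approaches.tendsto_Wbar (h : Approaches N z γ q) (hpq : RegWbar N p q) (n : ZMod N) :
    Tendsto (fun ε => Wbar N p (γ ε) n) (𝓝[≠] 0) (𝓝 (Wbar N p q n)) := by
  unfold Wbar weightWbar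
  refine ((h.μ.const_mul _).pow _).mul (tendsto_finsetProd _ fun j _ => ?_)
  refine (tendsto_const_nhds.sub (h.x.const_mul _)).div (h.y.sub tendsto_const_nhds) ?_
  have := hpq.den_ne_zero ((j + 1 : ℕ) : ZMod N)
  rwa [omegaZ_natCast] at this

lemma Approaches.tendsto_dualConst (h : Approaches N z γ q) (hpq : RegWbar N p q)
    (hz : z p * z q ≠ 0) :
    Tendsto (fun ε => dualConst N z φ p (γ ε)) (𝓝[≠] 0) (𝓝 (dualConst N z φ p q)) := by
  unfold dualConst hat phasedWbar
  refine tendsto_finsetSum _ fun n _ => ?_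
  exact ((((h.z.const_mul _).inv₀ hz).pow _).mul (h.tendsto_Wbar hpq n)).const_mul _

lemma Approaches.tendsto_exchangeSum_left (h : Approaches N z γ q) (hpq : RegW N p q)
    (hpq' : RegWbar N p' q) (a b c d : ZMod N) :
    Tendsto (fun ε => exchangeSum N p p' (γ ε) r a b c d) (𝓝[≠] 0)
      (𝓝 (exchangeSum N p p' q r a b c d)) := by
  unfold exchangeSum
  refine tendsto_finsetSum _ fun n _ => ?_
  exact ((h.tendsto_W hpq _).mul (h.tendsto_Wbar hpq' _)).mul_const _

lemma Approaches.tendsto_exchangeSum_right (h : Approaches N z γ q) (hpq : RegWbar N p q)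
    (hpq' : RegW N p' q) (a b c d : ZMod N) :
    Tendsto (fun ε => exchangeSum N p p' r (γ ε) a b c d) (𝓝[≠] 0)
      (𝓝 (exchangeSum N p p' r q a b c d)) := by
  unfold exchangeSum
  refine tendsto_finsetSum _ fun n _ => ?_
  exact ((h.tendsto_Wbar hpq _).mul (h.tendsto_W hpq' _)).const_mul _

lemma StarGauge.exchangeRel_of_approaches (h : StarGauge N S z φ) (hp : p ∈ S) (hp' : p' ∈ S)
    (hq : q ∈ S) (hγ : Approaches N z γ q) (hpq : RegPair N p q) (hpq' : RegPair N p' q) {L : ℕ}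
    [NeZero L] (hrel : ∀ᶠ ε in 𝓝[≠] (0 : ℂ), ExchangeRel N z φ L p p' (γ ε) r) :
    ExchangeRel N z φ L p p' q r := by
  intro j k
  have hz := mul_ne_zero (h.z_ne_zero p hp) (h.z_ne_zero q hq)
  have hz' := mul_ne_zero (h.z_ne_zero p' hp') (h.z_ne_zero q hq)
  refine tendsto_nhds_unique_of_eventuallyEq
    (f := fun ε => (dualConst N z φ p (γ ε) * dualConst N z φ p' r) ^ L *
        ∏ l, exchangeSum N p p' (γ ε) r (j l) (j (l + 1)) (k l) (k (l + 1)))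
    (g := fun ε => (dualConst N z φ p' (γ ε) * dualConst N z φ p r) ^ L *
        ∏ l, exchangeSum N p p' r (γ ε) (j l) (j (l + 1)) (k l) (k (l + 1)))
    (l := 𝓝[≠] (0 : ℂ)) ?_ ?_ ?_
  · exact (((hγ.tendsto_dualConst hpq.2 hz).mul_const _).pow _).mul
      (tendsto_finsetProd _ fun l _ => hγ.tendsto_exchangeSum_left hpq.1 hpq'.2 _ _ _ _)
  · exact (((hγ.tendsto_dualConst hpq'.2 hz').mul_const _).pow _).mul
      (tendsto_finsetProd _ fun l _ => hγ.tendsto_exchangeSum_right hpq.2 hpq'.1 _ _ _ _)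
  · exact hrel.mono fun ε hε => hε j k

lemma StarGauge.eventually_regPair (h : StarGauge N S z φ) (hp : p ∈ S)
    (hγS : ∀ᶠ ε in 𝓝[≠] (0 : ℂ), γ ε ∈ S) (hγ : Approaches N z γ q) :
    ∀ᶠ ε in 𝓝[≠] (0 : ℂ), RegPair N p (γ ε) := by
  filter_upwards [hγS, hγ.avoid (p.y ^ N)] with ε h1 h2
  exact ⟨h.regW p hp _ h1 h2.1, h.regWbar p hp _ h1 h2.2⟩

end Limit

/-- Coinciding or otherwise degenerate pairs `q`, `r`, and points with `y = 0`, are reached by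
continuity. -/
lemma StarGauge.exchangeRel (h : StarGauge N S z φ) (hp : p ∈ S) (hp' : p' ∈ S)
    (hq : q ∈ S) (hr : r ∈ S) (hy : p.y ≠ 0) (hy' : p'.y ≠ 0)
    (hpq : RegPair N p q) (hpr : RegPair N p r) (hpq' : RegPair N p' q) (hpr' : RegPair N p' r)
    (L : ℕ) [NeZero L] : ExchangeRel N z φ L p p' q r := by
  have step : ∀ q ∈ S, ∀ r ∈ S, r.y ^ N ≠ 0 → RegPair N p q → RegPair N p r → RegPair N p' q →
      RegPair N p' r → ExchangeRel N z φ L p p' q r := by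
    intro q hq r hr hry hpq hpr hpq' hpr'
    obtain ⟨γ, hγS, hγ⟩ := h.approach q hq
    refine h.exchangeRel_of_approaches hp hp' hq hγ hpq hpq' ?_
    filter_upwards [hγS, h.eventually_regPair hp hγS hγ, h.eventually_regPair hp' hγS hγ,
      h.eventually_regPair hr hγS hγ, hγ.avoid 0] with ε h1 h2 h3 h4 h5
    exact (h.exchangeRel_of_regPair hp hp' hr h1 hy hy' hry h5.2 hpr h2 hpr' h3 h4 L).symm
  obtain ⟨γ, hγS, hγ⟩ := h.approach r hr
  refine (h.exchangeRel_of_approaches hp hp' hr hγ hpr hpr' ?_).symm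
  filter_upwards [hγS, h.eventually_regPair hp hγS hγ, h.eventually_regPair hp' hγS hγ,
    hγ.avoid 0] with ε h1 h2 h3 h4
  exact (step q hq (γ ε) h1 h4.2 hpq h2 hpq' h3).symm

/-- Operators `T q` and `T' q` exchanging their arguments up to factors yield a commuting family. -/
lemma commute_of_exchange {ι n : Type*} [Fintype n] [DecidableEq n] (T T' : ι → Matrix n n ℂ)
    (g : ι → ℂ) (hg : ∀ i, g i ≠ 0) (h₁ : ∀ i j, T i * T' j = (g i / g j) • (T j * T' i))
    (h₂ : ∀ i j, T' i * T j = (g j / g i) • (T' j * T i)) (o : ι) (hT : IsUnit (T o))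
    (hT' : IsUnit (T' o)) (i j : ι) :
    (T' o)⁻¹ * T' i = (g o / g i) • (T i * (T o)⁻¹) ∧
      Commute ((T' o)⁻¹ * T' i) ((T' o)⁻¹ * T' j) := by
  have dT := (Matrix.isUnit_iff_isUnit_det _).mp hT
  have dT' := (Matrix.isUnit_iff_isUnit_det _).mp hT'
  have hQ : ∀ i, (T' o)⁻¹ * T' i = (g o / g i) • (T i * (T o)⁻¹) := by
    intro i
    have h3 : T' i = (g o / g i) • (T' o * T i) * (T o)⁻¹ := by
      rw [← h₂, Matrix.mul_assoc, Matrix.mul_nonsing_inv _ dT, Matrix.mul_one]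
    rw [h3, Matrix.smul_mul, Matrix.mul_smul, Matrix.mul_assoc,
      Matrix.nonsing_inv_mul_cancel_left _ _ dT']
  refine ⟨hQ i, ?_⟩
  set Q : ι → Matrix n n ℂ := fun i => (T' o)⁻¹ * T' i with hQdef
  have hT'Q : ∀ i, T' i = T' o * Q i := fun i => by
    rw [hQdef, Matrix.mul_nonsing_inv_cancel_left _ _ dT']
  have hTQ : ∀ i, T i = (g i / g o) • (Q i * T o) := by
    intro i
    simp only [hQdef]
    rw [hQ, Matrix.smul_mul, smul_smul, Matrix.nonsing_inv_mul_cancel_right _ _ dT]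
    have h1 := hg i
    have h2 := hg o
    rw [div_mul_div_cancel₀ h2, div_self h1, one_smul]
  set K := T o * T' o with hK
  have hKu : IsUnit K := hT.mul hT'
  -- the first relation, for arbitrary `i`, `j`; for `j = o` it says that `Q i` commutes with `K`
  have hQK : ∀ i j, Q i * K * Q j = Q j * K * Q i := by
    intro i j
    have h3 := h₁ i j
    rw [hTQ i, hT'Q j, hTQ j, hT'Q i, Matrix.smul_mul, Matrix.smul_mul, smul_smul,
      div_mul_div_cancel₀ (hg j)] at h3
    have h4 := smul_right_injective _ (div_ne_zero (hg i) (hg o)) h3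
    simpa only [hK, Matrix.mul_assoc] using h4
  have hQo : Q o = 1 := Matrix.nonsing_inv_mul _ dT'
  have hcomm : ∀ i, Q i * K = K * Q i := by
    intro i
    have := hQK i o
    rwa [hQo, Matrix.mul_one, Matrix.one_mul] at this
  have := hQK i j
  rw [hcomm, hcomm, Matrix.mul_assoc K, Matrix.mul_assoc K] at this
  exact hKu.mul_left_cancel this

theorem StarGauge.commutation (h : StarGauge N S z φ) (hp : p ∈ S) (hp' : p' ∈ S) (hy : p.y ≠ 0)
    (hy' : p'.y ≠ 0) : Commutation N S p p' := by
  set m : ℕ := ∑ k : ZMod N, k.val with hm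
  have hroot : ∀ q : Rapidity, ∃ s : ℂ, s ^ N = z q ^ m := fun q =>
    IsAlgClosed.exists_pow_nat_eq _ (NeZero.pos N)
  choose s hs using hroot
  have hs0 : ∀ q ∈ S, s q ≠ 0 := by
    intro q hq h0
    have := hs q
    rw [h0, zero_pow (NeZero.ne N)] at this
    exact pow_ne_zero _ (h.z_ne_zero q hq) this.symm
  set A := dualConst N z φ with hA
  -- the factors `s` give the prescribed `N`-th powers and cancel in the ratios of the `f`
  set f : Rapidity → Rapidity → ℂ := fun p q => A p q * (s q / s p) with hf
  have hreg : ∀ q ∈ S, RegularT N p p' q → RegularThat N p p' q →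
      RegPair N p q ∧ RegPair N p' q := fun q hq h1 h2 =>
    ⟨⟨h.regW p hp q hq h1.1, h.regWbar p hp q hq h2.1⟩,
      ⟨h.regW p' hp' q hq h2.2, h.regWbar p' hp' q hq h1.2⟩⟩
  have hf0 : ∀ p ∈ S, ∀ q ∈ S, RegPair N p q → f p q ≠ 0 ∧ f p q ^ N = fPow N p q := by
    intro p hp q hq hpq
    refine ⟨mul_ne_zero (h.dualConst_ne_zero hp hq hpq)
      (div_ne_zero (hs0 q hq) (hs0 p hp)), ?_⟩
    rw [h.fPow_eq hp hq hpq, hf, mul_pow, _root_.div_pow, _root_.div_pow, hs, hs]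
  -- the common index type of the relations: regular points of the curve
  set ι := {q : Rapidity // q ∈ S ∧ RegularT N p p' q ∧ RegularThat N p p' q}
  set g : ι → ℂ := fun q => f p' q.1 / f p q.1 with hg
  have hfi : ∀ q : ι, (f p q.1 ≠ 0 ∧ f p q.1 ^ N = fPow N p q.1) ∧
      (f p' q.1 ≠ 0 ∧ f p' q.1 ^ N = fPow N p' q.1) := fun q =>
    ⟨hf0 p hp q.1 q.2.1 (hreg q.1 q.2.1 q.2.2.1 q.2.2.2).1,
      hf0 p' hp' q.1 q.2.1 (hreg q.1 q.2.1 q.2.2.1 q.2.2.2).2⟩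
  have hg0 : ∀ q, g q ≠ 0 := fun q => div_ne_zero (hfi q).2.1 (hfi q).1.1
  have hgg : ∀ q r : ι, g q / g r = (f p' q.1 * f p r.1) / (f p q.1 * f p' r.1) := by
    intro q r
    simp only [hg]
    rw [div_div_div_eq]
  have hgA : ∀ q r : ι, g q / g r =
      (A p' q.1 * A p r.1) / (A p q.1 * A p' r.1) := by
    intro q r
    rw [hgg]
    have h1 := hs0 p hp
    have h2 := hs0 p' hp'
    have h3 := hs0 q.1 q.2.1
    have h4 := hs0 r.1 r.2.1
    have a1 := (mul_ne_zero_iff.mp (hfi q).1.1).1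
    have a2 := (mul_ne_zero_iff.mp (hfi r).2.1).1
    simp only [hf]
    field_simp
  refine ⟨f, fun q hq h1 h2 => ?_, fun L _ => ?_⟩
  · have := hfi ⟨q, hq, h1, h2⟩
    exact ⟨this.1.1, this.2.1, this.1.2, this.2.2⟩
  have hTT : ∀ q r : ι, transferT N L p p' q.1 * transferThat N L p p' r.1 =
      (g q ^ L / g r ^ L) • (transferT N L p p' r.1 * transferThat N L p p' q.1) := by
    intro q r
    obtain ⟨q1, q2⟩ := hreg q.1 q.2.1 q.2.2.1 q.2.2.2
    obtain ⟨r1, r2⟩ := hreg r.1 r.2.1 r.2.2.1 r.2.2.2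
    ext j k
    have key := h.exchangeRel hp hp' q.2.1 r.2.1 hy hy' q1 r1 q2 r2 L j k
    have a1 := h.dualConst_ne_zero hp q.2.1 q1
    have a2 := h.dualConst_ne_zero hp' r.2.1 r2
    rw [Matrix.smul_apply, transferT_mul_transferThat, transferT_mul_transferThat, smul_eq_mul,
      ← _root_.div_pow, hgA, _root_.div_pow, div_mul_eq_mul_div,
      eq_div_iff (pow_ne_zero _ (mul_ne_zero a1 a2)), mul_comm]
    exact key
  have hTT' : ∀ q r : ι, transferThat N L p p' q.1 * transferT N L p p' r.1 =
      (g r ^ L / g q ^ L) • (transferThat N L p p' r.1 * transferT N L p p' q.1) := by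
    intro q r
    obtain ⟨q1, q2⟩ := hreg q.1 q.2.1 q.2.2.1 q.2.2.2
    obtain ⟨r1, r2⟩ := hreg r.1 r.2.1 r.2.2.1 r.2.2.2
    ext j k
    have key := h.exchangeRel hp' hp q.2.1 r.2.1 hy' hy q2 r2 q1 r1 L j k
    have a1 := h.dualConst_ne_zero hp' q.2.1 q2
    have a2 := h.dualConst_ne_zero hp r.2.1 r1
    rw [Matrix.smul_apply, transferThat_mul_transferT, transferThat_mul_transferT, smul_eq_mul,
      ← _root_.div_pow, hgA, _root_.div_pow, div_mul_eq_mul_div,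
      eq_div_iff (pow_ne_zero _ (mul_ne_zero _ _)), mul_comm, mul_comm (A p' r.1),
      mul_comm (A p r.1)]
    · exact key
    · exact h.dualConst_ne_zero hp r.2.1 r1
    · exact h.dualConst_ne_zero hp' q.2.1 q2
  refine ⟨fun q hq q1 q2 r hr r1 r2 => ?_, fun o ho o1 o2 uT' uT q hq q1 q2 => ?_⟩
  · have e1 := hgg ⟨q, hq, q1, q2⟩ ⟨r, hr, r1, r2⟩
    have e2 := hgg ⟨r, hr, r1, r2⟩ ⟨q, hq, q1, q2⟩
    have e3 := hTT ⟨q, hq, q1, q2⟩ ⟨r, hr, r1, r2⟩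
    have e4 := hTT' ⟨q, hq, q1, q2⟩ ⟨r, hr, r1, r2⟩
    rw [← _root_.div_pow, e1] at e3
    rw [← _root_.div_pow, e2] at e4
    refine ⟨e3, ?_⟩
    rw [mul_comm (f p q), mul_comm (f p' q)]
    exact e4
  · have key := commute_of_exchange (fun q : ι => transferT N L p p' q.1)
      (fun q : ι => transferThat N L p p' q.1) (fun q => g q ^ L)
      (fun q => pow_ne_zero _ (hg0 q)) hTT hTT' ⟨o, ho, o1, o2⟩ uT uT'
    refine ⟨?_, fun r hr r1 r2 => (key ⟨q, hq, q1, q2⟩ ⟨r, hr, r1, r2⟩).2⟩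
    have e1 := (key ⟨q, hq, q1, q2⟩ ⟨q, hq, q1, q2⟩).1
    have e2 := hgg ⟨o, ho, o1, o2⟩ ⟨q, hq, q1, q2⟩
    rw [← _root_.div_pow, e2] at e1
    rw [mul_comm (f p q), mul_comm (f p' q)]
    exact e1

end Exchange

/-! ### The self-dual curves `x ^ N + y ^ N = δ` -/

section SelfDual

open Filter Topology

variable {N : ℕ} [NeZero N] {z : Rapidity → ℂ} {p q r : Rapidity}

lemma pow_val_eq_pred_mul {w : ℂ} (hw : w ^ N = 1) (n : ZMod N) :
    w ^ n.val = w ^ (n - 1).val * w := by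
  have h1 : w ^ (1 : ZMod N).val = w := by
    have := pow_val_natCast hw 1
    simpa using this
  conv_lhs => rw [← sub_add_cancel n 1, pow_val_add hw, h1]

lemma RegWbar.phased_recurrence (h : RegWbar N p q) (hz : (z p * z q) ^ N = 1) (n : ZMod N) :
    (q.y - omegaZ N n * p.y) * phasedWbar N z p q n =
      p.μ * q.μ / (z p * z q) * (omega N * p.x - omegaZ N n * q.x) *
        phasedWbar N z p q (n - 1) := by
  have hi : (z p * z q)⁻¹ ^ N = 1 := by rw [inv_pow, hz, inv_one]
  simp only [phasedWbar]
  rw [pow_val_eq_pred_mul hi n]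
  linear_combination (z p * z q)⁻¹ ^ (n - 1).val * (z p * z q)⁻¹ * h.recurrence n

lemma RegW.phased_recurrence (h : RegW N p q) (hz : (z q / z p) ^ N = 1) (n : ZMod N) :
    (p.y - omegaZ N n * q.x) * phasedW N z p q n =
      z q * p.μ / (z p * q.μ) * (q.y - omegaZ N n * p.x) * phasedW N z p q (n - 1) := by
  have h1 := h.recurrence n
  have h2 := h.mu_right
  simp only [phasedW]
  rw [pow_val_eq_pred_mul hz n]
  have : (p.y - omegaZ N n * q.x) * W N p q n =
      p.μ / q.μ * (q.y - omegaZ N n * p.x) * W N p q (n - 1) := by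
    field_simp
    linear_combination h1
  have e : z q * p.μ / (z p * q.μ) = z q / z p * (p.μ / q.μ) := by
    rw [div_mul_div_comm]
  rw [e]
  linear_combination (z q / z p) ^ (n - 1).val * (z q / z p) * this

@[simp] lemma phasedW_zero : phasedW N z p q 0 = 1 := by simp [phasedW]

@[simp] lemma phasedWbar_zero : phasedWbar N z p q 0 = 1 := by simp [phasedWbar]

lemma tendsto_const_add_nhdsNE (a : ℂ) : Tendsto (fun ε : ℂ => a + ε) (𝓝[≠] 0) (𝓝 a) := by
  have : Tendsto (fun ε : ℂ => a + ε) (𝓝 0) (𝓝 (a + 0)) := tendsto_id.const_add a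
  rw [add_zero] at this
  exact this.mono_left nhdsWithin_le_nhds

lemma eventually_add_pow_ne (a B : ℂ) : ∀ᶠ ε in 𝓝[≠] (0 : ℂ), (a + ε) ^ N ≠ B := by
  have hfin : {w : ℂ | w ^ N = B}.Finite := by
    refine (Polynomial.nthRoots N B).toFinset.finite_toSet.subset fun w hw => ?_
    simpa [Polynomial.mem_nthRoots (NeZero.pos N)] using hw
  have hcl : IsClosed ({w : ℂ | w ^ N = B} \ {a}) := (hfin.subset Set.sdiff_subset).isClosed
  have h2 := (tendsto_const_add_nhdsNE a).eventually (hcl.isOpen_compl.mem_nhds (fun h => h.2 rfl))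
  filter_upwards [h2, self_mem_nhdsWithin] with ε h3 h4 h5
  exact h3 ⟨h5, fun h6 => h4 (by simpa using h6)⟩

/-- An `N`-th root of a function tending to one. -/
lemma tendsto_cpow_inv {f : ℂ → ℂ} {l : Filter ℂ} (hf : Tendsto f l (𝓝 1)) :
    Tendsto (fun ε => f ε ^ ((N : ℂ)⁻¹)) l (𝓝 1) := by
  have h1 : ContinuousAt (fun w : ℂ => w ^ ((N : ℂ)⁻¹)) 1 :=
    continuousAt_cpow_const (by simp)
  have := h1.tendsto.comp hf
  rwa [Complex.one_cpow] at this

/-- Through every point of the plane curve `x ^ N + y ^ N = δ` there is a path along which no value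
of `x ^ N` or `y ^ N` persists. -/
lemma exists_fermat_path {x y δ : ℂ} (h : x ^ N + y ^ N = δ) : ∃ f g : ℂ → ℂ,
    Tendsto f (𝓝[≠] 0) (𝓝 x) ∧ Tendsto g (𝓝[≠] 0) (𝓝 y) ∧ (∀ ε, f ε ^ N + g ε ^ N = δ) ∧
      ∀ B, ∀ᶠ ε in 𝓝[≠] (0 : ℂ), f ε ^ N ≠ B ∧ g ε ^ N ≠ B := by
  -- for `x ≠ 0` the coordinate `y` is a local parameter, up to an `N`-th root near `1`
  have gen : ∀ x y : ℂ, x ^ N + y ^ N = δ → x ≠ 0 → ∃ f g : ℂ → ℂ,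
      Tendsto f (𝓝[≠] 0) (𝓝 x) ∧ Tendsto g (𝓝[≠] 0) (𝓝 y) ∧ (∀ ε, f ε ^ N + g ε ^ N = δ) ∧
        ∀ B, ∀ᶠ ε in 𝓝[≠] (0 : ℂ), f ε ^ N ≠ B ∧ g ε ^ N ≠ B := by
    intro x y h hx
    have hX := pow_ne_zero N hx
    have hpow : ∀ ε : ℂ, (x * ((δ - (y + ε) ^ N) / x ^ N) ^ ((N : ℂ)⁻¹)) ^ N =
        δ - (y + ε) ^ N := by
      intro ε
      rw [mul_pow, Complex.cpow_nat_inv_pow _ (NeZero.ne N)]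
      field_simp
    refine ⟨fun ε => x * ((δ - (y + ε) ^ N) / x ^ N) ^ ((N : ℂ)⁻¹), fun ε => y + ε, ?_,
      tendsto_const_add_nhdsNE y, fun ε => ?_, fun B => ?_⟩
    · have h1 : Tendsto (fun ε : ℂ => (δ - (y + ε) ^ N) / x ^ N) (𝓝[≠] 0) (𝓝 1) := by
        have h2 := ((tendsto_const_add_nhdsNE y).pow N).const_sub δ |>.div_const (x ^ N)
        rwa [← h, add_sub_cancel_right, div_self hX, h] at h2
      have := (tendsto_cpow_inv (N := N) h1).const_mul x
      rwa [mul_one] at this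
    · rw [hpow]
      ring
    · filter_upwards [eventually_add_pow_ne (N := N) y B,
        eventually_add_pow_ne (N := N) y (δ - B)] with ε h1 h2
      refine ⟨fun h3 => h2 ?_, h1⟩
      rw [hpow] at h3
      linear_combination -h3
  by_cases hx : x = 0
  · by_cases hy : y = 0
    -- the origin occurs for `δ = 0` only, where the curve is a union of lines
    · obtain ⟨ζ, hζ⟩ := IsAlgClosed.exists_pow_nat_eq (-1 : ℂ) (NeZero.pos N)
      have h0 : Tendsto (fun ε : ℂ => ε) (𝓝[≠] 0) (𝓝 0) := tendsto_id.mono_left nhdsWithin_le_nhds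
      refine ⟨fun ε => ζ * ε, fun ε => ε, ?_, ?_, fun ε => ?_, fun B => ?_⟩
      · have := h0.const_mul ζ
        rw [mul_zero] at this
        rwa [hx]
      · rwa [hy]
      · rw [← h, hx, hy, mul_pow, hζ, zero_pow (NeZero.ne N)]
        ring
      · filter_upwards [eventually_add_pow_ne (N := N) 0 B,
          eventually_add_pow_ne (N := N) 0 (-B)] with ε h1 h2
        rw [zero_add] at h1 h2
        refine ⟨fun h3 => h2 ?_, h1⟩
        rw [mul_pow, hζ] at h3
        linear_combination -h3
    · obtain ⟨f, g, h1, h2, h3, h4⟩ := gen y x (by rw [add_comm, h]) hy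
      exact ⟨g, f, h2, h1, fun ε => by rw [add_comm, h3], fun B => (h4 B).mono fun _ h => h.symm⟩
  · exact gen x y h hx

/-- On the curves `x ^ N + y ^ N = δ`, `μ ^ N = ±1`, the powers of `μ` can be removed from the
weights. -/
lemma weightPair_of_mu_pow {ε : ℂ} (hε : ε ^ 2 = 1) (hp : p.μ ^ N = ε) (hq : q.μ ^ N = ε)
    (h : RegPair N p q) :
    WeightPair N (p.x, p.y) (q.x, q.y) (phasedWbar N Rapidity.μ p q)
      (phasedW N Rapidity.μ p q) where
  u_zero := phasedWbar_zero
  v_zero := phasedW_zero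
  u_rec n := by
    rw [h.2.phased_recurrence (by rw [mul_pow, hp, hq, ← sq, hε]),
      div_self (mul_ne_zero h.1.mu_left h.1.mu_right), one_mul]
  v_rec n := by
    have h0 : p.μ ^ N ≠ 0 := pow_ne_zero N h.1.mu_left
    rw [h.1.phased_recurrence (by rw [_root_.div_pow, hq, ← hp, div_self h0]), mul_comm p.μ q.μ,
      mul_comm q.μ p.μ, div_self (mul_ne_zero h.1.mu_left h.1.mu_right), one_mul]
  u_den := h.2.den_ne_zero
  u_num := h.2.num_ne_zero
  v_den := h.1.den_ne_zero
  v_num := h.1.num_ne_zero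

theorem starGauge_fermat (hN : 2 ≤ N) {δ ε : ℂ} (hε : ε ^ 2 = 1) :
    StarGauge N {q | q.x ^ N + q.y ^ N = δ ∧ q.μ ^ N = ε} Rapidity.μ (Equiv.refl _) := by
  have hε0 : ε ≠ 0 := by
    rintro rfl
    simp at hε
  have hμ : ∀ q : Rapidity, q.μ ^ N = ε → q.μ ≠ 0 := by
    intro q hq h0
    rw [h0, zero_pow (NeZero.ne N)] at hq
    exact hε0 hq.symm
  have ne_origin : ∀ q : Rapidity, q.y ≠ 0 → ((q.x, q.y) : ℂ × ℂ) ≠ 0 := fun q h h0 =>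
    h (congrArg Prod.snd h0)
  refine ⟨fun p hp => hμ p hp.2, fun p hp q hq => ?_,
    fun p hp q hq hne => ⟨hμ p hp.2, hμ q hq.2, hne, ?_⟩,
    fun p hp q hq hne => ⟨hμ p hp.2, hμ q hq.2, hne, ?_⟩, fun p hp q hq hpq k => ?_,
    fun p hp q hq r hr hpy hqy hry hpq hpr hqr a b c => ?_, fun q hq => ?_⟩
  · rw [mul_pow, hp.2, hq.2, ← sq, hε]
  · rw [hp.2, hq.2]
    linear_combination ε * (hq.1 - hp.1)
  · rw [mul_pow, hp.2, hq.2, ← sq, hε]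
    linear_combination hp.1 - hq.1
  · exact (weightPair_of_mu_pow hε hp.2 hq.2 hpq).hat_eq k
  · have h₁ := weightPair_of_mu_pow hε hp.2 hq.2 hpq
    have h₂ := weightPair_of_mu_pow hε hp.2 hr.2 hpr
    have h₃ := weightPair_of_mu_pow hε hq.2 hr.2 hqr
    have hconst := starTriangle_const hN h₁ h₂ h₃ (ne_origin p hpy)
      (ne_origin q fun h => hqy (by rw [h, zero_pow (NeZero.ne N)]))
      (ne_origin r fun h => hry (by rw [h, zero_pow (NeZero.ne N)]))
    simp only [dualConst, Equiv.refl_apply]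
    rw [← hconst, starTriangle h₁ h₂ h₃ a b c]
    ring
  · obtain ⟨f, g, h1, h2, h3, h4⟩ := exists_fermat_path hq.1
    exact ⟨fun ε => ⟨f ε, g ε, q.μ⟩, Eventually.of_forall fun ε => ⟨h3 ε, hq.2⟩,
      ⟨h1, h2, tendsto_const_nhds, tendsto_const_nhds, h4⟩⟩

end SelfDual

/-! ### The self-dual curve `x ^ N + y ^ N = x ^ N y ^ N` -/

section ProductCurve

open Filter Topology

variable {N : ℕ} [NeZero N] {p q r : Rapidity}

/-- On `x ^ N + y ^ N = x ^ N y ^ N`, `μ ^ N = 1 - y ^ N`, the quotient `x μ / y` is an `N`-th root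
of `-1`; at the point `x = y = 0` it can be any such root. -/
noncomputable def prodPhase (N : ℕ) [NeZero N] (q : Rapidity) : ℂ :=
  if q.y = 0 then (IsAlgClosed.exists_pow_nat_eq (-1 : ℂ) (NeZero.pos N)).choose
  else q.x * q.μ / q.y

lemma mu_ne_zero_of_mem_curveProd (hq : q ∈ curveProd N) : q.μ ≠ 0 := by
  intro h0
  have h1 := hq.2
  have h2 := hq.1
  rw [h0, zero_pow (NeZero.ne N), eq_comm, sub_eq_zero] at h1
  rw [← h1, mul_one] at h2
  simp at h2

lemma prodPhase_pow (hq : q ∈ curveProd N) : prodPhase N q ^ N = -1 := by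
  unfold prodPhase
  split_ifs with hy
  · exact (IsAlgClosed.exists_pow_nat_eq (-1 : ℂ) (NeZero.pos N)).choose_spec
  · rw [_root_.div_pow, mul_pow, div_eq_iff (pow_ne_zero N hy), hq.2]
    linear_combination hq.1

lemma prodPhase_ne_zero (hq : q ∈ curveProd N) : prodPhase N q ≠ 0 := by
  intro h0
  have := prodPhase_pow hq
  rw [h0, zero_pow (NeZero.ne N)] at this
  norm_num at this

lemma x_mul_mu (hq : q ∈ curveProd N) : q.x * q.μ = prodPhase N q * q.y := by
  unfold prodPhase
  split_ifs with hy
  · have h1 := hq.1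
    rw [hy, zero_pow (NeZero.ne N), mul_zero, add_zero] at h1
    rw [hy, pow_eq_zero_iff (NeZero.ne N) |>.mp h1, zero_mul, mul_zero]
  · rw [div_mul_cancel₀ _ hy]

lemma regW_of_mem_curveProd (hp : p ∈ curveProd N) (hq : q ∈ curveProd N)
    (h : q.x ^ N ≠ p.y ^ N) : RegW N p q := by
  refine ⟨mu_ne_zero_of_mem_curveProd hp, mu_ne_zero_of_mem_curveProd hq, h, ?_⟩
  rw [hp.2, hq.2]
  linear_combination hq.1 - hp.1

lemma regWbar_of_mem_curveProd (hp : p ∈ curveProd N) (hq : q ∈ curveProd N)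
    (h : q.y ^ N ≠ p.y ^ N) : RegWbar N p q := by
  refine ⟨mu_ne_zero_of_mem_curveProd hp, mu_ne_zero_of_mem_curveProd hq, h, ?_⟩
  rw [mul_pow, hp.2, hq.2]
  linear_combination (1 - q.y ^ N) * hp.1 - (1 - p.y ^ N) * hq.1

lemma prodPhase_mul_pow (hp : p ∈ curveProd N) (hq : q ∈ curveProd N) :
    (prodPhase N p * prodPhase N q) ^ N = 1 := by
  rw [mul_pow, prodPhase_pow hp, prodPhase_pow hq]
  norm_num

lemma prodPhase_div_pow (hp : p ∈ curveProd N) (hq : q ∈ curveProd N) :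
    (prodPhase N q / prodPhase N p) ^ N = 1 := by
  rw [_root_.div_pow, prodPhase_pow hp, prodPhase_pow hq]
  norm_num

/-- The weights on `x ^ N + y ^ N = x ^ N y ^ N` are, in the order `q`, `p` and with the argument
of `W` reflected, weights of points of the Fermat curve: with `v = μ / z` the point `(v / y, 1 / y)`
is on it. Clearing `y_p` and `y_q` keeps the statement meaningful at `x = y = 0`. -/
lemma weightPair_of_mem_curveProd (hp : p ∈ curveProd N) (hq : q ∈ curveProd N)
    (h : RegPair N p q) :
    WeightPair N (q.μ / prodPhase N q * p.y, p.y) (p.μ / prodPhase N p * q.y, q.y)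
      (phasedWbar N (prodPhase N) p q)
      (fun n => phasedW N (prodPhase N) p q (-n - 1) / phasedW N (prodPhase N) p q (-1)) := by
  have zp := prodPhase_ne_zero hp
  have zq := prodPhase_ne_zero hq
  have mp := h.1.mu_left
  have mq := h.1.mu_right
  have hxp : p.y = p.μ / prodPhase N p * p.x := by
    have := x_mul_mu hp
    field_simp
    linear_combination -this
  have hxq : q.y = q.μ / prodPhase N q * q.x := by
    have := x_mul_mu hq
    field_simp
    linear_combination -this
  set vp := p.μ / prodPhase N p with hvp
  set vq := q.μ / prodPhase N q with hvq
  have vp0 : vp ≠ 0 := div_ne_zero mp zp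
  have vq0 : vq ≠ 0 := div_ne_zero mq zq
  have hW0 : phasedW N (prodPhase N) p q (-1) ≠ 0 :=
    mul_ne_zero (pow_ne_zero _ (div_ne_zero zq zp)) (h.1.W_ne_zero _)
  refine ⟨phasedWbar_zero, ?_, fun n => ?_, fun n => ?_, h.2.den_ne_zero, fun n => ?_, fun n => ?_,
    fun n => ?_⟩
  · simp only [neg_zero, zero_sub]
    exact div_self hW0
  · have h1 := h.2.phased_recurrence (z := prodPhase N) (prodPhase_mul_pow hp hq) n
    have h2 : p.μ * q.μ / (prodPhase N p * prodPhase N q) = vp * vq := by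
      rw [hvp, hvq, div_mul_div_comm]
    rw [h2] at h1
    simp only
    rw [h1]
    linear_combination (omegaZ N n * vp * phasedWbar N (prodPhase N) p q (n - 1)) * hxq -
      (omega N * vq * phasedWbar N (prodPhase N) p q (n - 1)) * hxp
  · have h1 := h.1.phased_recurrence (z := prodPhase N) (prodPhase_div_pow hp hq) (-n)
    have h2 : prodPhase N q * p.μ / (prodPhase N p * q.μ) = vp / vq := by
      rw [hvp, hvq, div_div_div_eq, mul_comm p.μ, mul_comm (prodPhase N p)]
    rw [h2, omegaZ_neg] at h1
    have e := omegaZ_ne_zero n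
    simp only
    rw [show -(n - 1) - 1 = -n by ring, ← mul_div_assoc, ← mul_div_assoc]
    congr 1
    have h3 : vq * (omegaZ N n * p.y - q.x) * phasedW N (prodPhase N) p q (-n) =
        vp * (omegaZ N n * q.y - p.x) * phasedW N (prodPhase N) p q (-n - 1) := by
      field_simp at h1
      linear_combination h1
    linear_combination h3 + phasedW N (prodPhase N) p q (-n - 1) * hxp -
      phasedW N (prodPhase N) p q (-n) * hxq
  · have : omega N * (vq * p.y) - omegaZ N n * (vp * q.y) =
        vp * vq * (omega N * p.x - omegaZ N n * q.x) := by
      linear_combination omega N * vq * hxp - omegaZ N n * vp * hxq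
    exact this ▸ mul_ne_zero (mul_ne_zero vp0 vq0) (h.2.num_ne_zero n)
  · have e := omegaZ_ne_zero n
    have : p.y - omegaZ N n * (vp * q.y) =
        -(omegaZ N n * vp) * (q.y - omegaZ N (-n) * p.x) := by
      rw [omegaZ_neg]
      field_simp
      linear_combination hxp
    exact this ▸ mul_ne_zero (neg_ne_zero.mpr (mul_ne_zero e vp0)) (h.1.num_ne_zero _)
  · have e := omegaZ_ne_zero n
    have : q.y - omegaZ N n * (vq * p.y) =
        -(omegaZ N n * vq) * (p.y - omegaZ N (-n) * q.x) := by
      rw [omegaZ_neg]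
      field_simp
      linear_combination hxq
    exact this ▸ mul_ne_zero (neg_ne_zero.mpr (mul_ne_zero e vq0)) (h.1.den_ne_zero _)

lemma WeightPair.scale {P Q : ℂ × ℂ} {u v : ZMod N → ℂ} (h : WeightPair N P Q u v) {c : ℂ}
    (hc : c ≠ 0) : WeightPair N (c * P.1, c * P.2) (c * Q.1, c * Q.2) u v where
  u_zero := h.u_zero
  v_zero := h.v_zero
  u_rec n := by linear_combination c * h.u_rec n
  v_rec n := by linear_combination c * h.v_rec n
  u_den n := by
    have := mul_ne_zero hc (h.u_den n)
    rwa [mul_sub, mul_left_comm] at this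
  u_num n := by
    have := mul_ne_zero hc (h.u_num n)
    rwa [mul_sub, mul_left_comm, mul_left_comm c (omegaZ N n)] at this
  v_den n := by
    have := mul_ne_zero hc (h.v_den n)
    rwa [mul_sub, mul_left_comm] at this
  v_num n := by
    have := mul_ne_zero hc (h.v_num n)
    rwa [mul_sub, mul_left_comm] at this

lemma weightPair_of_mem_curveProd' (hp : p ∈ curveProd N) (hq : q ∈ curveProd N)
    (h : RegPair N p q) (hpy : p.y ≠ 0) (hqy : q.y ≠ 0) :
    WeightPair N (q.μ / (prodPhase N q * q.y), q.y⁻¹) (p.μ / (prodPhase N p * p.y), p.y⁻¹)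
      (phasedWbar N (prodPhase N) p q)
      (fun n => phasedW N (prodPhase N) p q (-n - 1) / phasedW N (prodPhase N) p q (-1)) := by
  have h1 := (weightPair_of_mem_curveProd hp hq h).scale
    (inv_ne_zero (mul_ne_zero hpy hqy))
  have zp := prodPhase_ne_zero hp
  have zq := prodPhase_ne_zero hq
  convert h1 using 2
  · field_simp
  · field_simp
  · field_simp
  · field_simp

/-- The path keeps the phase `z` fixed and is parametrised by `y`; then `v = μ / z` is an `N`-th root
of `y ^ N - 1`. -/
lemma exists_prod_path (hq : q ∈ curveProd N) : ∃ γ : ℂ → Rapidity,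
    (∀ᶠ ε in 𝓝[≠] 0, γ ε ∈ curveProd N) ∧ Approaches N (prodPhase N) γ q := by
  have hz := prodPhase_ne_zero hq
  have hzN := prodPhase_pow hq
  have hμ := mu_ne_zero_of_mem_curveProd hq
  have hx := x_mul_mu hq
  set z := prodPhase N q with hzdef
  set v := q.μ / z with hv
  have hv0 : v ≠ 0 := div_ne_zero hμ hz
  have hvN : v ^ N = q.y ^ N - 1 := by
    rw [hv, _root_.div_pow, hzN, hq.2]
    ring
  have hvN0 := pow_ne_zero N hv0
  set V : ℂ → ℂ := fun ε => v * (((q.y + ε) ^ N - 1) / v ^ N) ^ ((N : ℂ)⁻¹) with hV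
  have hVN : ∀ ε, V ε ^ N = (q.y + ε) ^ N - 1 := by
    intro ε
    rw [hV, mul_pow, Complex.cpow_nat_inv_pow _ (NeZero.ne N)]
    field_simp
  have hVt : Tendsto V (𝓝[≠] 0) (𝓝 v) := by
    have h1 : Tendsto (fun ε : ℂ => ((q.y + ε) ^ N - 1) / v ^ N) (𝓝[≠] 0) (𝓝 1) := by
      have h2 := (((tendsto_const_add_nhdsNE q.y).pow N).sub_const 1).div_const (v ^ N)
      rwa [← hvN, div_self hvN0] at h2
    have := (tendsto_cpow_inv (N := N) h1).const_mul v
    rwa [mul_one] at this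
  have hV0 : ∀ᶠ ε in 𝓝[≠] (0 : ℂ), V ε ≠ 0 := by
    filter_upwards [eventually_add_pow_ne (N := N) q.y 1] with ε h1 h2
    have := hVN ε
    rw [h2, zero_pow (NeZero.ne N), eq_comm, sub_eq_zero] at this
    exact h1 this
  have hxv : q.x = q.y / v := by
    rw [hv]
    field_simp
    linear_combination hx
  have hy0 : ∀ᶠ ε in 𝓝[≠] (0 : ℂ), q.y + ε ≠ 0 := by
    filter_upwards [eventually_add_pow_ne (N := N) q.y 0] with ε h1 h2
    rw [h2, zero_pow (NeZero.ne N)] at h1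
    exact h1 rfl
  refine ⟨fun ε => ⟨(q.y + ε) / V ε, q.y + ε, z * V ε⟩, ?_, ⟨?_, ?_, ?_, ?_, fun B => ?_⟩⟩
  · filter_upwards [hV0] with ε h1
    have h2 := pow_ne_zero N h1
    refine ⟨?_, ?_⟩
    · simp only [_root_.div_pow]
      field_simp
      rw [hVN]
      ring
    · simp only [mul_pow, hzN, hVN]
      ring
  · simp only
    rw [hxv]
    exact (tendsto_const_add_nhdsNE q.y).div hVt hv0
  · exact tendsto_const_add_nhdsNE q.y
  · have := hVt.const_mul z
    rwa [hv, mul_div_cancel₀ _ hz] at this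
  · refine tendsto_const_nhds.congr' ?_
    filter_upwards [hV0, hy0] with ε h1 h2
    have : prodPhase N ⟨(q.y + ε) / V ε, q.y + ε, z * V ε⟩ = z := by
      simp only [prodPhase, if_neg h2]
      field_simp
    exact this.symm
  · filter_upwards [hV0, eventually_add_pow_ne (N := N) q.y B,
      eventually_add_pow_ne (N := N) q.y (B / (B - 1))] with ε h1 h2 h3
    refine ⟨fun h4 => h3 ?_, h2⟩
    have h5 := pow_ne_zero N h1
    rw [hVN] at h5
    simp only [_root_.div_pow, hVN] at h4
    rw [div_eq_iff h5] at h4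
    have hB : B - 1 ≠ 0 := by
      intro h6
      rw [sub_eq_zero.mp h6] at h4
      have : (1 : ℂ) = 0 := by linear_combination h4
      exact one_ne_zero this
    rw [eq_div_iff hB]
    linear_combination -h4

/-- The reversal of the order of the rapidities is compensated by the reflection `k ↦ -1 - k` of the
dual variable. -/
theorem starGauge_curveProd (hN : 2 ≤ N) :
    StarGauge N (curveProd N) (prodPhase N) (Equiv.subLeft (-1)) := by
  have hconst : ∀ {p q : Rapidity}, p ∈ curveProd N → q ∈ curveProd N → RegPair N p q →
      dualConst N (prodPhase N) (Equiv.subLeft (-1)) p q =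
        hat (phasedWbar N (prodPhase N) p q) 0 / phasedW N (prodPhase N) p q (-1) := by
    intro p q hp hq h
    rw [dualConst, Equiv.subLeft_apply, sub_zero, (weightPair_of_mem_curveProd hp hq h).hat_eq]
    simp [div_eq_mul_inv]
  have hW0 : ∀ {p q : Rapidity}, p ∈ curveProd N → q ∈ curveProd N → RegPair N p q →
      phasedW N (prodPhase N) p q (-1) ≠ 0 := fun hp hq h =>
    mul_ne_zero (pow_ne_zero _ (div_ne_zero (prodPhase_ne_zero hq) (prodPhase_ne_zero hp)))
      (h.1.W_ne_zero _)
  refine ⟨fun p hp => prodPhase_ne_zero hp, fun p hp q hq => prodPhase_mul_pow hp hq,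
    fun p hp q hq => regW_of_mem_curveProd hp hq,
    fun p hp q hq => regWbar_of_mem_curveProd hp hq, fun p hp q hq hpq k => ?_,
    fun p hp q hq r hr hpy hqy hry hpq hpr hqr a b c => ?_, fun q hq => exists_prod_path hq⟩
  · rw [hconst hp hq hpq, Equiv.subLeft_apply, (weightPair_of_mem_curveProd hp hq hpq).hat_eq]
    rw [show -(-1 - k) - 1 = k by ring]
    ring
  · have hqy' : q.y ≠ 0 := fun h => hqy (by rw [h, zero_pow (NeZero.ne N)])
    have hry' : r.y ≠ 0 := fun h => hry (by rw [h, zero_pow (NeZero.ne N)])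
    have h₁ := weightPair_of_mem_curveProd' hq hr hqr hqy' hry'
    have h₂ := weightPair_of_mem_curveProd' hp hr hpr hpy hry'
    have h₃ := weightPair_of_mem_curveProd' hp hq hpq hpy hqy'
    have ne_origin : ∀ w y : ℂ, y ≠ 0 → ((w, y⁻¹) : ℂ × ℂ) ≠ 0 := fun w y h h0 =>
      inv_ne_zero h (congrArg Prod.snd h0)
    have hc := starTriangle_const hN h₁ h₂ h₃ (ne_origin _ _ hry') (ne_origin _ _ hqy')
      (ne_origin _ _ hpy)
    -- the arguments undo the reflection of `W` in `weightPair_of_mem_curveProd`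
    have key := starTriangle h₁ h₂ h₃ (-a - 1) (-c) (-b)
    rw [hconst hp hr hpr, hconst hp hq hpq, hconst hq hr hqr]
    have w1 := hW0 hp hq hpq
    have w2 := hW0 hp hr hpr
    have w3 := hW0 hq hr hqr
    have e : starSum (phasedWbar N (prodPhase N) p q) (phasedWbar N (prodPhase N) q r)
        (phasedW N (prodPhase N) p r) a b c = phasedW N (prodPhase N) p r (-1) *
        starSum (phasedWbar N (prodPhase N) q r) (phasedWbar N (prodPhase N) p q)
          (fun n => phasedW N (prodPhase N) p r (-n - 1) / phasedW N (prodPhase N) p r (-1))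
          (-a - 1) (-c) (-b) := by
      rw [starSum, starSum, Finset.mul_sum, ← Equiv.sum_comp (Equiv.neg (ZMod N))]
      refine Finset.sum_congr rfl fun d _ => ?_
      simp only [Equiv.neg_apply]
      rw [show -(-a - 1 - d) - 1 = a + d by ring, show -c - d = -d - c by ring,
        show d - -b = b - -d by ring, show a - -d = a + d by ring]
      field_simp
    rw [e, key]
    rw [show -(-a - 1 - -c) - 1 = a - c by ring, show -c - -b = b - c by ring,
      show -(-a - 1 - -b) - 1 = a - b by ring]
    have := congrArg (fun t => t * (phasedW N (prodPhase N) p q (a - b) *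
      phasedWbar N (prodPhase N) p r (b - c) * phasedW N (prodPhase N) q r (a - c)) /
      (phasedW N (prodPhase N) p q (-1) * phasedW N (prodPhase N) q r (-1))) hc
    field_simp
    field_simp at this
    linear_combination this

end ProductCurve

/-! ### Regularity of the weights on the rapidity curves -/

section Curves

variable {N : ℕ} [NeZero N] {p q : Rapidity} {S : Set Rapidity}

theorem exists_starGauge (hN : 2 ≤ N) (hS : IsSelfDualCurve N S) :
    ∃ z φ, StarGauge N S z φ := by
  rcases hS with rfl | rfl | rfl | rfl
  · exact ⟨_, _, starGauge_fermat hN (δ := 0) (ε := 1) (by norm_num)⟩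
  · exact ⟨_, _, starGauge_fermat hN (δ := 0) (ε := -1) (by norm_num)⟩
  · exact ⟨_, _, starGauge_fermat hN (δ := 1) (ε := 1) (by norm_num)⟩
  · exact ⟨_, _, starGauge_curveProd hN⟩

lemma ne_zero_of_curveW {k k' : ℂ} (hk : k ^ 2 + k' ^ 2 = 1) (h1 : k' ≠ 1) (h2 : k' ≠ -1) :
    k ≠ 0 := by
  rintro rfl
  have : (k' - 1) * (k' + 1) = 0 := by linear_combination hk
  rcases mul_eq_zero.mp this with h | h
  · exact h1 (sub_eq_zero.mp h)
  · exact h2 (eq_neg_of_add_eq_zero_left h)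

lemma regW_of_pottsCurve (hN : 2 ≤ N) (hS : IsPottsCurve N S) (hp : p ∈ S) (hq : q ∈ S)
    (h : q.x ^ N ≠ p.y ^ N) : RegW N p q := by
  rcases hS with ⟨k, k', hk, -, h1, h2, rfl⟩ | hS
  · refine ⟨hp.1, hq.1, h, mul_left_cancel₀ (ne_zero_of_curveW hk h1 h2) ?_⟩
    have h3 := pow_ne_zero N hp.1
    have h4 := pow_ne_zero N hq.1
    have e1 : k * (p.μ ^ N * (q.y ^ N - p.x ^ N)) =
        p.μ ^ N * (k * q.y ^ N - k * p.x ^ N) := by ring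
    have e2 : k * (q.μ ^ N * (p.y ^ N - q.x ^ N)) =
        q.μ ^ N * (k * p.y ^ N - k * q.x ^ N) := by ring
    rw [e1, e2, hp.2.1, hp.2.2, hq.2.1, hq.2.2]
    field_simp
    ring
  · obtain ⟨z, φ, hz⟩ := exists_starGauge hN hS
    exact hz.regW p hp q hq h

lemma regWbar_of_pottsCurve (hN : 2 ≤ N) (hS : IsPottsCurve N S) (hp : p ∈ S) (hq : q ∈ S)
    (h : q.y ^ N ≠ p.y ^ N) : RegWbar N p q := by
  rcases hS with ⟨k, k', hk, -, h1, h2, rfl⟩ | hS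
  · refine ⟨hp.1, hq.1, h, mul_left_cancel₀ (ne_zero_of_curveW hk h1 h2) ?_⟩
    have h3 := pow_ne_zero N hp.1
    have h4 := pow_ne_zero N hq.1
    have e1 : k * ((p.μ * q.μ) ^ N * (p.x ^ N - q.x ^ N)) =
        p.μ ^ N * q.μ ^ N * (k * p.x ^ N - k * q.x ^ N) := by ring
    have e2 : k * (q.y ^ N - p.y ^ N) = k * q.y ^ N - k * p.y ^ N := by ring
    rw [e1, e2, hp.2.1, hp.2.2, hq.2.1, hq.2.2]
    field_simp
    ring
  · obtain ⟨z, φ, hz⟩ := exists_starGauge hN hS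
    exact hz.regWbar p hp q hq h

lemma curvePlus_y_pow_ne (hp : p ∈ curvePlus N) : p.y ^ N ≠ 1 := by
  intro h
  have := hp.2.2
  rw [h, sub_self] at this
  exact pow_ne_zero N hp.1 this

lemma curveMinus_x_pow_ne (hp : p ∈ curveMinus N) : p.x ^ N ≠ 1 := by
  intro h
  have := hp.2.2
  rw [h, sub_self] at this
  exact inv_ne_zero (pow_ne_zero N hp.1) this

lemma curveMinus_mul (hp : p ∈ curveMinus N) : p.μ ^ N * (1 - p.x ^ N) = 1 := by
  rw [← hp.2.2, mul_inv_cancel₀ (pow_ne_zero N hp.1)]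

lemma curveMinus_y_ne_zero (hp : p ∈ curveMinus N) : p.y ≠ 0 := by
  intro h
  have := hp.2.1
  rw [h, zero_pow (NeZero.ne N)] at this
  exact zero_ne_one this

lemma regW_curvePlus (hp : p ∈ curvePlus N) (hq : q ∈ curvePlus N) : RegW N p q := by
  refine ⟨hp.1, hq.1, ?_, ?_⟩
  · rw [hq.2.1]
    exact (curvePlus_y_pow_ne hp).symm
  · rw [hp.2.1, hq.2.1, hp.2.2, hq.2.2]
    ring

lemma regW_curveMinus (hp : p ∈ curveMinus N) (hq : q ∈ curveMinus N) : RegW N p q := by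
  refine ⟨hp.1, hq.1, ?_, ?_⟩
  · rw [hp.2.1]
    exact curveMinus_x_pow_ne hq
  · rw [hp.2.1, hq.2.1, curveMinus_mul hp, curveMinus_mul hq]

lemma regWbar_curvePlus_curveMinus (hp : p ∈ curvePlus N) (hq : q ∈ curveMinus N) :
    RegWbar N p q := by
  refine ⟨hp.1, hq.1, ?_, ?_⟩
  · rw [hq.2.1]
    exact (curvePlus_y_pow_ne hp).symm
  · rw [mul_pow, hp.2.1, hq.2.1, mul_assoc, curveMinus_mul hq, hp.2.2, mul_one]

lemma regWbar_curveMinus_curvePlus (hp : p ∈ curveMinus N) (hq : q ∈ curvePlus N) :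
    RegWbar N p q := by
  refine ⟨hp.1, hq.1, ?_, ?_⟩
  · rw [hp.2.1]
    exact curvePlus_y_pow_ne hq
  · rw [mul_pow, hp.2.1, hq.2.1, hq.2.2]
    linear_combination -(1 - q.y ^ N) * curveMinus_mul hp

end Curves

/-! ### Reduction of the non-generic models -/

section Reduction

variable {N : ℕ} [NeZero N]

/-- Conjugation by a diagonal matrix of scalars does not change the trace. -/
lemma chainTrace_diagonal_gauge (L : ℕ) [NeZero L] {α : Type} [Fintype α]
    {M M' : α → α → SiteOp N} (g : α → ℂ) (hg : ∀ a, g a ≠ 0)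
    (h : ∀ a b, M' a b = ((g a)⁻¹ * g b) • M a b) : chainTrace L M' = chainTrace L M := by
  ext j j'
  simp only [chainTrace, Matrix.of_apply, h, Matrix.smul_apply, smul_eq_mul]
  refine Finset.sum_congr rfl fun i _ => ?_
  rw [Finset.prod_mul_distrib, Finset.prod_mul_distrib, prod_shift fun l => g (i l),
    Finset.prod_inv_distrib, inv_mul_cancel₀ (Finset.prod_ne_zero_iff.mpr fun l _ => hg _), one_mul]

/-- The rescaling is absorbed by `b'`, and the factor `ν` by the conjugation with `diag (1, ν⁻¹)`. -/
lemma tau2_gaugeScale (P : LParams) {lam ν : ℂ} (hlam : lam ≠ 0) (hν : ν ≠ 0) (L : ℕ) [NeZero L]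
    (t : ℂ) : tau2 N P L t = tau2 N (P.gaugeScale lam ν) L (lam * t) := by
  have e1 : (lam * ν⁻¹ * P.b') * (ν * P.b) = lam * (P.b' * P.b) := by
    field_simp
  have key : ∀ w, lam * w / (lam * (P.b' * P.b)) = w / (P.b' * P.b) := fun w =>
    mul_div_mul_left _ _ hlam
  have hA : opA N (P.gaugeScale lam ν) (omega N * (lam * t)) = opA N P (omega N * t) := by
    have : omega N * (lam * t) * (P.c / (lam * (P.b' * P.b))) =
        omega N * t * (P.c / (P.b' * P.b)) := by
      rw [← key P.c]
      ring
    simp only [opA, LParams.gaugeScale, e1, this]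
  have hB : opB N (P.gaugeScale lam ν) (omega N * (lam * t)) = ν⁻¹ • opB N P (omega N * t) := by
    have h1 : 1 / (ν * P.b) = ν⁻¹ * (1 / P.b) := by
      rw [one_div, mul_inv, one_div]
    have h2 : omega N * (lam * ν⁻¹ * P.a * P.c / (lam * (P.b' * P.b))) =
        ν⁻¹ * (omega N * (P.a * P.c / (P.b' * P.b))) := by
      rw [← key (P.a * P.c)]
      ring
    simp only [opB, LParams.gaugeScale, e1, h1, h2, mul_smul, ← smul_sub, Matrix.smul_mul]
  have hC : opC N (P.gaugeScale lam ν) (omega N * (lam * t)) = ν • opC N P (omega N * t) := by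
    have h1 : 1 / (lam * ν⁻¹ * P.b') = lam⁻¹ * ν * (1 / P.b') := by
      rw [one_div, mul_inv, mul_inv, inv_inv, one_div]
    have h2 : ν * P.a' * P.c / (lam * (P.b' * P.b)) =
        lam⁻¹ * ν * (P.a' * P.c / (P.b' * P.b)) := by
      rw [← key (P.a' * P.c)]
      field_simp
    have h3 : -(omega N * (lam * t)) * (lam⁻¹ * ν) = ν * -(omega N * t) := by
      field_simp
    simp only [opC, LParams.gaugeScale, e1, h1, h2, mul_smul (lam⁻¹ * ν), ← smul_sub,
      Matrix.smul_mul]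
    rw [smul_smul, h3, mul_smul]
  have hD : opD N (P.gaugeScale lam ν) (omega N * (lam * t)) = opD N P (omega N * t) := by
    have h1 : omega N * (lam * t) * (1 / (lam * (P.b' * P.b))) =
        omega N * t * (1 / (P.b' * P.b)) := by
      rw [← key 1]
      ring
    have h2 : ν * P.a' * (lam * ν⁻¹ * P.a) * P.c / (lam * (P.b' * P.b)) =
        P.a' * P.a * P.c / (P.b' * P.b) := by
      rw [← key]
      field_simp
    simp only [opD, LParams.gaugeScale, e1, h1, h2]
  unfold tau2
  rw [eq_comm]
  refine chainTrace_diagonal_gauge L ![1, ν⁻¹] (fun a => ?_) fun a b => ?_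
  · fin_cases a
    · exact one_ne_zero
    · exact inv_ne_zero hν
  · fin_cases a <;> fin_cases b <;> simp [lOp, hA, hB, hC, hD, hν]

lemma reducesTo_mk (P : LParams) {lam ν μ μ' : ℂ} (hlam : lam ≠ 0) (hν : ν ≠ 0)
    (hμ : μ * μ' = P.c) :
    ReducesTo N P ⟨lam * ν⁻¹ * P.a, ν * P.b, μ⟩ ⟨ν * P.a', lam * ν⁻¹ * P.b', μ'⟩ lam ν := by
  have h : P.gaugeScale lam ν =
      rapParams ⟨lam * ν⁻¹ * P.a, ν * P.b, μ⟩ ⟨ν * P.a', lam * ν⁻¹ * P.b', μ'⟩ := by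
    simp only [LParams.gaugeScale, rapParams, hμ]
  exact ⟨hlam, hν, h, fun L _ t => h ▸ tau2_gaugeScale P hlam hν L t⟩

/-- Gauge and scale factors with prescribed `N`-th powers of `lam / ν` and `ν`. -/
lemma exists_gauge {α n : ℂ} (hα : α ≠ 0) (hn : n ≠ 0) : ∃ lam ν : ℂ, lam ≠ 0 ∧ ν ≠ 0 ∧
    (∀ w, (lam * ν⁻¹ * w) ^ N = α * w ^ N) ∧ ∀ w, (ν * w) ^ N = n * w ^ N := by
  obtain ⟨ν, hν⟩ := IsAlgClosed.exists_pow_nat_eq n (NeZero.pos N)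
  obtain ⟨m, hm⟩ := IsAlgClosed.exists_pow_nat_eq α (NeZero.pos N)
  have hν0 : ν ≠ 0 := by
    rintro rfl
    rw [zero_pow (NeZero.ne N)] at hν
    exact hn hν.symm
  have hm0 : m ≠ 0 := by
    rintro rfl
    rw [zero_pow (NeZero.ne N)] at hm
    exact hα hm.symm
  refine ⟨m * ν, ν, mul_ne_zero hm0 hν0, hν0, fun w => ?_, fun w => ?_⟩
  · rw [mul_inv_cancel_right₀ hν0, mul_pow, hm]
  · rw [mul_pow, hν]

lemma exists_root {w : ℂ} (hw : w ≠ 0) : ∃ μ : ℂ, μ ≠ 0 ∧ μ ^ N = w := by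
  obtain ⟨μ, hμ⟩ := IsAlgClosed.exists_pow_nat_eq w (NeZero.pos N)
  refine ⟨μ, ?_, hμ⟩
  rintro rfl
  rw [zero_pow (NeZero.ne N)] at hμ
  exact hw hμ.symm

variable {P : LParams}

/-- `ν = 1` is possible; then `b ^ N + lam ^ N a ^ N = 0` fixes `lam`. -/
lemma exists_reducesTo_curveZero (hP : P.Nonvanishing) (hC : P.c ^ N = 1)
    (h : P.b ^ N * P.b' ^ N = P.a ^ N * P.a' ^ N) :
    ∃ lam ν : ℂ, ∃ p ∈ curveZero N 1, ∃ p' ∈ curveZero N 1, ReducesTo N P p p' lam ν := by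
  obtain ⟨ha, hb, ha', hb', hc⟩ := hP
  have hA := pow_ne_zero N ha
  have hB := pow_ne_zero N hb
  obtain ⟨lam, ν, hl, hν, h1, h2⟩ := exists_gauge (N := N) (α := -(P.b ^ N / P.a ^ N)) (n := 1)
    (neg_ne_zero.mpr (div_ne_zero hB hA)) one_ne_zero
  refine ⟨lam, ν, _, ⟨?_, ?_⟩, _, ⟨?_, ?_⟩, reducesTo_mk P hl hν (mul_one P.c)⟩
  · simp only [h1, h2]
    field_simp
    ring
  · exact hC
  · simp only [h1, h2]
    field_simp
    linear_combination -h
  · exact one_pow N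

/-- The two equations `x ^ N + y ^ N = 1` are linear in the two factors. -/
lemma exists_reducesTo_curveFermat (hP : P.NoPseudovacuum N) (hC : P.c ^ N = 1)
    (h : P.b ^ N * P.b' ^ N ≠ P.a ^ N * P.a' ^ N) :
    ∃ lam ν : ℂ, ∃ p ∈ curveFermat N, ∃ p' ∈ curveFermat N, ReducesTo N P p p' lam ν := by
  unfold LParams.NoPseudovacuum at hP
  rw [hC, one_mul, one_mul, mul_ne_zero_iff] at hP
  have hd : P.a ^ N * P.a' ^ N - P.b ^ N * P.b' ^ N ≠ 0 := sub_ne_zero.mpr h.symm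
  obtain ⟨lam, ν, hl, hν, h1, h2⟩ := exists_gauge (N := N) (div_ne_zero hP.1 hd)
    (div_ne_zero hP.2 hd)
  refine ⟨lam, ν, _, ⟨?_, ?_⟩, _, ⟨?_, ?_⟩, reducesTo_mk P hl hν (mul_one P.c)⟩
  · simp only [h1, h2]
    rw [div_mul_eq_mul_div, div_mul_eq_mul_div, ← add_div, div_eq_one_iff_eq hd]
    ring
  · exact hC
  · simp only [h1, h2]
    rw [div_mul_eq_mul_div, div_mul_eq_mul_div, ← add_div, div_eq_one_iff_eq hd]
    ring
  · exact one_pow N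

/-- The equations `x ^ N + y ^ N = x ^ N y ^ N` are linear in the inverses of the two factors. The
product of the resulting `μ_p ^ N = 1 - y_p ^ N` and `μ_{p'} ^ N = 1 - y_{p'} ^ N` is `c ^ N`. -/
lemma exists_reducesTo_curveProd (hP : P.Nonvanishing) (hP' : P.NoPseudovacuum N)
    (hC : P.c ^ N ≠ 1) (h : P.b ^ N * P.b' ^ N = P.c ^ N * P.a ^ N * P.a' ^ N) :
    ∃ lam ν : ℂ, ∃ p ∈ curveProd N, ∃ p' ∈ curveProd N, ReducesTo N P p p' lam ν := by
  obtain ⟨ha, hb, ha', hb', hc⟩ := hP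
  obtain ⟨h3, h4⟩ := mul_ne_zero_iff.mp hP'
  have hA := pow_ne_zero N ha
  have hB := pow_ne_zero N hb
  have hA' := pow_ne_zero N ha'
  have hB' := pow_ne_zero N hb'
  set A := P.a ^ N with hAdef
  set B := P.b ^ N with hBdef
  set A' := P.a' ^ N with hAdef'
  set B' := P.b' ^ N with hBdef'
  set C := P.c ^ N with hCdef
  have hd : A * A' - B * B' ≠ 0 := by
    rw [h]
    have : A * A' - C * A * A' = A * A' * (1 - C) := by ring
    rw [this]
    exact mul_ne_zero (mul_ne_zero hA hA') (sub_ne_zero.mpr hC.symm)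
  have h5 : A - B' ≠ 0 := by
    intro h0
    refine h3 (mul_left_cancel₀ hA ?_)
    rw [mul_zero]
    linear_combination -h - B * h0
  have h6 : A' - B ≠ 0 := by
    intro h0
    refine h4 (mul_left_cancel₀ hA' ?_)
    rw [mul_zero]
    linear_combination -h - B' * h0
  obtain ⟨lam, ν, hl, hν, h1, h2⟩ := exists_gauge (N := N)
    (α := (A * A' - B * B') / ((A' - B) * (A * B'))) (n := (A * A' - B * B') / ((A - B') * (A' * B)))
    (div_ne_zero hd (mul_ne_zero h6 (mul_ne_zero hA hB')))
    (div_ne_zero hd (mul_ne_zero h5 (mul_ne_zero hA' hB)))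
  have e1 : 1 - (A * A' - B * B') / ((A - B') * (A' * B)) * B =
      B' * (B - A') / ((A - B') * A') := by
    field_simp
    ring
  have e2 : 1 - (A * A' - B * B') / ((A' - B) * (A * B')) * B' =
      B * (B' - A) / ((A' - B) * A) := by
    field_simp
    ring
  have e3 : 1 - (A * A' - B * B') / ((A - B') * (A' * B)) * B ≠ 0 := by
    rw [e1]
    refine div_ne_zero (mul_ne_zero hB' ?_) (mul_ne_zero h5 hA')
    rw [← neg_sub]
    exact neg_ne_zero.mpr h6
  obtain ⟨μ, hμ, hμN⟩ := exists_root (N := N) e3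
  refine ⟨lam, ν, _, ⟨?_, ?_⟩, _, ⟨?_, ?_⟩, reducesTo_mk P hl hν (mul_div_cancel₀ P.c hμ)⟩
  · simp only [h1, h2]
    field_simp
    ring
  · simp only [h2, hμN]
    rfl
  · simp only [h1, h2]
    field_simp
    ring
  · simp only [h1, _root_.div_pow, hμN, ← hBdef', ← hCdef]
    rw [div_eq_iff e3, e1, e2]
    field_simp
    linear_combination -(A' - B) * (A - B') * h

/-- `y_p ^ N = 1` fixes one factor, and `c ^ N = (1 - y_{p'} ^ N) / (1 - x_p ^ N)` the other one. -/
lemma exists_reducesTo_curveMinus_curvePlus (hP : P.Nonvanishing) (hP' : P.NoPseudovacuum N)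
    (hC : P.c ^ N ≠ 1) (h : P.a' ^ N = P.b ^ N) (hne : P.a ^ N ≠ P.b' ^ N) :
    ∃ lam ν : ℂ, ∃ p ∈ curveMinus N, ∃ p' ∈ curvePlus N, ReducesTo N P p p' lam ν := by
  obtain ⟨ha, hb, ha', hb', hc⟩ := hP
  obtain ⟨h3, h4⟩ := mul_ne_zero_iff.mp hP'
  have hB := pow_ne_zero N hb
  obtain ⟨lam, ν, hl, hν, h1, h2⟩ := exists_gauge (N := N)
    (div_ne_zero (sub_ne_zero.mpr hC) h4) (inv_ne_zero hB)
  have e1 : 1 - (P.c ^ N - 1) / (P.c ^ N * P.a ^ N - P.b' ^ N) * P.a ^ N =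
      (P.a ^ N - P.b' ^ N) / (P.c ^ N * P.a ^ N - P.b' ^ N) := by
    field_simp
    ring
  have e2 : 1 - (P.c ^ N - 1) / (P.c ^ N * P.a ^ N - P.b' ^ N) * P.a ^ N ≠ 0 := by
    rw [e1]
    exact div_ne_zero (sub_ne_zero.mpr hne) h4
  obtain ⟨μ, hμ, hμN⟩ := exists_root (N := N) (inv_ne_zero e2)
  refine ⟨lam, ν, _, ⟨?_, ?_, ?_⟩, _, ⟨?_, ?_, ?_⟩,
    reducesTo_mk P hl hν (mul_div_cancel₀ P.c hμ)⟩
  · exact hμ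
  · rw [h2, inv_mul_cancel₀ hB]
  · rw [h1, hμN, inv_inv]
  · exact div_ne_zero hc hμ
  · rw [h2, h, inv_mul_cancel₀ hB]
  · rw [h1, _root_.div_pow, hμN, div_inv_eq_mul, e1]
    field_simp
    ring

/-- `x_p ^ N = 1` fixes one factor, and `c ^ N = (1 - y_p ^ N) / (1 - x_{p'} ^ N)` the other one. -/
lemma exists_reducesTo_curvePlus_curveMinus (hP : P.Nonvanishing) (hP' : P.NoPseudovacuum N)
    (hC : P.c ^ N ≠ 1) (h : P.a ^ N = P.b' ^ N) (hne : P.a' ^ N ≠ P.b ^ N) :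
    ∃ lam ν : ℂ, ∃ p ∈ curvePlus N, ∃ p' ∈ curveMinus N, ReducesTo N P p p' lam ν := by
  obtain ⟨ha, hb, ha', hb', hc⟩ := hP
  obtain ⟨h3, h4⟩ := mul_ne_zero_iff.mp hP'
  have hA := pow_ne_zero N ha
  have hCc := pow_ne_zero N hc
  obtain ⟨lam, ν, hl, hν, h1, h2⟩ := exists_gauge (N := N) (inv_ne_zero hA)
    (div_ne_zero (sub_ne_zero.mpr hC) h3)
  have e1 : 1 - (P.c ^ N - 1) / (P.c ^ N * P.a' ^ N - P.b ^ N) * P.b ^ N =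
      P.c ^ N * (P.a' ^ N - P.b ^ N) / (P.c ^ N * P.a' ^ N - P.b ^ N) := by
    field_simp
    ring
  have e2 : 1 - (P.c ^ N - 1) / (P.c ^ N * P.a' ^ N - P.b ^ N) * P.b ^ N ≠ 0 := by
    rw [e1]
    exact div_ne_zero (mul_ne_zero hCc (sub_ne_zero.mpr hne)) h3
  obtain ⟨μ, hμ, hμN⟩ := exists_root (N := N) e2
  refine ⟨lam, ν, _, ⟨?_, ?_, ?_⟩, _, ⟨?_, ?_, ?_⟩,
    reducesTo_mk P hl hν (mul_div_cancel₀ P.c hμ)⟩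
  · exact hμ
  · rw [h1, inv_mul_cancel₀ hA]
  · rw [h2, hμN]
  · exact div_ne_zero hc hμ
  · rw [h1, ← h, inv_mul_cancel₀ hA]
  · rw [h2, _root_.div_pow, hμN, inv_div, e1]
    field_simp
    ring

lemma exists_gauge_to_one (hP : P.Nonvanishing) (h : P.a' ^ N = P.b ^ N)
    (h' : P.a ^ N = P.b' ^ N) : ∃ lam ν : ℂ, lam ≠ 0 ∧ ν ≠ 0 ∧
      (P.gaugeScale lam ν).a ^ N = 1 ∧ (P.gaugeScale lam ν).b ^ N = 1 ∧
      (P.gaugeScale lam ν).a' ^ N = 1 ∧ (P.gaugeScale lam ν).b' ^ N = 1 := by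
  obtain ⟨ha, hb, -⟩ := hP
  have hA := pow_ne_zero N ha
  have hB := pow_ne_zero N hb
  obtain ⟨lam, ν, hl, hν, h1, h2⟩ := exists_gauge (N := N) (inv_ne_zero hA) (inv_ne_zero hB)
  refine ⟨lam, ν, hl, hν, ?_, ?_, ?_, ?_⟩
  · exact (h1 _).trans (inv_mul_cancel₀ hA)
  · exact (h2 _).trans (inv_mul_cancel₀ hB)
  · exact (h2 _).trans (by rw [h, inv_mul_cancel₀ hB])
  · exact (h1 _).trans (by rw [← h', inv_mul_cancel₀ hA])

end Reduction

/-! ### XXZ chains of cyclic representations -/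

section WeylAlgebra

variable {N : ℕ} [NeZero N]

lemma eq_of_mulVec_apply {A B : SiteOp N} (h : ∀ v n, (A *ᵥ v) n = (B *ᵥ v) n) : A = B :=
  Matrix.mulVec_injective (funext fun v => funext fun n => h v n)

lemma weylX_pow_mulVec (k : ℕ) (v : ZMod N → ℂ) (n : ZMod N) :
    ((weylX N ^ k) *ᵥ v) n = v (n - k) := by
  induction k generalizing n with
  | zero => simp
  | succ k ih =>
    rw [pow_succ', ← Matrix.mulVec_mulVec, weylX_mulVec, ih]
    congr 1
    push_cast
    ring

lemma weylX_pow_N : weylX N ^ N = 1 :=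
  eq_of_mulVec_apply fun v n => by rw [weylX_pow_mulVec]; simp

lemma weylZ_mulVec (v : ZMod N → ℂ) (n : ZMod N) : (weylZ N *ᵥ v) n = omegaZ N n * v n := by
  rw [weylZ, Matrix.mulVec_diagonal]

lemma weylZ_inv_mulVec (v : ZMod N → ℂ) (n : ZMod N) :
    ((weylZ N)⁻¹ *ᵥ v) n = (omegaZ N n)⁻¹ * v n := by
  rw [weylZ_inv, Matrix.mulVec_diagonal]

lemma weylZ_mul_weylX : weylZ N * weylX N = omega N • (weylX N * weylZ N) := by
  refine eq_of_mulVec_apply fun v n => ?_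
  have := omega_ne_zero (N := N)
  simp only [Matrix.smul_mulVec, ← Matrix.mulVec_mulVec, Pi.smul_apply, weylX_mulVec, weylZ_mulVec,
    smul_eq_mul, omegaZ_sub, omegaZ_one]
  field_simp

lemma weylZ_inv_mul_weylX :
    (weylZ N)⁻¹ * weylX N = (omega N)⁻¹ • (weylX N * (weylZ N)⁻¹) := by
  refine eq_of_mulVec_apply fun v n => ?_
  have := omega_ne_zero (N := N)
  have := omegaZ_ne_zero n
  simp only [Matrix.smul_mulVec, ← Matrix.mulVec_mulVec, Pi.smul_apply, weylX_mulVec,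
    weylZ_inv_mulVec, smul_eq_mul, omegaZ_sub, omegaZ_one]
  field_simp

lemma weylZ_pow_N : weylZ N ^ N = 1 := by
  rw [weylZ, Matrix.diagonal_pow, ← Matrix.diagonal_one]
  congr 1
  funext n
  exact omegaZ_pow_N n

lemma weylZ_inv_pow_N : (weylZ N)⁻¹ ^ N = 1 := by
  rw [Matrix.inv_pow', weylZ_pow_N, inv_one]

variable {R : Type*} [Ring R] [Algebra ℂ R]

lemma pow_mul_of_mul_eq_smul {A B : R} {ζ : ℂ} (h : A * B = ζ • (B * A)) (k : ℕ) :
    A ^ k * B = ζ ^ k • (B * A ^ k) := by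
  induction k with
  | zero => simp
  | succ k ih =>
    rw [pow_succ, mul_assoc, h, mul_smul_comm, ← mul_assoc, ih, smul_mul_assoc, smul_smul,
      mul_assoc, pow_succ']

lemma mul_pow_of_mul_eq_smul {A B : R} {ζ : ℂ} (hζ : ζ ≠ 0) (h : A * B = ζ • (B * A)) (k : ℕ) :
    ∃ c : ℂ, c ≠ 0 ∧ (B * A) ^ k = c • (B ^ k * A ^ k) := by
  induction k with
  | zero => exact ⟨1, one_ne_zero, by simp⟩
  | succ k ih =>
    obtain ⟨c, hc, ih⟩ := ih
    refine ⟨c * ζ ^ k, mul_ne_zero hc (pow_ne_zero k hζ), ?_⟩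
    rw [pow_succ, ih, smul_mul_assoc, mul_assoc, ← mul_assoc (A ^ k), pow_mul_of_mul_eq_smul h,
      smul_mul_assoc, mul_smul_comm, smul_smul, mul_assoc, ← pow_succ, ← mul_assoc, ← pow_succ]

/-- If `Y X = ζ X Y`, moving all factors `Y` to the right in `((1 - a X) Y) ^ N` produces the
product of the factors `1 - a ζ ^ j X`, that is `1 - a ^ N X ^ N`. -/
lemma one_sub_smul_mul_pow {X Y : R} {ζ a : ℂ} (hζ : ζ ^ N = 1)
    (hprod : ∀ x : ℂ, ∏ j ∈ Finset.range N, (1 - ζ ^ (j + 1) * x) = 1 - x ^ N)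
    (h : Y * X = ζ • (X * Y)) (hX : X ^ N = 1) :
    ((1 - a • X) * Y) ^ N = (1 - a ^ N) • Y ^ N := by
  have hζ0 : ζ ≠ 0 := ne_zero_of_pow_eq_one hζ
  set F : ℕ → Polynomial ℂ := fun k =>
    ∏ j ∈ Finset.range k, (1 - Polynomial.C (a * ζ ^ j) * Polynomial.X) with hF
  have key : ∀ k, ((1 - a • X) * Y) ^ k = Polynomial.aeval X (F k) * Y ^ k := by
    intro k
    induction k with
    | zero => simp [hF]
    | succ k ih =>
      have h1 : Polynomial.aeval X (F (k + 1)) =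
          Polynomial.aeval X (F k) * (1 - (a * ζ ^ k) • X) := by
        simp only [hF]
        rw [Finset.prod_range_succ, map_mul]
        simp [Algebra.smul_def]
      have h2 : Y ^ k * (1 - a • X) = (1 - (a * ζ ^ k) • X) * Y ^ k := by
        rw [mul_sub, mul_smul_comm, pow_mul_of_mul_eq_smul h, smul_smul, sub_mul, smul_mul_assoc,
          mul_one, one_mul]
      rw [pow_succ, ih, h1, pow_succ Y k, mul_assoc, ← mul_assoc (Y ^ k), h2]
      simp only [mul_assoc]
  have hFN : F N = 1 - Polynomial.C (a ^ N) * Polynomial.X ^ N := by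
    refine Polynomial.funext fun r => ?_
    have h1 := hprod (a * ζ⁻¹ * r)
    have h2 : (a * ζ⁻¹ * r) ^ N = a ^ N * r ^ N := by
      rw [mul_pow, mul_pow, inv_pow, hζ, inv_one, mul_one]
    rw [h2] at h1
    simp only [hF, Polynomial.eval_prod, Polynomial.eval_sub, Polynomial.eval_one,
      Polynomial.eval_mul, Polynomial.eval_C, Polynomial.eval_X, Polynomial.eval_pow]
    rw [← h1]
    refine Finset.prod_congr rfl fun j _ => ?_
    rw [pow_succ]
    field_simp
  rw [key, hFN]
  simp [hX, sub_mul, Algebra.smul_def]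

lemma prod_one_sub_omega (x : ℂ) :
    ∏ j ∈ Finset.range N, (1 - omega N ^ (j + 1) * x) = 1 - x ^ N := by
  rw [prod_range_sub_omega, one_pow]

lemma prod_one_sub_omega_inv (x : ℂ) :
    ∏ j ∈ Finset.range N, (1 - (omega N)⁻¹ ^ (j + 1) * x) = 1 - x ^ N := by
  have h1 := prod_range_eq_prod_zmod (N := N) fun n => 1 - omegaZ N (-n) * x
  rw [Fintype.prod_equiv (Equiv.neg (ZMod N)) (fun n => 1 - omegaZ N (-n) * x)
    (fun n => 1 - omegaZ N n * x) fun n => rfl, prod_sub_omegaZ_mul, one_pow] at h1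
  rw [← h1]
  refine Finset.prod_congr rfl fun j _ => ?_
  have : ((j : ZMod N) + 1) = ((j + 1 : ℕ) : ZMod N) := by push_cast; rfl
  rw [this, omegaZ_neg, omegaZ_natCast, inv_pow]

end WeylAlgebra

section XXZ

variable {N : ℕ} [NeZero N]

lemma qPar_sq (hodd : Odd N) : qPar N ^ 2 = omega N := by
  obtain ⟨m, hm⟩ := hodd
  have h : (N + 1) / 2 * 2 = N + 1 := by omega
  rw [qPar, ← pow_mul, h, pow_succ, omega_pow, one_mul]

lemma qPar_pow : qPar N ^ N = 1 := by
  rw [qPar, ← pow_mul, mul_comm, pow_mul, omega_pow, one_pow]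

lemma qPar_ne_zero : qPar N ≠ 0 := pow_ne_zero _ omega_ne_zero

lemma qPar_sub_inv_ne_zero (hN : 2 ≤ N) (hodd : Odd N) : qPar N - (qPar N)⁻¹ ≠ 0 := by
  intro h0
  have h1 := qPar_ne_zero (N := N)
  have h2 : qPar N ^ 2 = 1 := by
    have : qPar N * (qPar N - (qPar N)⁻¹) = 0 := by rw [h0, mul_zero]
    rw [mul_sub, mul_inv_cancel₀ h1, sub_eq_zero] at this
    rw [sq, this]
  rw [qPar_sq hodd] at h2
  exact isPrimitiveRoot_omega.ne_one (by omega) h2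

/-- `1 / 2` modulo the odd number `N`. -/
def halfZ (N : ℕ) : ZMod N := ((N + 1) / 2 : ℕ)

lemma halfZ_add_halfZ (hodd : Odd N) : halfZ N + halfZ N = 1 := by
  obtain ⟨m, hm⟩ := hodd
  have h : (N + 1) / 2 + (N + 1) / 2 = N + 1 := by omega
  rw [halfZ, ← Nat.cast_add, h]
  simp

lemma omegaZ_halfZ : omegaZ N (halfZ N) = qPar N := omegaZ_natCast _

lemma opKhalfInv_mulVec (v : ZMod N → ℂ) (n : ZMod N) :
    (opKhalfInv N *ᵥ v) n = v (n - halfZ N) := weylX_pow_mulVec _ v n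

lemma opKhalf_mulVec (hodd : Odd N) (v : ZMod N → ℂ) (n : ZMod N) :
    (opKhalf N *ᵥ v) n = v (n + halfZ N) := by
  obtain ⟨m, hm⟩ := hodd
  have h : (N - 1) / 2 + (N + 1) / 2 = N := by omega
  rw [opKhalf, weylX_pow_mulVec, sub_eq_add_neg]
  congr 2
  have := congrArg (Nat.cast : ℕ → ZMod N) h
  push_cast at this
  rw [ZMod.natCast_self] at this
  rw [neg_eq_iff_add_eq_zero]
  exact this

lemma weylX_mulVec_half (hodd : Odd N) (v : ZMod N → ℂ) (n : ZMod N) :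
    (weylX N *ᵥ v) n = v (n - halfZ N - halfZ N) := by
  rw [weylX_mulVec, sub_sub, halfZ_add_halfZ hodd]

/-- With `1 = 1/2 + 1/2` modulo `N`, all shifts become multiples of `halfZ`. -/
lemma opE_mulVec (hodd : Odd N) (σ : ℂ) (v : ZMod N → ℂ) (n : ZMod N) :
    (opE N σ *ᵥ v) n = (qPar N - (qPar N)⁻¹)⁻¹ * (omegaZ N n *
      (v (n + halfZ N) - σ⁻¹ * (qPar N)⁻¹ ^ 2 * v (n - halfZ N))) := by
  simp only [opE, Matrix.smul_mulVec, ← Matrix.mulVec_mulVec, Matrix.sub_mulVec, Matrix.one_mulVec,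
    Pi.smul_apply, Pi.sub_apply, smul_eq_mul, weylX_mulVec_half hodd, weylZ_mulVec,
    opKhalf_mulVec hodd, omegaZ_sub, omegaZ_halfZ, sub_add_cancel]
  ring

lemma opF_mulVec (hodd : Odd N) (σ : ℂ) (v : ZMod N → ℂ) (n : ZMod N) :
    (opF N σ *ᵥ v) n = -(qPar N - (qPar N)⁻¹)⁻¹ * ((omegaZ N n)⁻¹ *
      (v (n + halfZ N) - σ * qPar N ^ 2 * v (n - halfZ N))) := by
  have := qPar_ne_zero (N := N)
  have := omegaZ_ne_zero n
  simp only [opF, Matrix.smul_mulVec, ← Matrix.mulVec_mulVec, Matrix.sub_mulVec, Matrix.one_mulVec,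
    Pi.smul_apply, Pi.sub_apply, smul_eq_mul, weylX_mulVec_half hodd, weylZ_inv_mulVec,
    opKhalf_mulVec hodd, omegaZ_sub, omegaZ_halfZ, sub_add_cancel]
  congr 1
  field_simp

theorem isUqRep (hN : 2 ≤ N) (hodd : Odd N) {σ : ℂ} (hσ : σ ≠ 0) :
    IsUqRep N (qPar N) (opKhalf N) (opKhalfInv N) (opE N σ) (opF N σ) := by
  have hq := qPar_ne_zero (N := N)
  have hd := qPar_sub_inv_ne_zero hN hodd
  refine ⟨?_, ?_, ?_, ?_, ?_⟩ <;> refine eq_of_mulVec_apply fun v n => ?_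
  · simp only [← Matrix.mulVec_mulVec, opKhalf_mulVec hodd, opKhalfInv_mulVec, Matrix.one_mulVec,
      add_sub_cancel_right]
  · simp only [← Matrix.mulVec_mulVec, opKhalf_mulVec hodd, opKhalfInv_mulVec, Matrix.one_mulVec,
      sub_add_cancel]
  · simp only [← Matrix.mulVec_mulVec, opKhalf_mulVec hodd, opKhalfInv_mulVec, Matrix.smul_mulVec,
      Pi.smul_apply, smul_eq_mul, opE_mulVec hodd, add_sub_cancel_right, omegaZ_add, omegaZ_halfZ]
    ring
  · simp only [← Matrix.mulVec_mulVec, opKhalf_mulVec hodd, opKhalfInv_mulVec, Matrix.smul_mulVec,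
      Pi.smul_apply, smul_eq_mul, opF_mulVec hodd, add_sub_cancel_right, omegaZ_add, omegaZ_halfZ,
      mul_inv]
    ring
  · have e := omegaZ_ne_zero n
    simp only [← Matrix.mulVec_mulVec, opKhalf_mulVec hodd, opKhalfInv_mulVec, Matrix.smul_mulVec,
      Matrix.sub_mulVec, Pi.sub_apply, Pi.smul_apply, smul_eq_mul, opE_mulVec hodd,
      opF_mulVec hodd, add_sub_cancel_right, sub_add_cancel, omegaZ_add, omegaZ_sub, omegaZ_halfZ]
    set d := qPar N - (qPar N)⁻¹ with hd'
    have hdd : qPar N ^ 2 - 1 = qPar N * d := by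
      rw [hd', mul_sub, mul_inv_cancel₀ hq]
      ring
    field_simp
    linear_combination σ * (v (n + halfZ N + halfZ N) - v (n - halfZ N - halfZ N)) * hdd

lemma chainTrace_mul_siteProduct (L : ℕ) [NeZero L] {α : Type} [Fintype α] (M : α → α → SiteOp N)
    (K : SiteOp N) : chainTrace L M * siteProduct L K = chainTrace L fun a b => M a b * K := by
  ext j j'
  rw [chainTrace_mul_of_prod M _ j' (fun l k => K k (j' l)) fun _ => rfl, chainTrace_apply]
  rfl

lemma chainTrace_smul (L : ℕ) [NeZero L] {α : Type} [Fintype α] (M : α → α → SiteOp N) (s : ℂ) :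
    chainTrace L (fun a b => s • M a b) = s ^ L • chainTrace L M := by
  ext j j'
  simp only [chainTrace, Matrix.of_apply, Matrix.smul_apply, smul_eq_mul, Finset.prod_mul_distrib,
    Finset.prod_const, Finset.card_univ, Fintype.card_fin, Finset.mul_sum]

/-- Multiplication by `K^{1/2}` from the right, the gauge transformation `diag (1, s)` and a factor
`s⁻¹` identify the two `L`-operators. -/
theorem xxzTransfer_eq (hN : 2 ≤ N) (hodd : Odd N) {σ s : ℂ} (hσ : σ ≠ 0) (hs : s ≠ 0) (L : ℕ)
    [NeZero L] : xxzTransfer N L σ s = (s⁻¹) ^ L •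
      (tau2 N (xxzParams N σ) L ((omega N)⁻¹ * s ^ 2) * siteProduct L (opKhalf N)) := by
  have hw := omega_ne_zero (N := N)
  have hd := qPar_sub_inv_ne_zero hN hodd
  have hX : weylX N * opKhalf N = opKhalfInv N := by
    obtain ⟨m, hm⟩ := hodd
    rw [opKhalf, opKhalfInv, ← pow_succ']
    congr 1
    omega
  unfold tau2 xxzTransfer
  rw [mul_inv_cancel_left₀ hw]
  refine Eq.trans ?_ (congrArg (fun M => (s⁻¹) ^ L • M)
    (chainTrace_mul_siteProduct L (lOp N (xxzParams N σ) (s ^ 2)) (opKhalf N)).symm)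
  refine Eq.trans ?_ (chainTrace_smul L _ _)
  refine chainTrace_diagonal_gauge L ![1, s] (fun a => ?_) fun a b => ?_
  · fin_cases a
    · exact one_ne_zero
    · exact hs
  have e1 : s⁻¹ * s ^ 2 = s := by field_simp
  fin_cases a <;> fin_cases b
  · simp [lOp, xxzL, opA, xxzParams, Matrix.sub_mul, hX, smul_sub, smul_smul, e1]
  · simp only [lOp, xxzL, opB, opE, xxzParams]
    simp [smul_smul, hd, hs, hw]
  · simp only [lOp, xxzL, opC, opF, xxzParams]
    have e2 : s⁻¹ * (s⁻¹ * s ^ 2) = 1 := by field_simp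
    simp [smul_smul, hd, e2]
  · have e3 : omega N * (σ * ((omega N)⁻¹ * σ⁻¹)) = 1 := by field_simp
    simp [lOp, xxzL, opD, xxzParams, Matrix.add_mul, hX, smul_add, smul_smul, e1, e3, hs]
    abel

lemma opE_pow (hN : 2 ≤ N) (hodd : Odd N) {σ : ℂ} (hσ : σ ^ N ≠ 1) :
    ∃ e : ℂ, e ≠ 0 ∧ opE N σ ^ N = e • (1 : SiteOp N) := by
  have hw := omega_ne_zero (N := N)
  have hX : (weylX N ^ ((N - 1) / 2)) ^ N = 1 := by
    rw [← pow_mul, mul_comm, pow_mul, weylX_pow_N, one_pow]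
  have h1 : weylX N * weylZ N = (omega N)⁻¹ • (weylZ N * weylX N) := by
    rw [weylZ_mul_weylX, smul_smul, inv_mul_cancel₀ hw, one_smul]
  obtain ⟨c, hc, h2⟩ := mul_pow_of_mul_eq_smul (pow_ne_zero _ (inv_ne_zero hw))
    (pow_mul_of_mul_eq_smul h1 ((N - 1) / 2)) N
  rw [weylZ_pow_N, hX, mul_one] at h2
  have h3 : weylZ N * opKhalf N * weylX N = omega N • (weylX N * (weylZ N * opKhalf N)) := by
    rw [opKhalf, mul_assoc, ← pow_succ, pow_succ', ← mul_assoc, weylZ_mul_weylX, smul_mul_assoc,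
      mul_assoc]
  have h4 := one_sub_smul_mul_pow (a := σ⁻¹) omega_pow prod_one_sub_omega h3 weylX_pow_N
  refine ⟨(qPar N - (qPar N)⁻¹)⁻¹ ^ N * ((1 - σ⁻¹ ^ N) * c), ?_, ?_⟩
  · refine mul_ne_zero (pow_ne_zero _ (inv_ne_zero (qPar_sub_inv_ne_zero hN hodd)))
      (mul_ne_zero (sub_ne_zero.mpr fun h => hσ ?_) hc)
    rw [inv_pow, eq_comm, inv_eq_one] at h
    exact h
  · rw [opE, smul_pow, mul_assoc, h4, opKhalf, h2, smul_smul, smul_smul, mul_assoc]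

lemma opF_pow (hN : 2 ≤ N) (hodd : Odd N) {σ : ℂ} (hσ : σ ^ N ≠ 1) :
    ∃ f : ℂ, f ≠ 0 ∧ opF N σ ^ N = f • (1 : SiteOp N) := by
  have hw := omega_ne_zero (N := N)
  have hX : (weylX N ^ ((N - 1) / 2)) ^ N = 1 := by
    rw [← pow_mul, mul_comm, pow_mul, weylX_pow_N, one_pow]
  have h1 : weylX N * (weylZ N)⁻¹ = omega N • ((weylZ N)⁻¹ * weylX N) := by
    rw [weylZ_inv_mul_weylX, smul_smul, mul_inv_cancel₀ hw, one_smul]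
  obtain ⟨c, hc, h2⟩ := mul_pow_of_mul_eq_smul (pow_ne_zero _ hw)
    (pow_mul_of_mul_eq_smul h1 ((N - 1) / 2)) N
  rw [weylZ_inv_pow_N, hX, mul_one] at h2
  have h3 : (weylZ N)⁻¹ * opKhalf N * weylX N =
      (omega N)⁻¹ • (weylX N * ((weylZ N)⁻¹ * opKhalf N)) := by
    rw [opKhalf, mul_assoc, ← pow_succ, pow_succ', ← mul_assoc, weylZ_inv_mul_weylX, smul_mul_assoc,
      mul_assoc]
  have h4 := one_sub_smul_mul_pow (a := σ) (by rw [inv_pow, omega_pow, inv_one])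
    prod_one_sub_omega_inv h3 weylX_pow_N
  refine ⟨(-(qPar N - (qPar N)⁻¹)⁻¹) ^ N * ((1 - σ ^ N) * c), ?_, ?_⟩
  · exact mul_ne_zero (pow_ne_zero _
      (neg_ne_zero.mpr (inv_ne_zero (qPar_sub_inv_ne_zero hN hodd))))
      (mul_ne_zero (sub_ne_zero.mpr fun h => hσ h.symm) hc)
  · rw [opF, smul_pow, mul_assoc, h4, opKhalf, h2, smul_smul, smul_smul, mul_assoc]

lemma xxzParams_noPseudovacuum {σ : ℂ} (hσ : σ ^ N ≠ 1) :
    (xxzParams N σ).NoPseudovacuum N := by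
  simp only [LParams.NoPseudovacuum, xxzParams, one_pow, one_mul, mul_pow, inv_pow, omega_pow,
    inv_one]
  refine mul_ne_zero (sub_ne_zero.mpr hσ) (sub_ne_zero.mpr fun h => hσ ?_)
  rwa [inv_eq_one] at h

lemma xxzParams_not_generic {σ : ℂ} (hσ : σ ^ N ≠ 1) : ¬ (xxzParams N σ).Generic N := by
  simp only [LParams.Generic, xxzParams, one_pow]
  rintro (⟨-, h, -⟩ | ⟨h, -⟩)
  · exact hσ (sub_eq_zero.mp h).symm
  · exact h rfl

lemma xxzParams_reducesTo {σ lam ν : ℂ} (hlam : lam ≠ 0) (hν : ν ≠ 0) {p p' : Rapidity}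
    (hp : p = ⟨lam * ν⁻¹ * ((omega N)⁻¹ * σ⁻¹), ν, 1⟩) (hp' : p' = ⟨ν * σ, lam * ν⁻¹, 1⟩) :
    ReducesTo N (xxzParams N σ) p p' lam ν := by
  have := reducesTo_mk (N := N) (xxzParams N σ) (μ := 1) (μ' := 1) hlam hν (mul_one 1)
  simp only [xxzParams, mul_one] at this
  rw [hp, hp']
  exact this

lemma xxz_curveZero_of_pow_eq_I {σ κ ρ : ℂ} (hσ : σ ≠ 0) (hκ : κ ^ N = Complex.I)
    (hρ : ρ ^ 2 = σ) :
    ∃ p ∈ curveZero N 1, ∃ p' ∈ curveZero N 1, p = ⟨(omega N)⁻¹ * κ⁻¹ * ρ⁻¹, κ * ρ⁻¹, 1⟩ ∧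
      p' = ⟨κ * ρ, κ⁻¹ * ρ, 1⟩ ∧ ReducesTo N (xxzParams N σ) p p' 1 (κ * ρ⁻¹) := by
  have hκ0 : κ ≠ 0 := by
    rintro rfl
    rw [zero_pow (NeZero.ne N)] at hκ
    exact Complex.I_ne_zero hκ.symm
  have hρ0 : ρ ≠ 0 := by
    rintro rfl
    exact hσ (by rw [← hρ]; norm_num)
  refine ⟨_, ⟨?_, one_pow N⟩, _, ⟨?_, one_pow N⟩, rfl, rfl,
    xxzParams_reducesTo one_ne_zero (mul_ne_zero hκ0 (inv_ne_zero hρ0)) ?_ ?_⟩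
  · simp only [mul_pow, inv_pow, omega_pow, hκ, Complex.inv_I]
    ring
  · simp only [mul_pow, inv_pow, hκ, Complex.inv_I]
    ring
  · rw [← hρ]
    congr 1
    field_simp
  · rw [← hρ]
    congr 1 <;> field_simp

lemma xxz_curveZero_of_pow_eq_neg_one {σ θ : ℂ} (hσ : σ ≠ 0) (hθ : θ ^ N = -1) :
    ∃ p ∈ curveZero N 1, ∃ p' ∈ curveZero N 1, p = ⟨θ * (omega N)⁻¹, 1, 1⟩ ∧
      p' = ⟨σ, θ * σ, 1⟩ ∧ ReducesTo N (xxzParams N σ) p p' (θ * σ) 1 := by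
  have hθ0 : θ ≠ 0 := by
    rintro rfl
    rw [zero_pow (NeZero.ne N)] at hθ
    norm_num at hθ
  refine ⟨_, ⟨?_, one_pow N⟩, _, ⟨?_, one_pow N⟩, rfl, rfl,
    xxzParams_reducesTo (mul_ne_zero hθ0 hσ) one_ne_zero ?_ ?_⟩
  · simp only [mul_pow, inv_pow, omega_pow, hθ, one_pow]
    ring
  · simp only [mul_pow, hθ]
    ring
  · congr 1
    field_simp
  · congr 1 <;> simp

end XXZ

end ChiralPotts

theorem mainTheorem3 (N : ℕ) [NeZero N] (hN : 2 ≤ N) :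
    -- identification and relations on the chiral Potts and the self-dual curves
    (∀ S : Set Rapidity, IsPottsCurve N S →
      ∀ p ∈ S, ∀ p' ∈ S, p.y ≠ 0 → p'.y ≠ 0 → ∀ q ∈ S,
        (RegularT N p p' q → RightIdentification N p p' q) ∧
        (RegularThat N p p' q → LeftIdentification N p p' q)) ∧
    -- commutation relation and commuting operators on the self-dual curves
    (∀ S : Set Rapidity, IsSelfDualCurve N S →
      ∀ p ∈ S, ∀ p' ∈ S, p.y ≠ 0 → p'.y ≠ 0 → Commutation N S p p') ∧
    -- the degenerate curve with two components
    (∀ p ∈ curveMinus N, ∀ p' ∈ curvePlus N, p'.y ≠ 0 →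
      (∀ q ∈ curveMinus N, RightIdentification N p p' q) ∧
      (∀ q ∈ curvePlus N, LeftIdentification N p p' q)) ∧
    (∀ p ∈ curvePlus N, ∀ p' ∈ curveMinus N, p.y ≠ 0 →
      (∀ q ∈ curvePlus N, RightIdentification N p p' q) ∧
      (∀ q ∈ curveMinus N, LeftIdentification N p p' q)) ∧
    -- reduction of the non-generic models
    (∀ P : LParams, P.Nonvanishing → P.NoPseudovacuum N → ¬ P.Generic N →
      (P.c ^ N = 1 ∧ P.b ^ N * P.b' ^ N = P.a ^ N * P.a' ^ N ∧
        ∃ lam ν : ℂ, ∃ p ∈ curveZero N 1, ∃ p' ∈ curveZero N 1, ReducesTo N P p p' lam ν) ∨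
      (P.c ^ N = 1 ∧ P.b ^ N * P.b' ^ N ≠ P.a ^ N * P.a' ^ N ∧
        ∃ lam ν : ℂ, ∃ p ∈ curveFermat N, ∃ p' ∈ curveFermat N, ReducesTo N P p p' lam ν) ∨
      (P.c ^ N ≠ 1 ∧ P.b ^ N * P.b' ^ N = P.c ^ N * P.a ^ N * P.a' ^ N ∧
        ∃ lam ν : ℂ, ∃ p ∈ curveProd N, ∃ p' ∈ curveProd N, ReducesTo N P p p' lam ν) ∨
      (P.c ^ N ≠ 1 ∧ P.a' ^ N = P.b ^ N ∧ P.a ^ N ≠ P.b' ^ N ∧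
        ∃ lam ν : ℂ, ∃ p ∈ curveMinus N, ∃ p' ∈ curvePlus N, ReducesTo N P p p' lam ν) ∨
      (P.c ^ N ≠ 1 ∧ P.a ^ N = P.b' ^ N ∧ P.a' ^ N ≠ P.b ^ N ∧
        ∃ lam ν : ℂ, ∃ p ∈ curvePlus N, ∃ p' ∈ curveMinus N, ReducesTo N P p p' lam ν) ∨
      (P.c ^ N ≠ 1 ∧ P.a' ^ N = P.b ^ N ∧ P.a ^ N = P.b' ^ N ∧
        ∃ lam ν : ℂ, lam ≠ 0 ∧ ν ≠ 0 ∧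
          (P.gaugeScale lam ν).a ^ N = 1 ∧ (P.gaugeScale lam ν).b ^ N = 1 ∧
          (P.gaugeScale lam ν).a' ^ N = 1 ∧ (P.gaugeScale lam ν).b' ^ N = 1)) ∧
    -- the XXZ chains of cyclic representations
    (Odd N → ∀ σ : ℂ, σ ≠ 0 →
      qPar N ^ 2 = omega N ∧ qPar N ^ N = 1 ∧
      IsUqRep N (qPar N) (opKhalf N) (opKhalfInv N) (opE N σ) (opF N σ) ∧
      (∀ (L : ℕ) [NeZero L] (s : ℂ), s ≠ 0 →
        xxzTransfer N L σ s =
          (s⁻¹) ^ L • (tau2 N (xxzParams N σ) L ((omega N)⁻¹ * s ^ 2) *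
            siteProduct L (opKhalf N))) ∧
      (σ ^ N ≠ 1 →
        (∃ e f : ℂ, e ≠ 0 ∧ f ≠ 0 ∧
          opE N σ ^ N = e • (1 : SiteOp N) ∧ opF N σ ^ N = f • (1 : SiteOp N)) ∧
        (xxzParams N σ).NoPseudovacuum N ∧ ¬ (xxzParams N σ).Generic N ∧
        (∀ κ ρ : ℂ, κ ^ N = Complex.I → ρ ^ 2 = σ →
          ∃ p ∈ curveZero N 1, ∃ p' ∈ curveZero N 1,
            p = ⟨(omega N)⁻¹ * κ⁻¹ * ρ⁻¹, κ * ρ⁻¹, 1⟩ ∧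
            p' = ⟨κ * ρ, κ⁻¹ * ρ, 1⟩ ∧
            ReducesTo N (xxzParams N σ) p p' 1 (κ * ρ⁻¹)) ∧
        (∀ θ : ℂ, θ ^ N = -1 →
          ∃ p ∈ curveZero N 1, ∃ p' ∈ curveZero N 1,
            p = ⟨θ * (omega N)⁻¹, 1, 1⟩ ∧
            p' = ⟨σ, θ * σ, 1⟩ ∧
            ReducesTo N (xxzParams N σ) p p' (θ * σ) 1))) := by
  refine ⟨fun S hS p hp p' hp' hy hy' q hq => ⟨fun h => ?_, fun h => ?_⟩,
    fun S hS p hp p' hp' hy hy' => ?_, fun p hp p' hp' hy' => ⟨fun q hq => ?_, fun q hq => ?_⟩,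
    fun p hp p' hp' hy => ⟨fun q hq => ?_, fun q hq => ?_⟩, fun P hP hP' hgen => ?_,
    fun hodd σ hσ => ⟨qPar_sq hodd, qPar_pow, isUqRep hN hodd hσ,
      fun L _ s hs => xxzTransfer_eq hN hodd hσ hs L, fun hσN => ⟨?_,
      xxzParams_noPseudovacuum hσN, xxzParams_not_generic hσN,
      fun κ ρ hκ hρ => xxz_curveZero_of_pow_eq_I hσ hκ hρ,
      fun θ hθ => xxz_curveZero_of_pow_eq_neg_one hσ hθ⟩⟩⟩
  · exact rightIdentification (regW_of_pottsCurve hN hS hp hq h.1)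
      (regWbar_of_pottsCurve hN hS hp' hq h.2) hy hy'
  · exact leftIdentification (regW_of_pottsCurve hN hS hp' hq h.2)
      (regWbar_of_pottsCurve hN hS hp hq h.1) hy hy'
  · obtain ⟨z, φ, hz⟩ := exists_starGauge hN hS
    exact hz.commutation hp hp' hy hy'
  · exact rightIdentification (regW_curveMinus hp hq) (regWbar_curvePlus_curveMinus hp' hq)
      (curveMinus_y_ne_zero hp) hy'
  · exact leftIdentification (regW_curvePlus hp' hq) (regWbar_curveMinus_curvePlus hp hq)
      (curveMinus_y_ne_zero hp) hy'
  · exact rightIdentification (regW_curvePlus hp hq) (regWbar_curveMinus_curvePlus hp' hq) hy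
      (curveMinus_y_ne_zero hp')
  · exact leftIdentification (regW_curveMinus hp' hq) (regWbar_curvePlus_curveMinus hp hq) hy
      (curveMinus_y_ne_zero hp')
  · by_cases hC : P.c ^ N = 1
    · by_cases h : P.b ^ N * P.b' ^ N = P.a ^ N * P.a' ^ N
      · exact Or.inl ⟨hC, h, exists_reducesTo_curveZero hP hC h⟩
      · exact Or.inr (Or.inl ⟨hC, h, exists_reducesTo_curveFermat hP' hC h⟩)
    by_cases h : P.b ^ N * P.b' ^ N = P.c ^ N * P.a ^ N * P.a' ^ N
    · exact Or.inr (Or.inr (Or.inl ⟨hC, h, exists_reducesTo_curveProd hP hP' hC h⟩))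
    by_cases h₁ : P.a' ^ N = P.b ^ N
    · by_cases h₂ : P.a ^ N = P.b' ^ N
      · exact Or.inr (Or.inr (Or.inr (Or.inr (Or.inr ⟨hC, h₁, h₂, exists_gauge_to_one hP h₁ h₂⟩))))
      · exact Or.inr (Or.inr (Or.inr (Or.inl ⟨hC, h₁, h₂,
          exists_reducesTo_curveMinus_curvePlus hP hP' hC h₁ h₂⟩)))
    by_cases h₂ : P.a ^ N = P.b' ^ N
    · exact Or.inr (Or.inr (Or.inr (Or.inr (Or.inl ⟨hC, h₂, h₁,
        exists_reducesTo_curvePlus_curveMinus hP hP' hC h₂ h₁⟩))))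
    -- none of the factors in the genericity criterion vanishes
    refine absurd (Or.inr ⟨hC, ?_⟩) hgen
    obtain ⟨h₃, h₄⟩ := mul_ne_zero_iff.mp hP'
    refine mul_ne_zero (mul_ne_zero (mul_ne_zero (mul_ne_zero ?_ ?_) ?_) ?_) ?_
    · exact sub_ne_zero.mpr (Ne.symm h₁)
    · exact sub_ne_zero.mpr (Ne.symm h₂)
    · exact fun h0 => h₃ (by linear_combination -h0)
    · exact fun h0 => h₄ (by linear_combination -h0)
    · exact fun h0 => h (by linear_combination h0)
  · obtain ⟨e, he, h₁⟩ := opE_pow hN hodd hσN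
    obtain ⟨f, hf, h₂⟩ := opF_pow hN hodd hσN
    exact ⟨e, f, he, hf, h₁, h₂⟩
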